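/- **Setting.** Let $\mathbb{T}^d=(\mathbb{R}/\mathbb{Z})^d$, let $(V,\mu)$ be a probability space, $a\in L^\infty(V;\mathbb{R}^d)$, $L^2_{x,v}=L^2(\mathbb{T}^d\times V,dx\otimes d\mu)$ with scalar product $(\cdot,\cdot)$, and let $L^2(V;H^1(\mathbb{T}^d))$ be the space of $f\in L^2_{x,v}$ whose weak derivatives $\partial_{x_i}f$ are in $L^2_{x,v}$, normed by $\|f\|^2_{L^2(H^1)}=\|f\|^2_{L^2}+\sum_i\|\partial_if\|^2_{L^2}$. Put $Lf=\int_Vf\,d\mu-f$ and $Af=a(v)\cdot\nabla_xf$; $A$ generates the group $(e^{\tau A}f)(x,v)=f(x+\tau a(v),v)$. Let $(\Omega,\mathcal{F},\mathbb{P})$ be a probability space with a filtration $(\mathcal{F}_t)_{t\in\mathbb{R}}$, and let $m=(m(t))_{t\in\mathbb{R}}$ be an adapted, jointly measurable, stationary, stochastically continuous, homogeneous Markov process with values in a bounded subset $E$ of $W^{1,\infty}(\mathbb{T}^d)$ and with transition semigroup $(P_t)_{t\ge0}$. Let $M$ be its infinitesimal generator, $M\psi(n)=\lim_{t\to0+}(P_t\psi(n)-\psi(n))/t$.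 Let $D_M\subset C_b(E)$ be a set such that, for every $\psi\in D_M$, $M\psi$ is well defined and $\psi(m(t))-\int_0^tM\psi(m(s))\,ds$, $t\ge0$, is a continuous integrable $(\mathcal{F}_t)$-martingale. (Adaptedness is always understood up to null sets, and continuity of a process means that almost all of its paths are continuous.) For $\varepsilon>0$ put $m^\varepsilon(t)=m(\varepsilon^{-2}t)$ and $\mathcal{F}^\varepsilon_t=\mathcal{F}_{\varepsilon^{-2}t}$. Let $f_0^\varepsilon\in L^2(V;H^1(\mathbb{T}^d))$, and let $f^\varepsilon$ be the solution of $$\partial_tf^\varepsilon+\tfrac1\varepsilon a(v)\cdot\nabla_xf^\varepsilon=\tfrac1{\varepsilon^2}Lf^\varepsilon+\tfrac1\varepsilon f^\varepsilon m^\varepsilon,\qquad f^\varepsilon(0)=f^\varepsilon_0,$$ in the mild sense: almost surely, $f^\varepsilon\in C([0,\infty);L^2_{x,v})$ and, for all $t\ge0$, $$f^\varepsilon(t)=e^{-\frac t\varepsilon A}f_0^\varepsilon+\int_0^te^{-\frac{t-s}\varepsilon A}\Big(\tfrac1{\varepsilon^2}Lf^\varepsilon(s)+\tfrac1\varepsilon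 f^\varepsilon(s)m^\varepsilon(s)\Big)ds .$$ A function $\Psi:L^2(V;H^1(\mathbb{T}^d))\times E\to\mathbb{R}$ is a *good test function* if it is differentiable in $f$ with differential $h\mapsto(h,D\Psi(f,n))$, $D\Psi(f,n)\in L^2_{x,v}$; if $D\Psi$ is continuous from $L^2(V;H^1(\mathbb{T}^d))\times E$ to $L^2_{x,v}$ and maps bounded sets to bounded sets; if $(f,n)\mapsto M\Psi(f,n):=M(\Psi(f,\cdot))(n)$ is continuous and maps bounded sets to bounded sets; and if $\Psi(f,\cdot)\in D_M$ for every $f$. For such $\Psi$ let $$\mathscr{L}^\varepsilon\Psi(f,n)=\tfrac1\varepsilon\big(-(Af,D\Psi(f,n))+(fn,D\Psi(f,n))\big)+\tfrac1{\varepsilon^2}\big((Lf,D\Psi(f,n))+M\Psi(f,n)\big).$$ **Proposition.** Let $\Psi$ be a good test function. Then, almost surely, $f^\varepsilon(t)\in L^2(V;H^1(\mathbb{T}^d))$ for all $t\ge0$ and $s\mapsto\mathscr{L}^\varepsilon\Psi(f^\varepsilon(s),m^\varepsilon(s))$ is integrable on bounded intervals of $[0,\infty)$, and $$M^\varepsilon_\Psi(t)=\Psi(f^\varepsilon(t),m^\varepsilon(t))-\int_0^t\mathscr{L}^\varepsilon\Psi(f^\varepsilon(s),m^\varepsilon(s))\,ds,\qquad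 t\ge0,$$ is a continuous integrable $(\mathcal{F}^\varepsilon_t)$-martingale. If $|\Psi|^2$ is also a good test function (so that $\mathscr{L}^\varepsilon|\Psi|^2$ is defined), its quadratic variation is $$\langle M^\varepsilon_\Psi,M^\varepsilon_\Psi\rangle(t)=\int_0^t\big(\mathscr{L}^\varepsilon|\Psi|^2-2\Psi\mathscr{L}^\varepsilon\Psi\big)(f^\varepsilon(s),m^\varepsilon(s))\,ds,$$ that is, the right-hand side is a well-defined adapted process, null at $0$, with continuous nondecreasing paths, and $|M^\varepsilon_\Psi|^2-\langle M^\varepsilon_\Psi,M^\varepsilon_\Psi\rangle$ is a continuous integrable $(\mathcal{F}^\varepsilon_t)$-martingale. -/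

import Mathlib

open MeasureTheory ProbabilityTheory Filter Topology Set
open scoped NNReal ENNReal BoundedContinuousFunction

noncomputable section

namespace KineticDiffusion

/-! ### Function spaces on the torus -/

/-- The torus `𝕋^d = (ℝ/ℤ)^d`, with its normalised Lebesgue measure `volume`. -/
abbrev Torus (d : ℕ) : Type := UnitAddTorus (Fin d)

/-- `HasWeakDeriv i u g`: the integrable function `g` is the weak derivative `∂_i u` of the
integrable function `u` on the torus: `∫ u ∂_i φ = - ∫ g φ` for every smooth (periodic) `φ`.
In the test, `φ'` is the classical `i`-th partial derivative of `φ`. -/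
structure HasWeakDeriv {d : ℕ} (i : Fin d) (u g : Torus d → ℝ) : Prop where
  integrable_fun : Integrable u volume
  integrable_deriv : Integrable g volume
  integral_eq : ∀ φ φ' : C(Torus d, ℝ),
    ContDiff ℝ ((⊤ : ℕ∞) : WithTop ℕ∞)
      (fun y : Fin d → ℝ => φ (fun j => (y j : UnitAddCircle))) →
    (∀ x : Torus d,
      HasDerivAt (fun s : ℝ => φ (x + Pi.single i (s : UnitAddCircle))) (φ' x) 0) →
    ∫ x, u x * φ' x = - ∫ x, g x * φ x

section WeakDeriv

variable {d : ℕ} {i : Fin d} {u u' g g' : Torus d → ℝ}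

theorem integrable_mul_test (hu : Integrable u volume) (φ : C(Torus d, ℝ)) :
    Integrable (fun x => u x * φ x) volume :=
  hu.mul_bdd (c := ‖φ‖) φ.continuous.aestronglyMeasurable
    (Eventually.of_forall fun x => φ.norm_coe_le_norm x)

theorem HasWeakDeriv.zero : HasWeakDeriv i (fun _ : Torus d => (0 : ℝ)) (fun _ => 0) :=
  ⟨integrable_zero _ _ _, integrable_zero _ _ _, by intros; simp⟩

theorem HasWeakDeriv.add (h : HasWeakDeriv i u g) (h' : HasWeakDeriv i u' g') :
    HasWeakDeriv i (fun x => u x + u' x) (fun x => g x + g' x) := by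
  refine ⟨h.1.add h'.1, h.2.add h'.2, fun φ φ' hφ hd => ?_⟩
  simp only [add_mul]
  rw [integral_add (integrable_mul_test h.1 φ') (integrable_mul_test h'.1 φ'),
    integral_add (integrable_mul_test h.2 φ) (integrable_mul_test h'.2 φ),
    h.3 φ φ' hφ hd, h'.3 φ φ' hφ hd]
  ring

theorem HasWeakDeriv.const_mul (c : ℝ) (h : HasWeakDeriv i u g) :
    HasWeakDeriv i (fun x => c * u x) (fun x => c * g x) := by
  refine ⟨h.1.const_mul c, h.2.const_mul c, fun φ φ' hφ hd => ?_⟩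
  simp only [mul_assoc, integral_const_mul, h.3 φ φ' hφ hd, mul_neg]

theorem HasWeakDeriv.congr (h : HasWeakDeriv i u g) (hu : u =ᵐ[volume] u')
    (hg : g =ᵐ[volume] g') : HasWeakDeriv i u' g' := by
  refine ⟨h.1.congr hu, h.2.congr hg, fun φ φ' hφ hd => ?_⟩
  have h1 : ∫ x, u' x * φ' x = ∫ x, u x * φ' x :=
    integral_congr_ae (hu.mono fun x hx => by simp only [hx])
  have h2 : ∫ x, g' x * φ x = ∫ x, g x * φ x :=
    integral_congr_ae (hg.mono fun x hx => by simp only [hx])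
  rw [h1, h2]
  exact h.3 φ φ' hφ hd

end WeakDeriv

/-- `W^{1,∞}(𝕋^d)`: pairs `(n, ∇n)` of an `L^∞` function and its weak gradient in `L^∞`, with the
norm `max (‖n‖_∞, max_i ‖∂_i n‖_∞)`. -/
def W1inf (d : ℕ) :
    Submodule ℝ (Lp ℝ ⊤ (volume : Measure (Torus d)) ×
      (Fin d → Lp ℝ ⊤ (volume : Measure (Torus d)))) where
  carrier := {p | ∀ i, HasWeakDeriv i (p.1 : Torus d → ℝ) (p.2 i : Torus d → ℝ)}
  zero_mem' := fun _ =>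
    HasWeakDeriv.zero.congr (Lp.coeFn_zero _ _ _).symm (Lp.coeFn_zero _ _ _).symm
  add_mem' := fun {_ _} hp hq i =>
    ((hp i).add (hq i)).congr (Lp.coeFn_add _ _).symm (Lp.coeFn_add _ _).symm
  smul_mem' := fun c _ hp i =>
    ((hp i).const_mul c).congr (Lp.coeFn_smul c _).symm (Lp.coeFn_smul c _).symm

/-- `W^{1,∞}(𝕋^d)` carries the Borel σ-algebra of its norm. -/
instance (d : ℕ) : MeasurableSpace (W1inf d) := borel _

instance (d : ℕ) : BorelSpace (W1inf d) := ⟨rfl⟩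

section Kinetic

variable {V : Type*} [MeasurableSpace V]

/-- `L²_{x,v} = L²(𝕋^d × V, dx ⊗ dμ)`. -/
abbrev L2xv (d : ℕ) (μ : Measure V) : Type _ :=
  Lp ℝ 2 ((volume : Measure (Torus d)).prod μ)

theorem ae_slice {d : ℕ} {μ : Measure V} [IsProbabilityMeasure μ] {p : Torus d × V → Prop}
    (h : ∀ᵐ z ∂(volume : Measure (Torus d)).prod μ, p z) :
    ∀ᵐ v ∂μ, ∀ᵐ x ∂(volume : Measure (Torus d)), p (x, v) :=
  Measure.ae_ae_of_ae_prod (p := fun z : V × Torus d => p (z.2, z.1))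
    ((Measure.measurePreserving_swap (μ := μ)
      (ν := (volume : Measure (Torus d)))).quasiMeasurePreserving.ae h)

/-- `L²(V; H¹(𝕋^d))`: pairs `(f, ∇_x f)` of functions in `L²_{x,v}` such that, for almost every
`v`, `∂_i f(·, v)` is the weak derivative of `f(·, v)`. The norm is
`(‖f‖² + ∑_i ‖∂_i f‖²)^{1/2}`. -/
def L2H1 (d : ℕ) (μ : Measure V) [IsProbabilityMeasure μ] :
    Submodule ℝ (WithLp 2 (L2xv d μ × PiLp 2 (fun _ : Fin d => L2xv d μ))) where
  carrier := {p | ∀ i : Fin d, ∀ᵐ v ∂μ,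
    HasWeakDeriv i (fun x => p.fst (x, v)) (fun x => p.snd i (x, v))}
  zero_mem' := fun i => by
    filter_upwards [ae_slice (Lp.coeFn_zero ℝ 2 ((volume : Measure (Torus d)).prod μ))]
      with v hv
    exact HasWeakDeriv.zero.congr (hv.mono fun x hx => hx.symm) (hv.mono fun x hx => hx.symm)
  add_mem' := fun {p q} hp hq i => by
    filter_upwards [hp i, hq i, ae_slice (Lp.coeFn_add p.fst q.fst),
      ae_slice (Lp.coeFn_add (p.snd i) (q.snd i))] with v h1 h2 h3 h4
    exact (h1.add h2).congr (h3.mono fun x hx => hx.symm) (h4.mono fun x hx => hx.symm)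
  smul_mem' := fun c p hp i => by
    filter_upwards [hp i, ae_slice (Lp.coeFn_smul c p.fst),
      ae_slice (Lp.coeFn_smul c (p.snd i))] with v h1 h2 h3
    exact (h1.const_mul c).congr (h2.mono fun x hx => hx.symm) (h3.mono fun x hx => hx.symm)

variable {d : ℕ} {μ : Measure V} [IsProbabilityMeasure μ]

/-- The inclusion `L²(V; H¹(𝕋^d)) → L²_{x,v}`. -/
def toL2 : L2H1 d μ →L[ℝ] L2xv d μ :=
  (WithLp.fstL 2 ℝ (L2xv d μ) (PiLp 2 (fun _ : Fin d => L2xv d μ))).comp (L2H1 d μ).subtypeL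

/-- The element of `L²(V; H¹(𝕋^d))` given by `f ∈ L²_{x,v}` if `f` has weak derivatives in
`L²_{x,v}` (and `0` otherwise). -/
def toH1 (f : L2xv d μ) : L2H1 d μ :=
  open Classical in if h : ∃ u : L2H1 d μ, toL2 u = f then h.choose else 0

/-! ### The operators of the kinetic equation -/

theorem memLp_average (f : L2xv d μ) :
    MemLp (fun p : Torus d × V => ∫ w, f (p.1, w) ∂μ) 2
      ((volume : Measure (Torus d)).prod μ) := by
  have hf : MemLp f 2 ((volume : Measure (Torus d)).prod μ) := Lp.memLp f
  have hsq : Integrable (fun p => f p ^ 2) ((volume : Measure (Torus d)).prod μ) := hf.integrable_sq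
  have hm : AEStronglyMeasurable (fun x : Torus d => ∫ w, f (x, w) ∂μ) volume :=
    hf.1.integral_prod_right'
  have h2 : MemLp (fun x : Torus d => ∫ w, f (x, w) ∂μ) 2 volume := by
    rw [memLp_two_iff_integrable_sq hm]
    refine hsq.integral_prod_left.mono' (hm.pow 2) ?_
    filter_upwards [hsq.prod_right_ae, hf.1.prodMk_left] with x hx hx'
    have hL : MemLp (fun w => f (x, w)) 2 μ := (memLp_two_iff_integrable_sq hx').2 hx
    have hI : Integrable (fun w => f (x, w)) μ := hL.integrable (by norm_num)
    rw [Real.norm_of_nonneg (sq_nonneg _)]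
    set c := ∫ w, f (x, w) ∂μ with hc
    have h0 : 0 ≤ ∫ w, (f (x, w) - c) ^ 2 ∂μ := integral_nonneg fun w => sq_nonneg _
    have h1 : ∫ w, (f (x, w) - c) ^ 2 ∂μ = (∫ w, f (x, w) ^ 2 ∂μ) - c ^ 2 := by
      have : ∀ w, (f (x, w) - c) ^ 2 = f (x, w) ^ 2 - (2 * c * f (x, w) - c ^ 2) := by
        intro w; ring
      simp only [this]
      have e1 : ∫ w, (2 * c * f (x, w) - c ^ 2) ∂μ = c ^ 2 := by
        rw [integral_sub (hI.const_mul _) (integrable_const _), integral_const_mul, ← hc]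
        simp
        ring
      have e2 : Integrable (fun w => 2 * c * f (x, w) - c ^ 2) μ :=
        (hI.const_mul _).sub (integrable_const _)
      rw [integral_sub hx e2, e1]
    linarith
  exact h2.comp_measurePreserving measurePreserving_fst

/-- The collision operator `L f = ∫_V f dμ - f`. -/
def collision (f : L2xv d μ) : L2xv d μ := (memLp_average f).toLp _ - f

theorem memLp_mulNoise (f : L2xv d μ) (n : Lp ℝ ⊤ (volume : Measure (Torus d))) :
    MemLp (fun p : Torus d × V => f p * n p.1) 2 ((volume : Measure (Torus d)).prod μ) := by
  have hfst : MeasurePreserving Prod.fst ((volume : Measure (Torus d)).prod μ) volume :=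
    measurePreserving_fst
  have hn : MemLp (fun p : Torus d × V => n p.1) ⊤ ((volume : Measure (Torus d)).prod μ) :=
    (Lp.memLp n).comp_measurePreserving hfst
  exact hn.mul (Lp.memLp f)

/-- The product `f n` of `f ∈ L²_{x,v}` and `n ∈ W^{1,∞}(𝕋^d)`. -/
def mulNoise (f : L2xv d μ) (n : W1inf d) : L2xv d μ :=
  (memLp_mulNoise f n.1.1).toLp _

theorem memLp_advection (a : Lp (EuclideanSpace ℝ (Fin d)) ⊤ μ) (g : Fin d → L2xv d μ) :
    MemLp (fun p : Torus d × V => ∑ i, a p.2 i * g i p) 2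
      ((volume : Measure (Torus d)).prod μ) := by
  refine memLp_finsetSum _ fun i _ => ?_
  have hb : ∀ᵐ v ∂μ, ‖a v‖ ≤ (eLpNormEssSup a μ).toReal := by
    have hlt : eLpNormEssSup a μ < ⊤ := by simpa using (Lp.memLp a).2
    filter_upwards [enorm_ae_le_eLpNormEssSup a μ] with v hv
    simpa using (ENNReal.toReal_mono hlt.ne hv)
  have ha : Measurable fun v => a v i :=
    (EuclideanSpace.proj (𝕜 := ℝ) i).continuous.measurable.comp (Lp.stronglyMeasurable a).measurable
  refine (Lp.memLp (g i)).of_le_mul (c := (eLpNormEssSup a μ).toReal)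
    ((ha.comp measurable_snd).aestronglyMeasurable.mul (Lp.memLp (g i)).1) ?_
  filter_upwards [(Measure.quasiMeasurePreserving_snd
    (μ := (volume : Measure (Torus d))) (ν := μ)).ae hb] with p hp
  rw [norm_mul]
  exact mul_le_mul_of_nonneg_right ((PiLp.norm_apply_le (a p.2) i).trans hp) (norm_nonneg _)

/-- The transport operator `A f = a(v) · ∇_x f` on `L²(V; H¹(𝕋^d))`. -/
def advection (a : Lp (EuclideanSpace ℝ (Fin d)) ⊤ μ) (u : L2H1 d μ) : L2xv d μ :=
  (memLp_advection a (fun i => u.1.snd i)).toLp _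

/-- The free flow `(x, v) ↦ (x + τ a(v), v)` on `𝕋^d × V`. -/
def freeFlow (a : Lp (EuclideanSpace ℝ (Fin d)) ⊤ μ) (τ : ℝ) (p : Torus d × V) : Torus d × V :=
  (p.1 + fun i => ((τ * a p.2 i : ℝ) : UnitAddCircle), p.2)

theorem measurePreserving_freeFlow (a : Lp (EuclideanSpace ℝ (Fin d)) ⊤ μ) (τ : ℝ) :
    MeasurePreserving (freeFlow a τ) ((volume : Measure (Torus d)).prod μ)
      ((volume : Measure (Torus d)).prod μ) := by
  have ha : ∀ i, Measurable fun v => a v i := fun i =>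
    (EuclideanSpace.proj (𝕜 := ℝ) i).continuous.measurable.comp (Lp.stronglyMeasurable a).measurable
  have hs : Measurable fun v => (fun i => ((τ * a v i : ℝ) : UnitAddCircle) : Torus d) :=
    measurable_pi_lambda _ fun i => (AddCircle.measurable_mk'.comp ((ha i).const_mul τ))
  have h := MeasurePreserving.skew_product (μc := (volume : Measure (Torus d)))
    (μd := (volume : Measure (Torus d))) (MeasurePreserving.id μ)
    (g := fun v x => x + (fun i => ((τ * a v i : ℝ) : UnitAddCircle) : Torus d))
    (measurable_snd.add (hs.comp measurable_fst))
    (Eventually.of_forall fun v => (measurePreserving_add_right volume _).map_eq)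
  exact (Measure.measurePreserving_swap.comp h).comp Measure.measurePreserving_swap

/-- The unitary group `e^{τA}` on `L²_{x,v}` generated by `A = a(v) · ∇_x`:
`(e^{τA} f)(x, v) = f(x + τ a(v), v)`. -/
def transport (a : Lp (EuclideanSpace ℝ (Fin d)) ⊤ μ) (τ : ℝ) (f : L2xv d μ) : L2xv d μ :=
  Lp.compMeasurePreserving (freeFlow a τ) (measurePreserving_freeFlow a τ) f

end Kinetic

/-! ### Martingales in continuous time -/

section Probability

variable {Ω : Type*} {mΩ : MeasurableSpace Ω}

/-- The filtration `(ℱ_t)_{t ≥ 0}` obtained from `(ℱ_t)_{t ∈ ℝ}`. -/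
def nonnegFiltration (ℱ : Filtration ℝ mΩ) : Filtration ℝ≥0 mΩ where
  seq t := ℱ (t : ℝ)
  mono' _ _ h := ℱ.mono (NNReal.coe_le_coe.2 h)
  le' t := ℱ.le t

/-- The filtration `ℱ^ε_t = ℱ_{ε⁻² t}`, `t ≥ 0`. -/
def scaledFiltration (ℱ : Filtration ℝ mΩ) (ε : ℝ) : Filtration ℝ≥0 mΩ where
  seq t := ℱ ((t : ℝ) / ε ^ 2)
  mono' _ _ h := ℱ.mono (div_le_div_of_nonneg_right (NNReal.coe_le_coe.2 h) (sq_nonneg ε))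
  le' _ := ℱ.le _

/-- `X` is a continuous integrable `(ℱ_t)`-martingale. Since the filtration is not assumed to be
complete, adaptedness is understood up to null sets: each `X_t` agrees almost surely with the
value at time `t` of a martingale. -/
structure IsContMartingale (X : ℝ≥0 → Ω → ℝ) (ℱ : Filtration ℝ≥0 mΩ) (P : Measure Ω) :
    Prop where
  integrable : ∀ t, Integrable (X t) P
  martingale : ∃ Y : ℝ≥0 → Ω → ℝ, Martingale Y ℱ P ∧ ∀ t, X t =ᵐ[P] Y t
  continuous_paths : ∀ᵐ ω ∂P, Continuous fun t => X t ω

/-- `A` is the quadratic variation `⟨X, X⟩` of the continuous martingale `X`: it is adapted (up to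
null sets), null at `0`, with continuous nondecreasing paths, and `X² - A` is a martingale. -/
structure IsQuadraticVariation (X A : ℝ≥0 → Ω → ℝ) (ℱ : Filtration ℝ≥0 mΩ)
    (P : Measure Ω) : Prop where
  adapted : ∀ t, AEStronglyMeasurable[ℱ t] (A t) P
  zero : ∀ᵐ ω ∂P, A 0 ω = 0
  monotone_paths : ∀ᵐ ω ∂P, Monotone fun t => A t ω
  continuous_paths : ∀ᵐ ω ∂P, Continuous fun t => A t ω
  martingale : IsContMartingale (fun t ω => X t ω ^ 2 - A t ω) ℱ P

/-! ### The driving process -/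

/-- The difference quotient `(P_t ψ(n) - ψ(n)) / t` of a transition semigroup. -/
def semigroupQuotient {E : Type*} [MeasurableSpace E] (Pt : ℝ≥0 → Kernel E E) (ψ : E → ℝ)
    (n : E) (t : ℝ≥0) : ℝ :=
  ((∫ y, ψ y ∂(Pt t n)) - ψ n) / (t : ℝ)

/-- `M ψ` is well defined: `(P_t ψ(n) - ψ(n)) / t` converges as `t → 0+`, for every `n`. -/
def InGeneratorDomain {E : Type*} [MeasurableSpace E] (Pt : ℝ≥0 → Kernel E E) (ψ : E → ℝ) :
    Prop :=
  ∀ n, ∃ l : ℝ, Tendsto (semigroupQuotient Pt ψ n) (𝓝[>] 0) (𝓝 l)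

/-- The infinitesimal generator `M` of `(P_t)`: `M ψ(n) = lim_{t → 0+} (P_t ψ(n) - ψ(n)) / t`. -/
def markovGenerator {E : Type*} [MeasurableSpace E] (Pt : ℝ≥0 → Kernel E E) (ψ : E → ℝ)
    (n : E) : ℝ :=
  limUnder (𝓝[>] 0) (semigroupQuotient Pt ψ n)

/-- The assumptions on the driving process: `m` is a (jointly measurable) stationary,
stochastically continuous, homogeneous Markov process for the filtration `(ℱ_t)`, with values in a
bounded subset `E` of `W^{1,∞}(𝕋^d)` and with transition semigroup `(P_t)`; and `D_M` is a set of
bounded continuous functions `ψ` on `E` for which `M ψ` is well defined and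
`ψ(m(t)) - ∫_0^t M ψ(m(s)) ds`, `t ≥ 0`, is a continuous integrable martingale. -/
structure IsDrivingProcess {d : ℕ} (P : Measure Ω) (ℱ : Filtration ℝ mΩ) (E : Set (W1inf d))
    (m : ℝ → Ω → E) (Pt : ℝ≥0 → Kernel E E) (DM : Set (E →ᵇ ℝ)) : Prop where
  bounded : Bornology.IsBounded E
  measurable : Measurable (Function.uncurry m)
  adapted : ∀ t, Measurable[ℱ t] (m t)
  stationary : ∀ h : ℝ, IdentDistrib (fun ω t => m (t + h) ω) (fun ω t => m t ω) P P
  stochasticallyContinuous : ∀ t, TendstoInMeasure P m (𝓝 t) (m t)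
  semigroup_markov : ∀ t, IsMarkovKernel (Pt t)
  semigroup_zero : Pt 0 = Kernel.id
  semigroup_add : ∀ s t, Pt (s + t) = Pt t ∘ₖ Pt s
  markov : ∀ (s : ℝ) (t : ℝ≥0) (B : Set E), MeasurableSet B →
    P[(m (s + t) ⁻¹' B).indicator (fun _ => (1 : ℝ)) | ℱ s] =ᵐ[P] fun ω => (Pt t (m s ω)).real B
  generator_wellDefined : ∀ ψ ∈ DM, InGeneratorDomain Pt ψ
  generator_martingale : ∀ ψ ∈ DM,
    IsContMartingale
      (fun t ω => ψ (m t ω) - ∫ s in (0 : ℝ)..t, markovGenerator Pt ψ (m s ω))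
      (nonnegFiltration ℱ) P

/-! ### The solution, good test functions and the generator -/

variable {V : Type*} [MeasurableSpace V] {d : ℕ} {μ : Measure V} [IsProbabilityMeasure μ]
  {E : Set (W1inf d)}

/-- `f` is a (mild) solution of
`∂_t f + ε⁻¹ a(v) · ∇_x f = ε⁻² L f + ε⁻¹ f m^ε`, `f(0) = f₀`, where `m^ε(t) = m(ε⁻² t)`:
almost surely, `f ∈ C([0,∞); L²_{x,v})` and, for all `t ≥ 0`,
`f(t) = e^{-tA/ε} f₀ + ∫_0^t e^{-(t-s)A/ε} (ε⁻² L f(s) + ε⁻¹ f(s) m^ε(s)) ds`. -/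
def IsSolution (P : Measure Ω) (a : Lp (EuclideanSpace ℝ (Fin d)) ⊤ μ) (m : ℝ → Ω → E) (ε : ℝ)
    (f₀ : L2xv d μ) (f : ℝ → Ω → L2xv d μ) : Prop :=
  ∀ᵐ ω ∂P, ContinuousOn (fun t => f t ω) (Ici 0) ∧
    ∀ t : ℝ, 0 ≤ t →
      f t ω = transport a (-(t / ε)) f₀ +
        ∫ s in (0 : ℝ)..t, transport a (-((t - s) / ε))
          ((ε ^ 2)⁻¹ • collision (f s ω) + ε⁻¹ • mulNoise (f s ω) (m (s / ε ^ 2) ω))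

/-- `g ∈ L²_{x,v}` is the gradient at `u` of `φ : L²(V; H¹) → ℝ`: the differential of `φ` at `u`
is `h ↦ (h, g)`. -/
def HasL2Gradient (φ : L2H1 d μ → ℝ) (g : L2xv d μ) (u : L2H1 d μ) : Prop :=
  HasFDerivAt φ ((innerSL ℝ g).comp toL2) u

/-- The gradient `DΨ(u, n) ∈ L²_{x,v}` with respect to the first variable (it is unique, as
`L²(V; H¹)` is dense in `L²_{x,v}`; the value is `0` if there is none). -/
def gradient (Ψ : L2H1 d μ → E → ℝ) (u : L2H1 d μ) (n : E) : L2xv d μ :=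
  open Classical in
  if h : ∃ g, HasL2Gradient (fun u' => Ψ u' n) g u then h.choose else 0

/-- Good test functions. -/
structure IsGoodTestFunction (Pt : ℝ≥0 → Kernel E E) (DM : Set (E →ᵇ ℝ))
    (Ψ : L2H1 d μ → E → ℝ) : Prop where
  differentiable : ∀ u n, ∃ g, HasL2Gradient (fun u' => Ψ u' n) g u
  continuous_gradient : Continuous fun p : L2H1 d μ × E => gradient Ψ p.1 p.2
  bounded_gradient : ∀ S : Set (L2H1 d μ × E), Bornology.IsBounded S →
    Bornology.IsBounded ((fun p => gradient Ψ p.1 p.2) '' S)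
  continuous_generator : Continuous fun p : L2H1 d μ × E => markovGenerator Pt (Ψ p.1) p.2
  bounded_generator : ∀ S : Set (L2H1 d μ × E), Bornology.IsBounded S →
    Bornology.IsBounded ((fun p => markovGenerator Pt (Ψ p.1) p.2) '' S)
  mem_domain : ∀ u, ∃ ψ ∈ DM, ⇑ψ = Ψ u

/-- `𝓛_{A*}Ψ(u, n) = -(A u, DΨ(u, n)) + (u n, DΨ(u, n))`. -/
def generatorA (a : Lp (EuclideanSpace ℝ (Fin d)) ⊤ μ) (Ψ : L2H1 d μ → E → ℝ)
    (u : L2H1 d μ) (n : E) : ℝ :=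
  -inner ℝ (advection a u) (gradient Ψ u n) + inner ℝ (mulNoise (toL2 u) n) (gradient Ψ u n)

/-- `𝓛_{L*}Ψ(u, n) = (L u, DΨ(u, n)) + MΨ(u, n)`. -/
def generatorL (Pt : ℝ≥0 → Kernel E E) (Ψ : L2H1 d μ → E → ℝ) (u : L2H1 d μ) (n : E) : ℝ :=
  inner ℝ (collision (toL2 u)) (gradient Ψ u n) + markovGenerator Pt (Ψ u) n

/-- The generator `𝓛^ε = ε⁻¹ 𝓛_{A*} + ε⁻² 𝓛_{L*}`. -/
def generator (a : Lp (EuclideanSpace ℝ (Fin d)) ⊤ μ) (Pt : ℝ≥0 → Kernel E E) (ε : ℝ)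
    (Ψ : L2H1 d μ → E → ℝ) (u : L2H1 d μ) (n : E) : ℝ :=
  ε⁻¹ * generatorA a Ψ u n + (ε ^ 2)⁻¹ * generatorL Pt Ψ u n

/-- `𝓛^ε|Ψ|² - 2 Ψ 𝓛^ε Ψ`. -/
def carreDuChamp (a : Lp (EuclideanSpace ℝ (Fin d)) ⊤ μ) (Pt : ℝ≥0 → Kernel E E) (ε : ℝ)
    (Ψ : L2H1 d μ → E → ℝ) (u : L2H1 d μ) (n : E) : ℝ :=
  generator a Pt ε (fun u' n' => Ψ u' n' ^ 2) u n - 2 * Ψ u n * generator a Pt ε Ψ u n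

/-- For `F : L²(V; H¹) × E → ℝ`, the process `t ↦ F(f(t), m^ε(t))`, `m^ε(t) = m(ε⁻² t)`. -/
def along (m : ℝ → Ω → E) (ε : ℝ) (f : ℝ → Ω → L2xv d μ) (F : L2H1 d μ → E → ℝ)
    (t : ℝ) (ω : Ω) : ℝ :=
  F (toH1 (f t ω)) (m (t / ε ^ 2) ω)

/-- `M^ε_Ψ(t) = Ψ(f(t), m^ε(t)) - ∫_0^t 𝓛^εΨ(f(s), m^ε(s)) ds`. -/
def testProcess (a : Lp (EuclideanSpace ℝ (Fin d)) ⊤ μ) (Pt : ℝ≥0 → Kernel E E)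
    (m : ℝ → Ω → E) (ε : ℝ) (f : ℝ → Ω → L2xv d μ) (Ψ : L2H1 d μ → E → ℝ)
    (t : ℝ≥0) (ω : Ω) : ℝ :=
  along m ε f Ψ t ω - ∫ s in (0 : ℝ)..t, along m ε f (generator a Pt ε Ψ) s ω

end Probability

end KineticDiffusion

end

/-! For a fixed `ω` the kinetic equation is linear. Its only unbounded term, the transport, is a
group of isometries both of `L²_{x,v}` and of `L²(V; H¹)`. Conjugating by this group (interaction
picture) leaves an equation `g' = C(t, ω) g`. The operators `C` are bounded on `L²(V; H¹)`,
uniformly in `(t, ω)`, because velocity averages and products with `W^{1,∞}` functions preserve that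
space and `E` is bounded. The Dyson series solves this equation with values in `L²(V; H¹)`, and
Gronwall's lemma in `L²_{x,v}` identifies the result with the given mild solution (`eq_toL2_solH`).

The martingale property is Dynkin's formula for the triple (time, `g`, noise). The observable
`Ψ(e^{-τA/ε} u, n)` is differentiable in `(τ, u)`. Since `DΨ` lies in `L²_{x,v}`, only `L²`
differentiability of the orbits of the transport group is needed, and that holds on `L²(V; H¹)`. The
derivative along the path plus the generator of the noise is exactly `𝓛^εΨ`
(`pictureDeriv_velocity`). In `IsDrivenPath.dynkin` one fixes a past event `A` and shows that `r ↦
E[1_A Φ(y_r, n_r)]` has a continuous right derivative. The increment splits into a path part, with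
the noise frozen, and a noise part, with the path frozen. The latter is controlled by the martingale
problem of `M`, which passes from deterministic parameters to past-measurable ones by
`setIntegral_freezing`. Stochastic continuity of the noise replaces continuity of its paths
throughout.

For the bracket, Dynkin's formula applied to `Ψ` and to `Ψ²` makes `N = X - J` and `X² - ∫ k`
martingales, where `J = ∫ j`. As `∫ J dJ = J²/2`, the process `N² - ∫ (k - 2Xj)` equals `(X² - ∫ k)
- 2 (N J - ∫ N dJ)`, and the last term is a martingale by integration by parts
(`HasCentredIncrements.sq_sub`). The bracket increases because the first-order part of `𝓛^ε` is a
derivation. What remains is `ε⁻² (Mψ² - 2ψ Mψ)`, a limit of normalised integrals of squares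
(`carreDuChamp_eq`, `markovGenerator_sq_nonneg`).

Two difficulties concern measurability. The noise takes values in the nonseparable space `W^{1,∞}`,
so strong measurability of products comes from separability of `{n u}` for each fixed `u`
(`isSeparable_range_noiseH`). Processes are not assumed progressive and the filtration is not
complete, so time integrals are shown to be adapted up to null sets by a conditional expectation
argument (`aestronglyMeasurable_integral`). -/

noncomputable section
namespace KineticDiffusion

/-! ### Fourier analysis on the torus: weak derivatives and translations as multipliers. -/

open UnitAddTorus in
theorem volume_torus_eq (d : ℕ) : (volume : Measure (Torus d)) =
    Measure.pi (fun _ : Fin d => (AddCircle.haarAddCircle : Measure UnitAddCircle)) := by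
  have h : (volume : Measure UnitAddCircle) = AddCircle.haarAddCircle := by
    rw [AddCircle.volume_eq_smul_haarAddCircle]; simp
  rw [volume_pi, h]

/-- The Fourier coefficients of a real function on the torus. -/
def fcoeff {d : ℕ} (w : Torus d → ℝ) (k : Fin d → ℤ) : ℂ :=
  ∫ x, UnitAddTorus.mFourier (-k) x * (w x : ℂ)

-- Parseval's identity of the complex `L²` space, read on real functions.
open ComplexConjugate in
theorem hasSum_conj_fcoeff_mul {d : ℕ} {w z : Torus d → ℝ} (hw : MemLp w 2 volume)
    (hz : MemLp z 2 volume) :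
    HasSum (fun k => conj (fcoeff w k) * fcoeff z k) ((∫ x, w x * z x : ℝ) : ℂ) := by
  have hw' : MemLp (fun x => (w x : ℂ)) 2 volume := hw.ofReal
  have hz' : MemLp (fun x => (z x : ℂ)) 2 volume := hz.ofReal
  unfold fcoeff
  rw [volume_torus_eq] at *
  have := UnitAddTorus.hasSum_prod_mFourierCoeff (hw'.toLp _) (hz'.toLp _)
  convert! this using 1
  · ext k
    congr 1
    · congr 1
      refine integral_congr_ae ?_
      filter_upwards [hw'.coeFn_toLp] with x hx
      rw [hx]; rfl
    · refine integral_congr_ae ?_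
      filter_upwards [hz'.coeFn_toLp] with x hx
      rw [hx]; rfl
  · rw [← integral_complex_ofReal]
    refine integral_congr_ae ?_
    filter_upwards [hw'.coeFn_toLp, hz'.coeFn_toLp] with x hx hx2
    rw [hx, hx2]; simp

section Fourier

open Complex

variable {d : ℕ}

theorem integrable_mFourier_mul {w : Torus d → ℝ} (hw : Integrable w volume) (k : Fin d → ℤ) :
    Integrable (fun x => UnitAddTorus.mFourier k x * (w x : ℂ)) volume :=
  hw.ofReal.bdd_mul (c := 1) (UnitAddTorus.mFourier k).continuous.aestronglyMeasurable
    (Eventually.of_forall fun x => by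
      simpa [UnitAddTorus.mFourier_norm] using (UnitAddTorus.mFourier k).norm_coe_le_norm x)

theorem fcoeff_sub {w z : Torus d → ℝ} (hw : Integrable w volume) (hz : Integrable z volume)
    (k : Fin d → ℤ) : fcoeff (fun x => w x - z x) k = fcoeff w k - fcoeff z k := by
  unfold fcoeff
  rw [← integral_sub (integrable_mFourier_mul hw _) (integrable_mFourier_mul hz _)]
  refine integral_congr_ae (Eventually.of_forall fun x => ?_)
  push_cast; ring

theorem fcoeff_const_mul (c : ℝ) (w : Torus d → ℝ) (k : Fin d → ℤ) :
    fcoeff (fun x => c * w x) k = c * fcoeff w k := by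
  unfold fcoeff
  rw [← integral_const_mul]
  refine integral_congr_ae (Eventually.of_forall fun x => ?_)
  push_cast; ring

theorem fcoeff_sum {ι : Type*} (s : Finset ι) {w : ι → Torus d → ℝ}
    (hw : ∀ i, Integrable (w i) volume) (k : Fin d → ℤ) :
    fcoeff (fun x => ∑ i ∈ s, w i x) k = ∑ i ∈ s, fcoeff (w i) k := by
  unfold fcoeff
  rw [← integral_finsetSum _ fun i _ => integrable_mFourier_mul (hw i) _]
  refine integral_congr_ae (Eventually.of_forall fun x => ?_)
  simp [Finset.mul_sum]

theorem mFourier_apply_add (k : Fin d → ℤ) (x y : Torus d) :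
    UnitAddTorus.mFourier k (x + y) = UnitAddTorus.mFourier k x * UnitAddTorus.mFourier k y := by
  simp [UnitAddTorus.mFourier, fourier_apply, smul_add, AddCircle.toCircle_add,
    Finset.prod_mul_distrib]

theorem mFourier_coe (k : Fin d → ℤ) (y : Fin d → ℝ) :
    UnitAddTorus.mFourier k (fun j => (y j : UnitAddCircle)) =
      exp (2 * Real.pi * I * (∑ j, k j * y j : ℝ)) := by
  change ∏ j, fourier (k j) (y j : UnitAddCircle) = _
  rw [Complex.ofReal_sum, Finset.mul_sum, Complex.exp_sum]
  refine Finset.prod_congr rfl fun j _ => ?_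
  rw [fourier_coe_apply]
  congr 1; simp; ring

theorem mFourier_single_coe (k : Fin d → ℤ) (i : Fin d) (s : ℝ) :
    UnitAddTorus.mFourier k (Pi.single i (s : UnitAddCircle)) = exp (2 * Real.pi * I * (k i * s)) := by
  have : (Pi.single i (s : UnitAddCircle) : Torus d) =
      fun j => ((Pi.single i s : Fin d → ℝ) j : UnitAddCircle) := by
    funext j
    by_cases h : j = i
    · subst h; simp
    · simp [h]
  rw [this, mFourier_coe]
  congr 2
  rw [Finset.sum_eq_single i]
  · simp
  · intro j _ hj; simp [hj]
  · simp

theorem fcoeff_translate (w : Torus d → ℝ) (y : Torus d) (k : Fin d → ℤ) :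
    fcoeff (fun x => w (x + y)) k = UnitAddTorus.mFourier k y * fcoeff w k := by
  unfold fcoeff
  rw [← integral_const_mul, ← integral_add_right_eq_self (μ := (volume : Measure (Torus d)))
    (fun x => UnitAddTorus.mFourier k y * (UnitAddTorus.mFourier (-k) x * (w x : ℂ))) y]
  refine integral_congr_ae (Eventually.of_forall fun x => ?_)
  have h : UnitAddTorus.mFourier k y * UnitAddTorus.mFourier (-k) y = 1 := by
    rw [← UnitAddTorus.mFourier_add]; simp [UnitAddTorus.mFourier_zero]
  simp only [mFourier_apply_add]
  linear_combination (UnitAddTorus.mFourier (-k) x * (w (x + y) : ℂ)) * (-h)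

/-- The real trigonometric monomial `Re (c e^{2π i k·x})`. -/
def trigMode (c : ℂ) (k : Fin d → ℤ) : C(Torus d, ℝ) where
  toFun x := (c * UnitAddTorus.mFourier k x).re
  continuous_toFun := by fun_prop

theorem trigMode_apply (c : ℂ) (k : Fin d → ℤ) (x : Torus d) :
    trigMode c k x = (c * UnitAddTorus.mFourier k x).re := rfl

theorem contDiff_trigMode (c : ℂ) (k : Fin d → ℤ) :
    ContDiff ℝ ((⊤ : ℕ∞) : WithTop ℕ∞)
      (fun y : Fin d → ℝ => trigMode c k (fun j => (y j : UnitAddCircle))) := by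
  simp only [trigMode_apply, mFourier_coe]
  have h1 : ContDiff ℝ ((⊤ : ℕ∞) : WithTop ℕ∞) fun y : Fin d → ℝ => ∑ j, (k j : ℝ) * y j := by
    fun_prop
  have h2 : ContDiff ℝ ((⊤ : ℕ∞) : WithTop ℕ∞) fun y : Fin d → ℝ =>
      c * exp (2 * Real.pi * I * (∑ j, (k j : ℝ) * y j : ℝ)) :=
    contDiff_const.mul (contDiff_const.mul (Complex.ofRealCLM.contDiff.comp h1)).cexp
  exact Complex.reCLM.contDiff.comp h2

theorem hasDerivAt_trigMode (c : ℂ) (k : Fin d → ℤ) (i : Fin d) (x : Torus d) :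
    HasDerivAt (fun s : ℝ => trigMode c k (x + Pi.single i (s : UnitAddCircle)))
      (trigMode (c * (2 * Real.pi * I * k i)) k x) 0 := by
  simp only [trigMode_apply, mFourier_apply_add, mFourier_single_coe]
  have h1 : HasDerivAt (fun s : ℂ => c * (UnitAddTorus.mFourier k x *
      exp (2 * Real.pi * I * (k i * s)))) (c * (UnitAddTorus.mFourier k x *
      (exp (2 * Real.pi * I * (k i * (0 : ℝ))) * (2 * Real.pi * I * (k i * 1))))) ((0 : ℝ) : ℂ) :=
    ((((((hasDerivAt_id _).const_mul _).const_mul _).cexp).const_mul _).const_mul _)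
  have h2 := h1.real_of_complex
  convert! h2 using 2
  simp only [ofReal_zero, mul_zero, exp_zero, mul_one, one_mul]
  ring

theorem integral_mul_trigMode {w : Torus d → ℝ} (hw : Integrable w volume) (c : ℂ)
    (k : Fin d → ℤ) : ∫ x, w x * trigMode c k x = (c * fcoeff w (-k)).re := by
  unfold fcoeff
  rw [← integral_const_mul, neg_neg]
  have := integral_re ((integrable_mFourier_mul hw k).const_mul c)
  simp only [RCLike.re_to_complex] at this
  rw [← this]
  refine integral_congr_ae (Eventually.of_forall fun x => ?_)
  simp [trigMode]; ring

theorem HasWeakDeriv.fcoeff_eq {i : Fin d} {u g : Torus d → ℝ} (h : HasWeakDeriv i u g)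
    (k : Fin d → ℤ) : fcoeff g k = 2 * Real.pi * I * k i * fcoeff u k := by
  have key : ∀ c : ℂ, (c * (2 * Real.pi * I * k i * fcoeff u k)).re = (c * fcoeff g k).re := by
    intro c
    have := h.integral_eq _ _ (contDiff_trigMode c (-k)) (hasDerivAt_trigMode c (-k) i)
    rw [integral_mul_trigMode h.1, integral_mul_trigMode h.2, neg_neg] at this
    have e : c * (2 * Real.pi * I * ((-k) i : ℤ)) * fcoeff u k =
      -(c * (2 * Real.pi * I * k i * fcoeff u k)) := by
      simp; ring
    rw [e, Complex.neg_re] at this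
    linarith
  -- Tests are real-valued, so an exponential is seen only through `Re (c e_{-k})`; `c = 1` and `c =
  -- I` recover the real and the imaginary part.
  have h1 := key 1
  have h2 := key I
  simp only [one_mul, Complex.I_mul_re] at h1 h2
  exact Complex.ext h1.symm (by linarith)

/-- By Parseval: the multiplier `2πi k_i` is purely imaginary, so moving it across the conjugate
changes the sign. Neither factor needs to be smooth, which is what the product rule requires. -/
theorem integral_mul_eq_of_fcoeff {i : Fin d} {u g p q : Torus d → ℝ}
    (h : HasWeakDeriv i u g) (h' : HasWeakDeriv i p q) (hu : MemLp u 2 volume)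
    (hg : MemLp g 2 volume) (hp : MemLp p 2 volume) (hq : MemLp q 2 volume) :
    ∫ x, u x * q x = - ∫ x, g x * p x := by
  have h1 := hasSum_conj_fcoeff_mul hu hq
  have h2 := (hasSum_conj_fcoeff_mul hg hp).neg
  have := h1.unique (h2.congr_fun ?_)
  · exact_mod_cast this
  · intro k
    rw [h.fcoeff_eq, h'.fcoeff_eq]
    simp [Complex.conj_ofNat]; ring

theorem hasSum_norm_fcoeff_sq {w : Torus d → ℝ} (hw : MemLp w 2 volume) :
    HasSum (fun k => ‖fcoeff w k‖ ^ 2) (∫ x, w x ^ 2) := by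
  have := Complex.hasSum_re (hasSum_conj_fcoeff_mul hw hw)
  convert! this using 1
  · ext k
    rw [← Complex.normSq_eq_conj_mul_self, Complex.ofReal_re, Complex.normSq_eq_norm_sq]
  · simp [pow_two]

theorem ae_eq_zero_of_fcoeff_eq_zero {w : Torus d → ℝ} (hw : MemLp w 2 volume)
    (h : ∀ k, fcoeff w k = 0) : w =ᵐ[volume] 0 := by
  have h1 := hasSum_norm_fcoeff_sq hw
  simp only [h, norm_zero, ne_eq, OfNat.ofNat_ne_zero, not_false_eq_true, zero_pow] at h1
  have h2 := hasSum_zero.unique h1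
  have h3 := (integral_eq_zero_iff_of_nonneg (fun x => sq_nonneg (w x)) hw.integrable_sq).1 h2.symm
  filter_upwards [h3] with x hx
  simpa using hx

theorem HasWeakDeriv.unique {i : Fin d} {u g g' : Torus d → ℝ} (h : HasWeakDeriv i u g)
    (h' : HasWeakDeriv i u g') (hg : MemLp g 2 volume) (hg' : MemLp g' 2 volume) :
    g =ᵐ[volume] g' := by
  have := ae_eq_zero_of_fcoeff_eq_zero (hg.sub hg') fun k => by
    have := fcoeff_sub h.2 h'.2 k
    rw [h.fcoeff_eq, h'.fcoeff_eq, sub_self] at this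
    exact this
  filter_upwards [this] with x hx
  simpa [sub_eq_zero] using hx

theorem integral_sq_le_of_fcoeff {w z : Torus d → ℝ} (hw : MemLp w 2 volume)
    (hz : MemLp z 2 volume) (h : ∀ k, ‖fcoeff w k‖ ≤ 2 * ‖fcoeff z k‖) :
    ∫ x, w x ^ 2 ≤ 4 * ∫ x, z x ^ 2 := by
  refine hasSum_le (fun k => ?_) (hasSum_norm_fcoeff_sq hw) ((hasSum_norm_fcoeff_sq hz).mul_left 4)
  calc ‖fcoeff w k‖ ^ 2 ≤ (2 * ‖fcoeff z k‖) ^ 2 := by gcongr; exact h k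
    _ = _ := by ring

theorem tendsto_integral_sq_of_fcoeff {ι : Type*} {l : Filter ι} {w : ι → Torus d → ℝ}
    {z : Torus d → ℝ} (hw : ∀ t, MemLp (w t) 2 volume) (hz : MemLp z 2 volume)
    (h : ∀ t k, ‖fcoeff (w t) k‖ ≤ 2 * ‖fcoeff z k‖)
    (hl : ∀ k, Tendsto (fun t => fcoeff (w t) k) l (𝓝 0)) :
    Tendsto (fun t => ∫ x, w t x ^ 2) l (𝓝 0) := by
  simp only [fun t => (hasSum_norm_fcoeff_sq (hw t)).tsum_eq.symm]
  have := tendsto_tsum_of_dominated_convergence (𝓕 := l)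
    (f := fun t k => ‖fcoeff (w t) k‖ ^ 2) (g := fun _ => 0)
    (bound := fun k => 4 * ‖fcoeff z k‖ ^ 2)
    ((hasSum_norm_fcoeff_sq hz).mul_left 4).summable ?_ ?_
  · simpa using this
  · intro k
    simpa using (hl k).norm.pow 2
  · refine Eventually.of_forall fun t k => ?_
    rw [Real.norm_of_nonneg (by positivity)]
    calc ‖fcoeff (w t) k‖ ^ 2 ≤ (2 * ‖fcoeff z k‖) ^ 2 := by gcongr; exact h t k
      _ = _ := by ring

/-- The point `τ a` of the torus. -/
def shift (a : EuclideanSpace ℝ (Fin d)) (τ : ℝ) : Torus d :=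
  fun i => ((τ * a i : ℝ) : UnitAddCircle)

/-- The frequency `2π k·a`. -/
def freq (a : EuclideanSpace ℝ (Fin d)) (k : Fin d → ℤ) : ℝ := 2 * Real.pi * ∑ j, k j * a j

theorem mFourier_shift (a : EuclideanSpace ℝ (Fin d)) (τ : ℝ) (k : Fin d → ℤ) :
    UnitAddTorus.mFourier k (shift a τ) = exp (I * (τ * freq a k : ℝ)) := by
  unfold shift
  rw [mFourier_coe k (fun i => τ * a i)]
  congr 1
  simp only [freq, Complex.ofReal_mul, Complex.ofReal_sum, Finset.mul_sum]
  refine Finset.sum_congr rfl fun j _ => ?_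
  push_cast; ring

theorem memLp_translate {w : Torus d → ℝ} (hw : MemLp w 2 volume) (y : Torus d) :
    MemLp (fun x => w (x + y)) 2 volume :=
  hw.comp_measurePreserving (measurePreserving_add_right volume y)

/-- The multiplier `e^{iτω} - 1` has modulus at most `2` and tends to `0` with `τ`. The bound
uniform in `τ` serves as domination when the slices are later integrated over `v`. -/
theorem translate_sub_bounds {u : Torus d → ℝ} (hu : MemLp u 2 volume)
    (a : EuclideanSpace ℝ (Fin d)) :
    (∀ τ, ∫ x, (u (x + shift a τ) - u x) ^ 2 ≤ 4 * ∫ x, u x ^ 2) ∧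
    Tendsto (fun τ => ∫ x, (u (x + shift a τ) - u x) ^ 2) (𝓝 0) (𝓝 0) := by
  have hw : ∀ τ, MemLp (fun x => u (x + shift a τ) - u x) 2 volume := fun τ =>
    (memLp_translate hu _).sub hu
  have hi : Integrable u volume := hu.integrable (by norm_num)
  have hc : ∀ τ k, fcoeff (fun x => u (x + shift a τ) - u x) k =
      (exp (I * (τ * freq a k : ℝ)) - 1) * fcoeff u k := by
    intro τ k
    rw [fcoeff_sub ((memLp_translate hu _).integrable (by norm_num)) hi, fcoeff_translate,
      mFourier_shift]
    ring
  have hb : ∀ τ k, ‖fcoeff (fun x => u (x + shift a τ) - u x) k‖ ≤ 2 * ‖fcoeff u k‖ := by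
    intro τ k
    rw [hc, norm_mul]
    gcongr
    refine (norm_sub_le _ _).trans ?_
    rw [mul_comm, Complex.norm_exp_ofReal_mul_I]
    norm_num
  refine ⟨fun τ => integral_sq_le_of_fcoeff (hw τ) hu (hb τ),
    tendsto_integral_sq_of_fcoeff hw hu hb fun k => ?_⟩
  simp only [hc]
  have : Continuous fun τ : ℝ => (exp (I * (τ * freq a k : ℝ)) - 1) * fcoeff u k := by fun_prop
  convert! this.tendsto 0
  simp

/-- The multiplier `τ⁻¹ (e^{iτω} - 1) - iω` has modulus at most `2|ω|` and tends to `0`, while `iω`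
is the multiplier of the directional derivative along `a`. -/
theorem translate_diff_bounds {u : Torus d → ℝ} {g : Fin d → Torus d → ℝ}
    (hu : MemLp u 2 volume) (hg : ∀ i, MemLp (g i) 2 volume)
    (h : ∀ i, HasWeakDeriv i u (g i)) (a : EuclideanSpace ℝ (Fin d)) :
    (∀ τ, ∫ x, (τ⁻¹ * (u (x + shift a τ) - u x) - ∑ i, a i * g i x) ^ 2 ≤
      4 * ∫ x, (∑ i, a i * g i x) ^ 2) ∧
    Tendsto (fun τ => ∫ x, (τ⁻¹ * (u (x + shift a τ) - u x) - ∑ i, a i * g i x) ^ 2)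
      (𝓝[≠] 0) (𝓝 0) := by
  have hz : MemLp (fun x => ∑ i, a i * g i x) 2 volume :=
    memLp_finsetSum _ fun i _ => (hg i).const_mul (a i)
  have hd : ∀ τ, MemLp (fun x => u (x + shift a τ) - u x) 2 volume := fun τ =>
    (memLp_translate hu _).sub hu
  have hw : ∀ τ, MemLp (fun x => τ⁻¹ * (u (x + shift a τ) - u x) - ∑ i, a i * g i x) 2 volume :=
    fun τ => ((hd τ).const_mul τ⁻¹).sub hz
  have hi : Integrable u volume := hu.integrable (by norm_num)
  have hcz : ∀ k, fcoeff (fun x => ∑ i, a i * g i x) k = I * freq a k * fcoeff u k := by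
    intro k
    rw [fcoeff_sum _ fun i => ((hg i).integrable (by norm_num)).const_mul _]
    simp only [fcoeff_const_mul, (h _).fcoeff_eq, freq]
    push_cast
    simp only [Finset.mul_sum, Finset.sum_mul]
    refine Finset.sum_congr rfl fun j _ => ?_
    ring
  have hc : ∀ τ k, fcoeff (fun x => τ⁻¹ * (u (x + shift a τ) - u x) - ∑ i, a i * g i x) k =
      ((τ : ℂ)⁻¹ * (exp (I * (τ * freq a k : ℝ)) - 1) - I * freq a k) * fcoeff u k := by
    intro τ k
    rw [fcoeff_sub (((hd τ).const_mul τ⁻¹).integrable (by norm_num))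
      (hz.integrable (by norm_num)), fcoeff_const_mul,
      fcoeff_sub ((memLp_translate hu _).integrable (by norm_num)) hi, fcoeff_translate,
      mFourier_shift, hcz]
    push_cast
    ring
  have hb : ∀ τ k, ‖fcoeff (fun x => τ⁻¹ * (u (x + shift a τ) - u x) - ∑ i, a i * g i x) k‖ ≤
      2 * ‖fcoeff (fun x => ∑ i, a i * g i x) k‖ := by
    intro τ k
    rw [hc, hcz, norm_mul, norm_mul, ← mul_assoc]
    gcongr
    refine (norm_sub_le _ _).trans ?_
    have h1 : ‖(τ : ℂ)⁻¹ * (exp (I * (τ * freq a k : ℝ)) - 1)‖ ≤ ‖I * (freq a k : ℂ)‖ := by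
      rw [norm_mul]
      refine (mul_le_mul_of_nonneg_left (Real.norm_exp_I_mul_ofReal_sub_one_le) (norm_nonneg _)).trans ?_
      -- With the convention `0⁻¹ = 0` the bound also holds at `τ = 0`, so no exception has to be
      -- carried along.
      by_cases hτ : τ = 0
      · subst hτ; simp
      · simp only [norm_inv, Complex.norm_real, norm_mul, Complex.norm_I, one_mul]
        rw [inv_mul_cancel_left₀ (by simpa using hτ)]
    linarith
  refine ⟨fun τ => integral_sq_le_of_fcoeff (hw τ) hz (hb τ),
    tendsto_integral_sq_of_fcoeff hw hz hb fun k => ?_⟩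
  simp only [hc]
  have hd : HasDerivAt (fun τ : ℝ => exp (I * (τ * freq a k : ℝ))) (I * freq a k) 0 := by
    have h1 : HasDerivAt (fun τ : ℂ => exp (I * (τ * freq a k))) _ ((0 : ℝ) : ℂ) :=
      (((hasDerivAt_id _).mul_const (freq a k : ℂ)).const_mul I).cexp
    have h2 := h1.comp_ofReal
    simpa using h2
  have h3 := hd.tendsto_slope_zero
  have h4 : Tendsto (fun τ : ℝ => ((τ : ℂ)⁻¹ * (exp (I * (τ * freq a k : ℝ)) - 1) - I * freq a k) *
      fcoeff u k) (𝓝[≠] 0) (𝓝 ((I * freq a k - I * freq a k) * fcoeff u k)) := by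
    refine Tendsto.mul_const _ (Tendsto.sub_const ?_ _)
    refine h3.congr fun τ => ?_
    simp [Complex.real_smul]
  simpa using h4

end Fourier

end KineticDiffusion
-- Calculus of weak derivatives: products, translations, limits, averages.
namespace KineticDiffusion

instance isProbabilityMeasure_torus (d : ℕ) :
    IsProbabilityMeasure (volume : Measure (Torus d)) := by
  rw [volume_torus_eq]
  infer_instance

theorem sq_integral_le_integral_sq {α : Type*} [MeasurableSpace α] {ν : Measure α}
    [IsProbabilityMeasure ν] {f : α → ℝ} (hf : MemLp f 2 ν) :
    (∫ x, f x ∂ν) ^ 2 ≤ ∫ x, f x ^ 2 ∂ν := by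
  have h := variance_nonneg f ν
  rw [variance_eq_sub hf] at h
  simp only [Pi.pow_apply] at h
  linarith

section WeakDerivative

variable {d : ℕ} {i : Fin d}

/-- Smooth tests: `φ'` is the `i`-th partial derivative of the smooth function `φ`. -/
def IsTest (i : Fin d) (φ φ' : C(Torus d, ℝ)) : Prop :=
  ContDiff ℝ ((⊤ : ℕ∞) : WithTop ℕ∞)
      (fun y : Fin d → ℝ => φ (fun j => (y j : UnitAddCircle))) ∧
    ∀ x : Torus d, HasDerivAt (fun s : ℝ => φ (x + Pi.single i (s : UnitAddCircle))) (φ' x) 0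

theorem IsTest.mul {φ φ' η η' : C(Torus d, ℝ)} (h : IsTest i φ φ') (h' : IsTest i η η') :
    IsTest i (φ * η) (φ' * η + φ * η') := by
  refine ⟨h.1.mul h'.1, fun x => ?_⟩
  have := (h.2 x).mul (h'.2 x)
  simpa using! this

theorem IsTest.translate {φ φ' : C(Torus d, ℝ)} (h : IsTest i φ φ') (y : Torus d) :
    IsTest i (φ.comp ((ContinuousMap.id _) + ContinuousMap.const _ y))
      (φ'.comp ((ContinuousMap.id _) + ContinuousMap.const _ y)) := by
  constructor
  -- Smoothness is tested on `ℝ^d`, so the torus point `y` is lifted to a vector `z` and the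
  -- translation becomes one of `ℝ^d`.
  · choose z hz using fun j => QuotientAddGroup.mk_surjective (y j)
    have h1 := h.1.comp (contDiff_id.add (contDiff_const (c := z)))
    convert! h1 using 2 with p
    simp only [ContinuousMap.comp_apply, ContinuousMap.add_apply, ContinuousMap.id_apply,
      ContinuousMap.const_apply, Function.comp]
    congr 1
    funext j
    have : y j = ((z j : ℝ) : UnitAddCircle) := (hz j).symm
    simp [this]
  · intro x
    have := h.2 (x + y)
    refine this.congr_of_eventuallyEq (Eventually.of_forall fun s => ?_)
    simp only [ContinuousMap.comp_apply, ContinuousMap.add_apply, ContinuousMap.id_apply,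
      ContinuousMap.const_apply]
    congr 1
    abel

theorem HasWeakDeriv.translate {u g : Torus d → ℝ} (h : HasWeakDeriv i u g) (y : Torus d) :
    HasWeakDeriv i (fun x => u (x + y)) (fun x => g (x + y)) := by
  refine ⟨h.1.comp_add_right y, h.2.comp_add_right y, fun φ φ' hφ hd => ?_⟩
  have ht := IsTest.translate (i := i) ⟨hφ, hd⟩ (-y)
  have := h.3 _ _ ht.1 ht.2
  rw [← integral_add_right_eq_self _ y] at this
  rw [← integral_add_right_eq_self (fun x => g x * _) y] at this
  simpa using this

theorem HasWeakDeriv.mul_test {n gn : Torus d → ℝ} (h : HasWeakDeriv i n gn)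
    {φ φ' : C(Torus d, ℝ)} (hφ : IsTest i φ φ') :
    HasWeakDeriv i (fun x => n x * φ x) (fun x => gn x * φ x + n x * φ' x) := by
  refine ⟨integrable_mul_test h.1 φ,
    (integrable_mul_test h.2 φ).add (integrable_mul_test h.1 φ'), fun η η' hη hd => ?_⟩
  have ht := hφ.mul (η := η) (η' := η') ⟨hη, hd⟩
  have h1 := h.3 _ _ ht.1 ht.2
  simp only [ContinuousMap.add_apply, ContinuousMap.mul_apply, mul_add] at h1
  have i1 := integrable_mul_test h.1 (φ' * η)
  have i2 := integrable_mul_test h.1 (φ * η')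
  have i3 := integrable_mul_test h.2 (φ * η)
  simp only [ContinuousMap.mul_apply] at i1 i2 i3
  rw [integral_add i1 i2] at h1
  simp only [add_mul, mul_assoc]
  rw [integral_add i3 i1]
  linarith

/-- The derivative of `u` has to be tested against `n φ`, which is not smooth. But `n φ` has an `L²`
weak derivative by `HasWeakDeriv.mul_test`, so `integral_mul_eq_of_fcoeff` applies instead of the
definition. -/
theorem HasWeakDeriv.mul {u g n gn : Torus d → ℝ} (h : HasWeakDeriv i u g)
    (hn : HasWeakDeriv i n gn) (hu : MemLp u 2 volume) (hg : MemLp g 2 volume)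
    (hnb : MemLp n ⊤ volume) (hgnb : MemLp gn ⊤ volume) :
    HasWeakDeriv i (fun x => u x * n x) (fun x => g x * n x + u x * gn x) := by
  have t1 : ∀ {w z : Torus d → ℝ}, MemLp w 2 volume → MemLp z ⊤ volume →
      MemLp (fun x => w x * z x) 2 volume := fun hw hz => hz.mul hw
  have t2 : ∀ {w z : Torus d → ℝ}, MemLp w 2 volume → MemLp z ⊤ volume →
      Integrable (fun x => w x * z x) volume := fun hw hz => (t1 hw hz).integrable (by norm_num)
  have t3 : ∀ {w : Torus d → ℝ} (φ : C(Torus d, ℝ)), MemLp w ⊤ volume →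
      MemLp (fun x => w x * φ x) ⊤ volume := fun φ hw =>
    (show MemLp φ ⊤ volume from memLp_top_of_bound φ.continuous.aestronglyMeasurable ‖φ‖
      (Eventually.of_forall fun x => φ.norm_coe_le_norm x)).mul hw
  refine ⟨t2 hu hnb, (t2 hg hnb).add (t2 hu hgnb), fun φ φ' hφ hd => ?_⟩
  have ht : IsTest i φ φ' := ⟨hφ, hd⟩
  have h1 := hn.mul_test ht
  have key := integral_mul_eq_of_fcoeff h h1 hu hg ((t3 φ hnb).mono_exponent le_top)
    (((t3 φ hgnb).add (t3 φ' hnb)).mono_exponent le_top)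
  have e1 : ∫ x, u x * n x * φ' x = (∫ x, u x * (gn x * φ x + n x * φ' x)) -
      ∫ x, u x * gn x * φ x := by
    have i1 : Integrable (fun x => u x * (gn x * φ x + n x * φ' x)) volume :=
      t2 hu ((t3 φ hgnb).add (t3 φ' hnb))
    rw [← integral_sub i1 (integrable_mul_test (t2 hu hgnb) φ)]
    refine integral_congr_ae (Eventually.of_forall fun x => ?_)
    ring
  rw [e1, key]
  simp only [add_mul]
  rw [integral_add (integrable_mul_test (t2 hg hnb) φ) (integrable_mul_test (t2 hu hgnb) φ)]
  simp only [mul_assoc]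
  ring

theorem tendsto_integral_mul_test {f : ℕ → Torus d → ℝ} {g : Torus d → ℝ}
    (hf : ∀ n, MemLp (f n) 2 volume) (hg : MemLp g 2 volume)
    (h : Tendsto (fun n => ∫ x, (f n x - g x) ^ 2) atTop (𝓝 0)) (φ : C(Torus d, ℝ)) :
    Tendsto (fun n => ∫ x, f n x * φ x) atTop (𝓝 (∫ x, g x * φ x)) := by
  rw [tendsto_iff_norm_sub_tendsto_zero]
  have hs : Tendsto (fun n => ‖φ‖ * √(∫ x, (f n x - g x) ^ 2)) atTop (𝓝 0) := by
    simpa using (h.sqrt).const_mul ‖φ‖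
  refine squeeze_zero (fun _ => norm_nonneg _) (fun n => ?_) hs
  have hm : MemLp (fun x => f n x - g x) 2 volume := (hf n).sub hg
  rw [← integral_sub (integrable_mul_test ((hf n).integrable (by norm_num)) φ)
    (integrable_mul_test (hg.integrable (by norm_num)) φ)]
  have h1 : ‖∫ x, (f n x * φ x - g x * φ x)‖ ≤ ∫ x, ‖φ‖ * |f n x - g x| := by
    refine norm_integral_le_of_norm_le ((hm.integrable (by norm_num)).abs.const_mul _)
      (Eventually.of_forall fun x => ?_)
    rw [← sub_mul, norm_mul, mul_comm, Real.norm_eq_abs (f n x - g x)]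
    gcongr
    exact φ.norm_coe_le_norm x
  refine h1.trans ?_
  rw [integral_const_mul]
  gcongr
  refine Real.le_sqrt_of_sq_le ?_
  simpa [Pi.abs_apply] using sq_integral_le_integral_sq (hm.abs)

theorem HasWeakDeriv.of_tendsto {u g : ℕ → Torus d → ℝ} {u' g' : Torus d → ℝ}
    (h : ∀ n, HasWeakDeriv i (u n) (g n)) (hu : ∀ n, MemLp (u n) 2 volume)
    (hg : ∀ n, MemLp (g n) 2 volume) (hu' : MemLp u' 2 volume) (hg' : MemLp g' 2 volume)
    (h1 : Tendsto (fun n => ∫ x, (u n x - u' x) ^ 2) atTop (𝓝 0))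
    (h2 : Tendsto (fun n => ∫ x, (g n x - g' x) ^ 2) atTop (𝓝 0)) : HasWeakDeriv i u' g' := by
  refine ⟨hu'.integrable (by norm_num), hg'.integrable (by norm_num), fun φ φ' hφ hd => ?_⟩
  refine tendsto_nhds_unique (tendsto_integral_mul_test hu hu' h1 φ') ?_
  exact (tendsto_integral_mul_test hg hg' h2 φ).neg.congr fun n => ((h n).3 φ φ' hφ hd).symm

theorem HasWeakDeriv.average {V : Type*} [MeasurableSpace V] {μ : Measure V}
    [IsProbabilityMeasure μ] {f g : Torus d × V → ℝ} (hf : Integrable f (volume.prod μ))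
    (hg : Integrable g (volume.prod μ))
    (h : ∀ᵐ v ∂μ, HasWeakDeriv i (fun x => f (x, v)) (fun x => g (x, v))) :
    HasWeakDeriv i (fun x => ∫ v, f (x, v) ∂μ) (fun x => ∫ v, g (x, v) ∂μ) := by
  have key : ∀ {w : Torus d × V → ℝ} (φ : C(Torus d, ℝ)), Integrable w (volume.prod μ) →
      ∫ x, (∫ v, w (x, v) ∂μ) * φ x = ∫ v, (∫ x, w (x, v) * φ x) ∂μ := by
    intro w φ hw
    rw [← integral_integral_swap]
    · simp only [integral_mul_const]
    · exact hw.mul_bdd (c := ‖φ‖) (φ.continuous.measurable.comp measurable_fst).aestronglyMeasurable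
        (Eventually.of_forall fun x => φ.norm_coe_le_norm x.1)
  refine ⟨hf.integral_prod_left, hg.integral_prod_left, fun φ φ' hφ hd => ?_⟩
  rw [key φ' hf, key φ hg, ← integral_neg]
  refine integral_congr_ae ?_
  filter_upwards [h] with v hv
  exact hv.3 φ φ' hφ hd

end WeakDerivative

end KineticDiffusion
-- Slices in the velocity variable, and the space `L²(V; H¹)`.
namespace KineticDiffusion

section Operators

variable {V : Type*} [MeasurableSpace V] {d : ℕ} {μ : Measure V} [IsProbabilityMeasure μ]

theorem norm_sq_eq_integral_slices (f : L2xv d μ) :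
    ‖f‖ ^ 2 = ∫ v, (∫ x, f (x, v) ^ 2) ∂μ := by
  rw [← real_inner_self_eq_norm_sq, L2.inner_def, integral_prod_symm]
  · simp [pow_two]
  · exact L2.integrable_inner (𝕜 := ℝ) f f

theorem integrable_integral_slices (f : L2xv d μ) :
    Integrable (fun v => ∫ x, f (x, v) ^ 2) μ :=
  (Lp.memLp f).integrable_sq.integral_prod_right

theorem ae_memLp_slice (f : L2xv d μ) : ∀ᵐ v ∂μ, MemLp (fun x => f (x, v)) 2 volume := by
  have h : MemLp (fun p : V × Torus d => f (p.2, p.1)) 2 (μ.prod volume) :=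
    (Lp.memLp f).comp_measurePreserving Measure.measurePreserving_swap
  have h2 := h.integrable_sq
  filter_upwards [h2.prod_right_ae, h.1.prodMk_left] with v hv hv'
  exact (memLp_two_iff_integrable_sq hv').2 hv

/-- Dominated convergence in `v`. The factor `4` is the one supplied by the Fourier bounds on each
slice. -/
theorem tendsto_zero_of_slices {F : ℕ → L2xv d μ} {z : L2xv d μ}
    (hb : ∀ n, ∀ᵐ v ∂μ, ∫ x, F n (x, v) ^ 2 ≤ 4 * ∫ x, z (x, v) ^ 2)
    (hl : ∀ᵐ v ∂μ, Tendsto (fun n => ∫ x, F n (x, v) ^ 2) atTop (𝓝 0)) :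
    Tendsto F atTop (𝓝 0) := by
  rw [tendsto_zero_iff_norm_tendsto_zero]
  have h : Tendsto (fun n => ‖F n‖ ^ 2) atTop (𝓝 0) := by
    simp only [norm_sq_eq_integral_slices]
    have := tendsto_integral_of_dominated_convergence (F := fun n v => ∫ x, F n (x, v) ^ 2)
      (f := fun _ => (0 : ℝ)) (μ := μ) (fun v => 4 * ∫ x, z (x, v) ^ 2)
      (fun n => (integrable_integral_slices (F n)).1) ((integrable_integral_slices z).const_mul 4)
      (fun n => by
        filter_upwards [hb n] with v hv
        rwa [Real.norm_of_nonneg (integral_nonneg fun x => sq_nonneg _)]) hl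
    simpa using this
  simpa using h.sqrt

/-- The squared slice norms of `F n - f` converge to `0` in `L¹(μ)`, hence in measure, hence almost
everywhere along a subsequence. -/
theorem exists_subseq_tendsto_slices {F : ℕ → L2xv d μ} {f : L2xv d μ}
    (h : Tendsto F atTop (𝓝 f)) : ∃ φ : ℕ → ℕ, StrictMono φ ∧
      ∀ᵐ v ∂μ, Tendsto (fun n => ∫ x, (F (φ n) (x, v) - f (x, v)) ^ 2) atTop (𝓝 0) := by
  have h0 : Tendsto (fun n => ‖F n - f‖ ^ 2) atTop (𝓝 0) := by
    simpa using (tendsto_iff_norm_sub_tendsto_zero.1 h).pow 2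
  have h1 : Tendsto (fun n => eLpNorm ((fun v => ∫ x, (F n - f : L2xv d μ) (x, v) ^ 2) - 0) 1 μ)
      atTop (𝓝 0) := by
    have : ∀ n, eLpNorm ((fun v => ∫ x, (F n - f : L2xv d μ) (x, v) ^ 2) - 0) 1 μ =
        ENNReal.ofReal (‖F n - f‖ ^ 2) := by
      intro n
      rw [sub_zero, eLpNorm_one_eq_lintegral_enorm, norm_sq_eq_integral_slices,
        ofReal_integral_eq_lintegral_ofReal (integrable_integral_slices _)
          (Eventually.of_forall fun v => integral_nonneg fun x => sq_nonneg _)]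
      refine lintegral_congr fun v => ?_
      rw [Real.enorm_eq_ofReal (integral_nonneg fun x => sq_nonneg _)]
    simp only [this]
    simpa using ENNReal.tendsto_ofReal h0
  obtain ⟨φ, hφ, hae⟩ := (tendstoInMeasure_of_tendsto_eLpNorm one_ne_zero
    (fun n => (integrable_integral_slices (F n - f)).1)
    (aestronglyMeasurable_const (b := (0 : ℝ))) h1).exists_seq_tendsto_ae
  refine ⟨φ, hφ, ?_⟩
  filter_upwards [hae, ae_all_iff.2 fun n => ae_slice (Lp.coeFn_sub (F (φ n)) f)] with v hv hv'
  refine hv.congr fun n => integral_congr_ae ?_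
  filter_upwards [hv' n] with x hx
  rw [hx]; rfl

/-! ### The transport group -/

variable (a : Lp (EuclideanSpace ℝ (Fin d)) ⊤ μ)

theorem transport_slice (τ : ℝ) (f : L2xv d μ) :
    ∀ᵐ v ∂μ, (fun x => transport a τ f (x, v)) =ᵐ[volume] fun x => f (x + shift (a v) τ, v) :=
  ae_slice (Lp.coeFn_compMeasurePreserving f (measurePreserving_freeFlow a τ))

/-- The transport group as a linear isometry. -/
def transportL (τ : ℝ) : L2xv d μ →ₗᵢ[ℝ] L2xv d μ :=
  Lp.compMeasurePreservingₗᵢ ℝ (freeFlow a τ) (measurePreserving_freeFlow a τ)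

theorem transportL_apply (τ : ℝ) (f : L2xv d μ) : transportL a τ f = transport a τ f := rfl

theorem norm_transport (τ : ℝ) (f : L2xv d μ) : ‖transport a τ f‖ = ‖f‖ :=
  (transportL a τ).norm_map f

theorem transport_sub (τ : ℝ) (f g : L2xv d μ) :
    transport a τ (f - g) = transport a τ f - transport a τ g := map_sub (transportL a τ) f g

theorem shift_add (b : EuclideanSpace ℝ (Fin d)) (s t : ℝ) :
    shift b (s + t) = shift b s + shift b t := by
  funext i
  simp [shift, add_mul]

theorem shift_zero (b : EuclideanSpace ℝ (Fin d)) : shift b 0 = 0 := by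
  funext i
  simp [shift]

theorem transport_zero (f : L2xv d μ) : transport a 0 f = f := by
  have : freeFlow a 0 = id := by
    funext p
    exact Prod.ext ((congrArg (p.1 + ·) (shift_zero (a p.2))).trans (add_zero _)) rfl
  refine Lp.ext ((Lp.coeFn_compMeasurePreserving f (measurePreserving_freeFlow a 0)).trans ?_)
  rw [this]
  rfl

theorem transport_transport (s t : ℝ) (f : L2xv d μ) :
    transport a s (transport a t f) = transport a (s + t) f := by
  unfold transport
  rw [← Lp.compMeasurePreserving_comp_apply]
  have h : freeFlow a t ∘ freeFlow a s = freeFlow a (s + t) := by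
    funext p
    refine Prod.ext ?_ rfl
    change (p.1 + shift (a p.2) s) + shift (a p.2) t = p.1 + shift (a p.2) (s + t)
    rw [shift_add, add_assoc]
  simp only [h]

theorem tendsto_transport_zero (f : L2xv d μ) :
    Tendsto (fun τ => transport a τ f - f) (𝓝 0) (𝓝 0) := by
  refine tendsto_of_seq_tendsto fun τ hτ => ?_
  have hs : ∀ᵐ v ∂μ, ∀ n, (fun x => (transport a (τ n) f - f : L2xv d μ) (x, v)) =ᵐ[volume]
      fun x => f (x + shift (a v) (τ n), v) - f (x, v) := by
    refine ae_all_iff.2 fun n => ?_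
    filter_upwards [transport_slice a (τ n) f, ae_slice (Lp.coeFn_sub (transport a (τ n) f) f)]
      with v h1 h2
    filter_upwards [h1, h2] with x h1 h2
    rw [h2, ← h1]; rfl
  refine tendsto_zero_of_slices (z := f) (fun n => ?_) ?_
  · filter_upwards [hs, ae_memLp_slice f] with v hv hm
    exact (integral_congr_ae ((hv n).fun_comp (· ^ 2))).trans_le
      ((translate_sub_bounds hm (a v)).1 (τ n))
  · filter_upwards [hs, ae_memLp_slice f] with v hv hm
    refine ((translate_sub_bounds hm (a v)).2.comp hτ).congr fun n => ?_
    exact (integral_congr_ae ((hv n).fun_comp (· ^ 2))).symm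

/-- The group law and the isometry property reduce continuity at `t` to continuity at `0`. -/
theorem continuous_transport (f : L2xv d μ) : Continuous fun τ => transport a τ f := by
  refine continuous_iff_continuousAt.2 fun t => ?_
  rw [ContinuousAt, tendsto_iff_norm_sub_tendsto_zero]
  have h : Tendsto (fun τ => τ - t) (𝓝 t) (𝓝 0) := by
    have : Continuous fun τ : ℝ => τ - t := by fun_prop
    simpa using this.tendsto t
  refine ((tendsto_transport_zero a f).comp h).norm.congr' ?_ |>.trans (by simp)
  refine Eventually.of_forall fun τ => ?_
  have : transport a τ f = transport a t (transport a (τ - t) f) := by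
    rw [transport_transport]; congr 1; ring
  simp only [Function.comp]
  rw [this, ← transport_sub, norm_transport]

/-! ### Elements of `L²(V; H¹)` -/

/-- The partial derivative `∂_i` on `L²(V; H¹)`. -/
def gradL (i : Fin d) : L2H1 d μ →L[ℝ] L2xv d μ :=
  ((PiLp.proj 2 (fun _ : Fin d => L2xv d μ) i : PiLp 2 (fun _ : Fin d => L2xv d μ) →L[ℝ] L2xv d μ).comp
    (WithLp.sndL 2 ℝ (L2xv d μ) (PiLp 2 (fun _ : Fin d => L2xv d μ)))).comp (L2H1 d μ).subtypeL

theorem hasWeakDeriv_slice (u : L2H1 d μ) (i : Fin d) :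
    ∀ᵐ v ∂μ, HasWeakDeriv i (fun x => toL2 u (x, v)) (fun x => gradL i u (x, v)) := u.2 i

theorem norm_sq_L2H1 (u : L2H1 d μ) : ‖u‖ ^ 2 = ‖toL2 u‖ ^ 2 + ∑ i, ‖gradL i u‖ ^ 2 := by
  rw [Submodule.coe_norm, WithLp.prod_norm_sq_eq_of_L2, PiLp.norm_sq_eq_of_L2]
  rfl

theorem L2H1_ext {u w : L2H1 d μ} (h : toL2 u = toL2 w) (h' : ∀ i, gradL i u = gradL i w) :
    u = w := by
  have : ‖u - w‖ ^ 2 = 0 := by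
    rw [norm_sq_L2H1]
    simp [map_sub, h, h']
  simpa [sub_eq_zero] using this

/-- Weak derivatives are unique on almost every slice. Identities in `L²(V; H¹)` can therefore be
checked in `L²_{x,v}`, and `toH1` inverts `toL2` on its range. -/
theorem toL2_injective : Function.Injective (toL2 : L2H1 d μ → L2xv d μ) := by
  intro u w h
  refine L2H1_ext h fun i => ?_
  refine Lp.ext ?_
  have h1 : ∀ᵐ v ∂μ, ∀ᵐ x, gradL i u (x, v) = gradL i w (x, v) := by
    filter_upwards [hasWeakDeriv_slice u i, hasWeakDeriv_slice w i, ae_memLp_slice (gradL i u),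
      ae_memLp_slice (gradL i w)] with v h1 h2 h3 h4
    rw [h] at h1
    exact h1.unique h2 h3 h4
  have hm : MeasurableSet {p : V × Torus d | gradL i u (p.2, p.1) = gradL i w (p.2, p.1)} :=
    measurableSet_eq_fun ((Lp.stronglyMeasurable _).measurable.comp measurable_swap)
      ((Lp.stronglyMeasurable _).measurable.comp measurable_swap)
  have h2 : ∀ᵐ p ∂μ.prod volume, gradL i u (p.2, p.1) = gradL i w (p.2, p.1) :=
    (Measure.ae_prod_iff_ae_ae hm).2 h1
  exact (Measure.measurePreserving_swap (μ := (volume : Measure (Torus d)))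
      (ν := μ)).quasiMeasurePreserving.ae h2

theorem toH1_toL2 (u : L2H1 d μ) : toH1 (toL2 u) = u := by
  have h : ∃ w : L2H1 d μ, toL2 w = toL2 u := ⟨u, rfl⟩
  rw [toH1, dif_pos h]
  exact toL2_injective h.choose_spec

/-- The element of `L²(V; H¹)` with prescribed function and gradient. -/
def mkL2H1 (f : L2xv d μ) (g : Fin d → L2xv d μ)
    (h : ∀ i, ∀ᵐ v ∂μ, HasWeakDeriv i (fun x => f (x, v)) (fun x => g i (x, v))) : L2H1 d μ :=
  ⟨WithLp.toLp 2 (f, WithLp.toLp 2 g), h⟩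

@[simp]
theorem toL2_mkL2H1 (f : L2xv d μ) (g : Fin d → L2xv d μ) (h) : toL2 (mkL2H1 f g h) = f := rfl

theorem isInducing_L2H1 : Topology.IsInducing
    (fun u : L2H1 d μ => (toL2 u, fun i => gradL i u)) := by
  have h1 : Topology.IsInducing (Subtype.val : L2H1 d μ → _) := Topology.IsInducing.subtypeVal
  have h2 := (WithLp.prodContinuousLinearEquiv 2 ℝ (L2xv d μ)
    (PiLp 2 (fun _ : Fin d => L2xv d μ))).toHomeomorph.isInducing
  have h3 := (PiLp.continuousLinearEquiv 2 ℝ (fun _ : Fin d => L2xv d μ)).toHomeomorph.isInducing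
  exact ((Topology.IsInducing.id.prodMap h3).comp h2).comp h1

theorem continuous_L2H1_iff {α : Type*} [TopologicalSpace α] {F : α → L2H1 d μ} :
    Continuous F ↔ Continuous (fun x => toL2 (F x)) ∧ ∀ i, Continuous fun x => gradL i (F x) := by
  rw [isInducing_L2H1.continuous_iff]
  simp only [Function.comp_def, continuous_prodMk, continuous_pi_iff]

/-- Completeness is what gives meaning to Bochner integrals and the Dyson series in `L²(V; H¹)`. It
amounts to closedness of the weak gradient. -/
instance completeSpace_L2H1 : CompleteSpace (L2H1 d μ) := by
  refine IsClosed.completeSpace_coe (hs := IsSeqClosed.isClosed fun F p hF hp i => ?_)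
  have h1 : Tendsto (fun n => (F n).fst) atTop (𝓝 p.fst) :=
    ((WithLp.fstL 2 ℝ (L2xv d μ) (PiLp 2 (fun _ : Fin d => L2xv d μ))).continuous.tendsto p).comp hp
  have h2 : Tendsto (fun n => (F n).snd i) atTop (𝓝 (p.snd i)) :=
    (((PiLp.proj 2 (fun _ : Fin d => L2xv d μ) i :
      PiLp 2 (fun _ : Fin d => L2xv d μ) →L[ℝ] L2xv d μ).comp (WithLp.sndL 2 ℝ (L2xv d μ)
      (PiLp 2 (fun _ : Fin d => L2xv d μ)))).continuous.tendsto p).comp hp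
  -- `L²_{x,v}` convergence passes to slices only along a subsequence; the second extraction, from
  -- the first, handles function and derivative together.
  obtain ⟨φ, hφ, hs1⟩ := exists_subseq_tendsto_slices h1
  obtain ⟨ψ, hψ, hs2⟩ := exists_subseq_tendsto_slices (h2.comp hφ.tendsto_atTop)
  filter_upwards [hs1, hs2, ae_all_iff.2 fun n => hF n i, ae_memLp_slice p.fst,
    ae_memLp_slice (p.snd i), ae_all_iff.2 fun n => ae_memLp_slice (F n).fst,
    ae_all_iff.2 fun n => ae_memLp_slice ((F n).snd i)] with v a1 a2 a3 a4 a5 a6 a7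
  exact HasWeakDeriv.of_tendsto (fun n => a3 (φ (ψ n))) (fun n => a6 _) (fun n => a7 _) a4 a5
    (a1.comp hψ.tendsto_atTop) a2

/-- A bounded operator into `L²(V; H¹)` given by its components. -/
def liftL2H1 (A : L2H1 d μ →L[ℝ] L2xv d μ) (B : Fin d → L2H1 d μ →L[ℝ] L2xv d μ)
    (h : ∀ u i, ∀ᵐ v ∂μ, HasWeakDeriv i (fun x => A u (x, v)) (fun x => B i u (x, v))) :
    L2H1 d μ →L[ℝ] L2H1 d μ where
  toFun u := mkL2H1 (A u) (fun i => B i u) (h u)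
  map_add' u w := toL2_injective (by
    rw [toL2.map_add, toL2_mkL2H1, toL2_mkL2H1, toL2_mkL2H1,
      ContinuousLinearMap.map_add])
  map_smul' c u := toL2_injective (by
    rw [RingHom.id_apply, toL2.map_smul, toL2_mkL2H1, toL2_mkL2H1,
      ContinuousLinearMap.map_smul])
  cont := continuous_L2H1_iff.2 ⟨A.continuous, fun i => (B i).continuous⟩

/-- The transport group on `L²(V; H¹)`. -/
def transportH (τ : ℝ) : L2H1 d μ →L[ℝ] L2H1 d μ :=
  liftL2H1 ((transportL a τ).toContinuousLinearMap.comp toL2)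
    (fun i => (transportL a τ).toContinuousLinearMap.comp (gradL i)) fun u i => by
    filter_upwards [hasWeakDeriv_slice u i, transport_slice a τ (toL2 u),
      transport_slice a τ (gradL i u)] with v h1 h2 h3
    exact (h1.translate (shift (a v) τ)).congr h2.symm h3.symm

theorem toL2_transportH (τ : ℝ) (u : L2H1 d μ) :
    toL2 (transportH a τ u) = transport a τ (toL2 u) := rfl

theorem gradL_transportH (τ : ℝ) (u : L2H1 d μ) (i : Fin d) :
    gradL i (transportH a τ u) = transport a τ (gradL i u) := rfl

theorem norm_transportH (τ : ℝ) (u : L2H1 d μ) : ‖transportH a τ u‖ = ‖u‖ := by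
  rw [← sq_eq_sq₀ (norm_nonneg _) (norm_nonneg _), norm_sq_L2H1, norm_sq_L2H1]
  simp only [toL2_transportH, gradL_transportH, norm_transport]

theorem transportH_zero (u : L2H1 d μ) : transportH a 0 u = u :=
  toL2_injective (by rw [toL2_transportH, transport_zero])

theorem transportH_transportH (s t : ℝ) (u : L2H1 d μ) :
    transportH a s (transportH a t u) = transportH a (s + t) u :=
  toL2_injective (by simp only [toL2_transportH, transport_transport])

theorem continuous_transportH (u : L2H1 d μ) : Continuous fun τ => transportH a τ u :=
  continuous_L2H1_iff.2 ⟨continuous_transport a _, fun _ => continuous_transport a _⟩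

/-! ### The advection operator -/

theorem advection_slice (u : L2H1 d μ) : ∀ᵐ v ∂μ,
    (fun x => advection a u (x, v)) =ᵐ[volume] fun x => ∑ i, a v i * gradL i u (x, v) :=
  ae_slice (memLp_advection a fun i => u.1.snd i).coeFn_toLp

/-- `A` is the `L²_{x,v}` derivative of the group at `0` on all of `L²(V; H¹)`. The limit does not
hold in the `L²(V; H¹)` norm in general, so all later differentiations along the flow are made in
`L²_{x,v}`. -/
theorem tendsto_transport_slope (u : L2H1 d μ) :
    Tendsto (fun τ : ℝ => τ⁻¹ • (transport a τ (toL2 u) - toL2 u)) (𝓝[≠] 0)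
      (𝓝 (advection a u)) := by
  rw [tendsto_iff_norm_sub_tendsto_zero, ← tendsto_zero_iff_norm_tendsto_zero]
  refine tendsto_of_seq_tendsto fun τ hτ => ?_
  have hs : ∀ᵐ v ∂μ, ∀ n, (fun x => ((τ n)⁻¹ • (transport a (τ n) (toL2 u) - toL2 u) -
      advection a u : L2xv d μ) (x, v)) =ᵐ[volume]
      fun x => (τ n)⁻¹ * (toL2 u (x + shift (a v) (τ n), v) - toL2 u (x, v)) -
        ∑ i, a v i * gradL i u (x, v) := by
    refine ae_all_iff.2 fun n => ?_
    filter_upwards [transport_slice a (τ n) (toL2 u), advection_slice a u,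
      ae_slice (Lp.coeFn_sub (transport a (τ n) (toL2 u)) (toL2 u)),
      ae_slice (Lp.coeFn_smul (τ n)⁻¹ (transport a (τ n) (toL2 u) - toL2 u)),
      ae_slice (Lp.coeFn_sub ((τ n)⁻¹ • (transport a (τ n) (toL2 u) - toL2 u)) (advection a u))]
      with v h1 h2 h3 h4 h5
    filter_upwards [h1, h2, h3, h4, h5] with x h1 h2 h3 h4 h5
    rw [h5, Pi.sub_apply, h4, Pi.smul_apply, h3, Pi.sub_apply, h1, h2, smul_eq_mul]
  have hd : ∀ᵐ v ∂μ, (∀ i, HasWeakDeriv i (fun x => toL2 u (x, v)) (fun x => gradL i u (x, v))) ∧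
      MemLp (fun x => toL2 u (x, v)) 2 volume ∧ ∀ i, MemLp (fun x => gradL i u (x, v)) 2 volume :=
    (ae_all_iff.2 (hasWeakDeriv_slice u)).and
      ((ae_memLp_slice (toL2 u)).and (ae_all_iff.2 fun i => ae_memLp_slice (gradL i u)))
  refine tendsto_zero_of_slices (z := advection a u) (fun n => ?_) ?_
  · filter_upwards [hs, hd, advection_slice a u] with v hv h hA
    have h1 := (translate_diff_bounds h.2.1 h.2.2 h.1 (a v)).1 (τ n)
    refine (integral_congr_ae ((hv n).fun_comp (· ^ 2))).trans_le (h1.trans_eq ?_)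
    exact congrArg (4 * ·) (integral_congr_ae (hA.fun_comp (· ^ 2))).symm
  · filter_upwards [hs, hd] with v hv h
    refine ((translate_diff_bounds h.2.1 h.2.2 h.1 (a v)).2.comp hτ).congr fun n => ?_
    exact (integral_congr_ae ((hv n).fun_comp (· ^ 2))).symm

end Operators

end KineticDiffusion
-- Averaging, collision, multiplication and advection as bounded operators.
namespace KineticDiffusion

section Operators

variable {V : Type*} [MeasurableSpace V] {d : ℕ} {μ : Measure V} [IsProbabilityMeasure μ]

theorem ae_norm_le_norm_Linfty {α F : Type*} [MeasurableSpace α] {ν : Measure α}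
    [NormedAddCommGroup F] (n : Lp F ⊤ ν) : ∀ᵐ x ∂ν, ‖n x‖ ≤ ‖n‖ := by
  have hlt : eLpNormEssSup n ν < ⊤ := by simpa using (Lp.memLp n).2
  filter_upwards [enorm_ae_le_eLpNormEssSup n ν] with v hv
  rw [Lp.norm_def, eLpNorm_exponent_top]
  simpa using (ENNReal.toReal_mono hlt.ne hv)

theorem ae_fst {p : Torus d → Prop} (h : ∀ᵐ x, p x) :
    ∀ᵐ z ∂(volume : Measure (Torus d)).prod μ, p z.1 :=
  (measurePreserving_fst (μ := (volume : Measure (Torus d))) (ν := μ)).quasiMeasurePreserving.ae h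

theorem ae_snd {p : V → Prop} (h : ∀ᵐ v ∂μ, p v) :
    ∀ᵐ z ∂(volume : Measure (Torus d)).prod μ, p z.2 :=
  (measurePreserving_snd (μ := (volume : Measure (Torus d))) (ν := μ)).quasiMeasurePreserving.ae h

theorem integrable_L2xv (f : L2xv d μ) : Integrable f ((volume : Measure (Torus d)).prod μ) :=
  (Lp.memLp f).integrable (by norm_num)

/-- The velocity average `f ↦ ∫ f dμ`. -/
def averageL : L2xv d μ →L[ℝ] L2xv d μ :=
  LinearMap.mkContinuous
    { toFun := fun f => (memLp_average f).toLp _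
      map_add' := fun f g => by
        rw [← MemLp.toLp_add, MemLp.toLp_eq_toLp_iff]
        refine ae_fst (p := fun x => ∫ w, (f + g : L2xv d μ) (x, w) ∂μ =
          (∫ w, f (x, w) ∂μ) + ∫ w, g (x, w) ∂μ) ?_
        filter_upwards [Measure.ae_ae_of_ae_prod (Lp.coeFn_add f g),
          (integrable_L2xv f).prod_right_ae, (integrable_L2xv g).prod_right_ae] with x h1 h2 h3
        rw [← integral_add h2 h3]
        exact integral_congr_ae h1
      map_smul' := fun c f => by
        rw [RingHom.id_apply, ← MemLp.toLp_const_smul, MemLp.toLp_eq_toLp_iff]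
        refine ae_fst (p := fun x => ∫ w, (c • f : L2xv d μ) (x, w) ∂μ =
          c • ∫ w, f (x, w) ∂μ) ?_
        filter_upwards [Measure.ae_ae_of_ae_prod (Lp.coeFn_smul c f)] with x h1
        rw [← integral_smul]
        exact integral_congr_ae h1 } 1 fun f => by
    rw [one_mul, ← sq_le_sq₀ (norm_nonneg _) (norm_nonneg _)]
    change ‖(memLp_average f).toLp _‖ ^ 2 ≤ _
    have e : ∀ g : L2xv d μ, ‖g‖ ^ 2 = ∫ z, g z ^ 2 ∂(volume.prod μ) := fun g => by
      rw [← real_inner_self_eq_norm_sq, L2.inner_def]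
      simp [pow_two]
    rw [e, e]
    have e2 : ∫ z, (memLp_average f).toLp _ z ^ 2 ∂(volume.prod μ) =
        ∫ z : Torus d × V, (∫ w, f (z.1, w) ∂μ) ^ 2 ∂(volume.prod μ) :=
      integral_congr_ae ((memLp_average f).coeFn_toLp.fun_comp (· ^ 2))
    rw [e2, integral_prod _ (memLp_average f).integrable_sq,
      integral_prod _ (Lp.memLp f).integrable_sq]
    have i1 := (memLp_average f).integrable_sq.integral_prod_left
    refine integral_mono_ae i1 (Lp.memLp f).integrable_sq.integral_prod_left ?_
    filter_upwards [(Lp.memLp f).integrable_sq.prod_right_ae, (Lp.memLp f).1.prodMk_left]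
      with x hx hx'
    simpa using sq_integral_le_integral_sq ((memLp_two_iff_integrable_sq hx').2 hx)

theorem averageL_slice (f : L2xv d μ) : ∀ᵐ v ∂μ,
    (fun x => averageL f (x, v)) =ᵐ[volume] fun x => ∫ w, f (x, w) ∂μ :=
  ae_slice (memLp_average f).coeFn_toLp

/-- The collision operator as a bounded operator. -/
def collisionL : L2xv d μ →L[ℝ] L2xv d μ := averageL - ContinuousLinearMap.id ℝ _

/-- The velocity average on `L²(V; H¹)`. -/
def averageH : L2H1 d μ →L[ℝ] L2H1 d μ :=
  liftL2H1 (averageL.comp toL2) (fun i => averageL.comp (gradL i)) fun u i => by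
    have h := HasWeakDeriv.average (i := i) (integrable_L2xv (toL2 u)) (integrable_L2xv (gradL i u))
      (hasWeakDeriv_slice u i)
    filter_upwards [averageL_slice (toL2 u), averageL_slice (gradL i u)] with v h1 h2
    exact h.congr h1.symm h2.symm

/-- The collision operator on `L²(V; H¹)`. -/
def collisionH : L2H1 d μ →L[ℝ] L2H1 d μ := averageH - ContinuousLinearMap.id ℝ _

theorem toL2_collisionH (u : L2H1 d μ) : toL2 (collisionH u) = collision (toL2 u) := by
  rw [collisionH, sub_apply, toL2.map_sub]
  rfl

/-- Multiplication of `f ∈ L²_{x,v}` by `n ∈ L^∞(𝕋^d)`. -/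
def multL : Lp ℝ ⊤ (volume : Measure (Torus d)) →L[ℝ] L2xv d μ →L[ℝ] L2xv d μ :=
  LinearMap.mkContinuous₂ (LinearMap.mk₂ ℝ (fun n f => (memLp_mulNoise f n).toLp _)
    (fun n n' f => by
      rw [← MemLp.toLp_add, MemLp.toLp_eq_toLp_iff]
      filter_upwards [ae_fst (μ := μ) (Lp.coeFn_add n n')] with z hz
      simp only [hz, Pi.add_apply, mul_add])
    (fun c n f => by
      rw [← MemLp.toLp_const_smul, MemLp.toLp_eq_toLp_iff]
      filter_upwards [ae_fst (μ := μ) (Lp.coeFn_smul c n)] with z hz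
      simp only [hz, Pi.smul_apply, smul_eq_mul]
      ring)
    (fun n f f' => by
      rw [← MemLp.toLp_add, MemLp.toLp_eq_toLp_iff]
      filter_upwards [Lp.coeFn_add f f'] with z hz
      simp only [hz, Pi.add_apply, add_mul])
    (fun c n f => by
      rw [← MemLp.toLp_const_smul, MemLp.toLp_eq_toLp_iff]
      filter_upwards [Lp.coeFn_smul c f] with z hz
      simp only [hz, Pi.smul_apply, smul_eq_mul]
      ring)) 1 fun n f => by
    rw [one_mul]
    change ‖(memLp_mulNoise f n).toLp _‖ ≤ _
    refine Lp.norm_le_mul_norm_of_ae_le_mul ?_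
    filter_upwards [(memLp_mulNoise f n).coeFn_toLp, ae_fst (μ := μ) (ae_norm_le_norm_Linfty n)]
      with z h1 h2
    rw [h1, norm_mul, mul_comm]
    gcongr

theorem multL_apply (n : Lp ℝ ⊤ (volume : Measure (Torus d))) (f : L2xv d μ) :
    multL n f = (memLp_mulNoise f n).toLp _ := rfl

theorem mulNoise_eq (f : L2xv d μ) (n : W1inf d) : mulNoise f n = multL n.1.1 f := rfl

theorem norm_multL_le (n : Lp ℝ ⊤ (volume : Measure (Torus d))) (f : L2xv d μ) :
    ‖multL n f‖ ≤ ‖n‖ * ‖f‖ := by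
  have h : ‖(multL : Lp ℝ ⊤ (volume : Measure (Torus d)) →L[ℝ] L2xv d μ →L[ℝ] L2xv d μ)‖ ≤ 1 :=
    LinearMap.mkContinuous₂_norm_le _ zero_le_one _
  calc ‖multL n f‖ ≤ ‖multL‖ * ‖n‖ * ‖f‖ := multL.le_opNorm₂ n f
    _ ≤ 1 * ‖n‖ * ‖f‖ := by gcongr
    _ = _ := by ring

theorem multL_slice (n : Lp ℝ ⊤ (volume : Measure (Torus d))) (f : L2xv d μ) : ∀ᵐ v ∂μ,
    (fun x => multL n f (x, v)) =ᵐ[volume] fun x => f (x, v) * n x :=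
  ae_slice (memLp_mulNoise f n).coeFn_toLp

/-- Multiplication by `n ∈ W^{1,∞}(𝕋^d)` on `L²(V; H¹)`. -/
def noiseH (n : W1inf d) : L2H1 d μ →L[ℝ] L2H1 d μ :=
  liftL2H1 ((multL n.1.1).comp toL2)
    (fun i => (multL n.1.1).comp (gradL i) + (multL (n.1.2 i)).comp toL2) fun u i => by
    filter_upwards [hasWeakDeriv_slice u i, ae_memLp_slice (toL2 u), ae_memLp_slice (gradL i u),
      multL_slice n.1.1 (toL2 u), multL_slice n.1.1 (gradL i u), multL_slice (n.1.2 i) (toL2 u),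
      ae_slice (Lp.coeFn_add (multL n.1.1 (gradL i u)) (multL (n.1.2 i) (toL2 u)))]
      with v h1 h2 h3 h4 h5 h6 h7
    refine (h1.mul (n.2 i) h2 h3 (Lp.memLp _) (Lp.memLp _)).congr h4.symm ?_
    filter_upwards [h5, h6, h7] with x h5 h6 h7
    exact (h7.trans (congrArg₂ (· + ·) h5 h6)).symm

theorem toL2_noiseH (n : W1inf d) (u : L2H1 d μ) : toL2 (noiseH n u) = multL n.1.1 (toL2 u) := rfl

theorem gradL_noiseH (n : W1inf d) (u : L2H1 d μ) (i : Fin d) :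
    gradL i (noiseH n u) = multL n.1.1 (gradL i u) + multL (n.1.2 i) (toL2 u) := rfl

theorem continuous_multL {α : Type*} [TopologicalSpace α]
    {n : α → Lp ℝ ⊤ (volume : Measure (Torus d))} {f : α → L2xv d μ} (hn : Continuous n)
    (hf : Continuous f) : Continuous fun x => multL (n x) (f x) :=
  (multL.continuous.comp hn).clm_apply hf

theorem continuous_noiseH : Continuous fun p : W1inf d × L2H1 d μ => noiseH p.1 p.2 := by
  have h1 : Continuous fun p : W1inf d × L2H1 d μ => p.1.1.1 := by fun_prop
  have h2 : ∀ i, Continuous fun p : W1inf d × L2H1 d μ => p.1.1.2 i := fun i => by fun_prop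
  refine continuous_L2H1_iff.2 ⟨continuous_multL h1 (toL2.continuous.comp continuous_snd),
    fun i => ?_⟩
  exact (continuous_multL h1 ((gradL i).continuous.comp continuous_snd)).add
    (continuous_multL (h2 i) (toL2.continuous.comp continuous_snd))

theorem norm_toL2_le (u : L2H1 d μ) : ‖toL2 u‖ ≤ ‖u‖ := by
  rw [← sq_le_sq₀ (norm_nonneg _) (norm_nonneg _), norm_sq_L2H1]
  have := Finset.sum_nonneg fun i (_ : i ∈ Finset.univ) => sq_nonneg ‖gradL i u‖
  linarith

theorem norm_gradL_le (u : L2H1 d μ) (i : Fin d) : ‖gradL i u‖ ≤ ‖u‖ := by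
  rw [← sq_le_sq₀ (norm_nonneg _) (norm_nonneg _), norm_sq_L2H1]
  have := Finset.single_le_sum (f := fun i => ‖gradL i u‖ ^ 2) (fun i _ => sq_nonneg _)
    (Finset.mem_univ i)
  have := sq_nonneg ‖toL2 u‖
  linarith

/-- The function component is at most `‖n‖ ‖u‖` and each of the `d` gradient components at most
twice that; then `1 + 4d ≤ (1 + 2d)²`. -/
theorem norm_noiseH_le (n : W1inf d) (u : L2H1 d μ) :
    ‖noiseH n u‖ ≤ (1 + 2 * d) * ‖n‖ * ‖u‖ := by
  have h1 : ‖n.1.1‖ ≤ ‖n‖ := norm_fst_le n.1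
  have h2 : ∀ i, ‖n.1.2 i‖ ≤ ‖n‖ := fun i => (norm_le_pi_norm n.1.2 i).trans (norm_snd_le n.1)
  have e1 : ‖toL2 (noiseH n u)‖ ≤ ‖n‖ * ‖u‖ := by
    rw [toL2_noiseH]
    exact (norm_multL_le _ _).trans
      (mul_le_mul h1 (norm_toL2_le u) (norm_nonneg _) (norm_nonneg _))
  have e2 : ∀ i, ‖gradL i (noiseH n u)‖ ≤ 2 * (‖n‖ * ‖u‖) := fun i => by
    rw [gradL_noiseH]
    refine (norm_add_le _ _).trans ?_
    have a1 := (norm_multL_le n.1.1 (gradL i u)).trans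
      (mul_le_mul h1 (norm_gradL_le u i) (norm_nonneg _) (norm_nonneg _))
    have a2 := (norm_multL_le (n.1.2 i) (toL2 u)).trans
      (mul_le_mul (h2 i) (norm_toL2_le u) (norm_nonneg _) (norm_nonneg _))
    linarith
  rw [← sq_le_sq₀ (norm_nonneg _) (by positivity), norm_sq_L2H1]
  set r := ‖n‖ * ‖u‖ with hr
  have hr0 : 0 ≤ r := by positivity
  have e3 : ∑ i, ‖gradL i (noiseH n u)‖ ^ 2 ≤ ∑ _i : Fin d, (2 * r) ^ 2 := by
    gcongr with i
    exact e2 i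
  have e4 : ‖toL2 (noiseH n u)‖ ^ 2 ≤ r ^ 2 := by gcongr
  have e5 : (1 + 2 * d) * ‖n‖ * ‖u‖ = (1 + 2 * d) * r := by rw [hr]; ring
  rw [e5]
  simp only [Finset.sum_const, Finset.card_univ, Fintype.card_fin, nsmul_eq_mul] at e3
  have : (0 : ℝ) ≤ (d : ℝ) ^ 2 * r ^ 2 := by positivity
  nlinarith

theorem ae_norm_velocity_mul_le (a : Lp (EuclideanSpace ℝ (Fin d)) ⊤ μ) (i : Fin d)
    (g : L2xv d μ) : ∀ᵐ p ∂(volume : Measure (Torus d)).prod μ,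
      ‖a p.2 i * g p‖ ≤ ‖a‖ * ‖g p‖ := by
  filter_upwards [ae_snd (d := d) (ae_norm_le_norm_Linfty a)] with p hp
  rw [norm_mul]
  gcongr
  exact (PiLp.norm_apply_le (a p.2) i).trans hp

theorem memLp_velocity_mul (a : Lp (EuclideanSpace ℝ (Fin d)) ⊤ μ) (i : Fin d) (g : L2xv d μ) :
    MemLp (fun p : Torus d × V => a p.2 i * g p) 2 (volume.prod μ) :=
  (Lp.memLp g).of_le_mul ((((EuclideanSpace.proj (𝕜 := ℝ) i).continuous.measurable.comp
    (Lp.stronglyMeasurable a).measurable).comp measurable_snd).aestronglyMeasurable.mul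
    (Lp.memLp g).1) (ae_norm_velocity_mul_le a i g)

/-- Multiplication by the `i`-th component of the velocity. -/
def velocityL (a : Lp (EuclideanSpace ℝ (Fin d)) ⊤ μ) (i : Fin d) : L2xv d μ →L[ℝ] L2xv d μ :=
  LinearMap.mkContinuous
    { toFun := fun g => (memLp_velocity_mul a i g).toLp _
      map_add' := fun f g => by
        rw [← MemLp.toLp_add, MemLp.toLp_eq_toLp_iff]
        filter_upwards [Lp.coeFn_add f g] with z hz
        simp only [hz, Pi.add_apply, mul_add]
      map_smul' := fun c g => by
        rw [RingHom.id_apply, ← MemLp.toLp_const_smul, MemLp.toLp_eq_toLp_iff]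
        filter_upwards [Lp.coeFn_smul c g] with z hz
        simp only [hz, Pi.smul_apply, smul_eq_mul]
        ring } ‖a‖ fun g => by
    refine Lp.norm_le_mul_norm_of_ae_le_mul ?_
    filter_upwards [(memLp_velocity_mul a i g).coeFn_toLp, ae_norm_velocity_mul_le a i g] with z h1 h2
    exact (congrArg norm h1).trans_le h2

theorem coeFn_velocityL (a : Lp (EuclideanSpace ℝ (Fin d)) ⊤ μ) (i : Fin d) (g : L2xv d μ) :
    velocityL a i g =ᵐ[volume.prod μ] fun p => a p.2 i * g p := (memLp_velocity_mul a i g).coeFn_toLp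

/-- The advection operator as a bounded operator. -/
def advectionL (a : Lp (EuclideanSpace ℝ (Fin d)) ⊤ μ) : L2H1 d μ →L[ℝ] L2xv d μ :=
  ∑ i, (velocityL a i).comp (gradL i)

theorem advectionL_apply (a : Lp (EuclideanSpace ℝ (Fin d)) ⊤ μ) (u : L2H1 d μ) :
    advectionL a u = advection a u := by
  refine Lp.ext (EventuallyEq.trans ?_ (memLp_advection a fun i => u.1.snd i).coeFn_toLp.symm)
  rw [advectionL, sum_apply]
  filter_upwards [Lp.coeFn_finsetSum Finset.univ fun i => (velocityL a i).comp (gradL i) u,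
    ae_all_iff.2 fun i => coeFn_velocityL a i (gradL i u)] with z h1 h2
  rw [h1, Finset.sum_apply]
  exact Finset.sum_congr rfl fun i _ => h2 i

end Operators

end KineticDiffusion
-- Strong measurability in spite of the nonseparable noise space.
namespace KineticDiffusion

section Separability

variable {V : Type*} [MeasurableSpace V] {d : ℕ} {μ : Measure V} [IsProbabilityMeasure μ]

theorem norm_sq_Lp_two {α : Type*} [MeasurableSpace α] {ν : Measure α} (g : Lp ℝ 2 ν) :
    ‖g‖ ^ 2 = ∫ z, g z ^ 2 ∂ν := by
  rw [← real_inner_self_eq_norm_sq, L2.inner_def]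
  simp [pow_two]

/-- `B` factors through an isometry defined on the range of `A`, which is separable. -/
theorem isSeparable_range_of_dist_eq {α X Y : Type*} [PseudoMetricSpace X] [SecondCountableTopology X]
    [MetricSpace Y] {A : α → X} {B : α → Y} (h : ∀ n n', dist (A n) (A n') = dist (B n) (B n')) :
    TopologicalSpace.IsSeparable (range B) := by
  choose c hc using fun y : range A => y.2
  have hiso : Isometry fun y : range A => B (c y) := Isometry.of_dist_eq fun y y' => by
    rw [← h, hc, hc]; rfl
  refine (TopologicalSpace.isSeparable_range hiso.continuous).mono ?_
  rintro _ ⟨n, rfl⟩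
  refine ⟨⟨A n, n, rfl⟩, ?_⟩
  change B (c ⟨A n, n, rfl⟩) = B n
  rw [← dist_eq_zero, ← h, hc, dist_self]

/-- Although `L^∞` is not separable in general, `‖(n - n') w‖` is the distance of `n` and `n'` in
`L²(ν)`, where `ν` is the image on the torus of the finite measure with density `w²`. `L²(ν)` is
separable because the σ-algebra of the torus is countably generated. -/
theorem isSeparable_range_multL (w : L2xv d μ) :
    TopologicalSpace.IsSeparable
      (range fun n : Lp ℝ ⊤ (volume : Measure (Torus d)) => multL n w) := by
  have hwm : Measurable fun z => ENNReal.ofReal (w z ^ 2) :=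
    ((Lp.stronglyMeasurable w).measurable.pow_const 2).ennreal_ofReal
  set ρ : Measure (Torus d × V) := (volume.prod μ).withDensity fun z => ENNReal.ofReal (w z ^ 2)
    with hρ
  have : IsFiniteMeasure ρ := isFiniteMeasure_withDensity_ofReal (Lp.memLp w).integrable_sq.2
  set ν : Measure (Torus d) := ρ.map Prod.fst with hν
  have : IsFiniteMeasure ν := by rw [hν]; infer_instance
  have : Fact ((2 : ℝ≥0∞) ≠ ⊤) := ⟨by norm_num⟩
  have i1 : MeasurableSpace.CountablyGenerated (Torus d) := inferInstance
  have i2 : SFinite ν := inferInstance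
  have i3 : MeasureTheory.IsSeparable ν := inferInstance
  have hac : ν ≪ volume := by
    have h1 : ν ≪ ((volume : Measure (Torus d)).prod μ).map Prod.fst :=
      (withDensity_absolutelyContinuous _ _).map measurable_fst
    simpa using h1
  have hmem : ∀ n : Lp ℝ ⊤ (volume : Measure (Torus d)), MemLp n 2 ν := fun n =>
    MemLp.of_bound (Lp.stronglyMeasurable n).aestronglyMeasurable ‖n‖
      (hac.ae_le (ae_norm_le_norm_Linfty n))
  refine isSeparable_range_of_dist_eq (A := fun n => (hmem n).toLp n) fun n n' => ?_
  rw [dist_eq_norm, dist_eq_norm, ← sq_eq_sq₀ (norm_nonneg _) (norm_nonneg _), ← MemLp.toLp_sub,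
    norm_sq_Lp_two, norm_sq_Lp_two]
  have hm : Measurable fun x => (n x - n' x) ^ 2 :=
    ((Lp.stronglyMeasurable n).measurable.sub (Lp.stronglyMeasurable n').measurable).pow_const 2
  have e1 : ∫ x, ((hmem n).sub (hmem n')).toLp _ x ^ 2 ∂ν = ∫ x, (n x - n' x) ^ 2 ∂ν :=
    integral_congr_ae (((hmem n).sub (hmem n')).coeFn_toLp.fun_comp (· ^ 2))
  rw [e1, hν, integral_map measurable_fst.aemeasurable hm.aestronglyMeasurable, hρ,
    integral_withDensity_eq_integral_toReal_smul hwm (Eventually.of_forall fun _ =>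
      ENNReal.ofReal_lt_top)]
  refine integral_congr_ae ?_
  filter_upwards [Lp.coeFn_sub (multL n w) (multL n' w), (memLp_mulNoise w n).coeFn_toLp,
    (memLp_mulNoise w n').coeFn_toLp] with z h1 h2 h3
  rw [h1, Pi.sub_apply, multL_apply, multL_apply, h2, h3, ENNReal.toReal_ofReal (sq_nonneg _),
    smul_eq_mul]
  ring

theorem isSeparable_range_noiseH (u : L2H1 d μ) :
    TopologicalSpace.IsSeparable (range fun n : W1inf d => noiseH n u) := by
  set S : Set (L2xv d μ × (Fin d → L2xv d μ)) :=
    (range fun n => multL n (toL2 u)) ×ˢ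
      univ.pi fun i => (fun p : L2xv d μ × L2xv d μ => p.1 + p.2) ''
        ((range fun n => multL n (gradL i u)) ×ˢ (range fun n => multL n (toL2 u))) with hS
  have h1 : TopologicalSpace.IsSeparable S :=
    (isSeparable_range_multL _).prod (TopologicalSpace.IsSeparable.univ_pi fun i =>
      ((isSeparable_range_multL _).prod (isSeparable_range_multL _)).image continuous_add)
  refine (isInducing_L2H1.isSeparable_preimage h1).mono ?_
  rintro _ ⟨n, rfl⟩
  exact ⟨⟨n.1.1, rfl⟩, fun i _ => ⟨(multL n.1.1 (gradL i u), multL (n.1.2 i) (toL2 u)),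
    ⟨⟨n.1.1, rfl⟩, ⟨n.1.2 i, rfl⟩⟩, rfl⟩⟩

theorem stronglyMeasurable_of_continuous_of_isSeparable {α Y Z : Type*} [MeasurableSpace α]
    [TopologicalSpace Y] [MeasurableSpace Y] [OpensMeasurableSpace Y] [TopologicalSpace Z]
    [TopologicalSpace.PseudoMetrizableSpace Z] {g : Y → Z} (hg : Continuous g)
    (hs : TopologicalSpace.IsSeparable (range g)) {M : α → Y} (hM : Measurable M) :
    StronglyMeasurable fun x => g (M x) := by
  borelize Z
  exact stronglyMeasurable_iff_measurable_separable.2 ⟨hg.measurable.comp hM,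
    hs.mono (range_comp_subset_range M g)⟩

theorem stronglyMeasurable_noiseH {α : Type*} [MeasurableSpace α] {M : α → W1inf d}
    (hM : Measurable M) (u : L2H1 d μ) : StronglyMeasurable fun x => noiseH (M x) u :=
  stronglyMeasurable_of_continuous_of_isSeparable
    (continuous_noiseH.comp (Continuous.prodMk_left u)) (isSeparable_range_noiseH u) hM

theorem stronglyMeasurable_mulNoise {α : Type*} [MeasurableSpace α] {M : α → W1inf d}
    (hM : Measurable M) (f : L2xv d μ) : StronglyMeasurable fun x => mulNoise f (M x) := by
  simp only [mulNoise_eq]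
  refine stronglyMeasurable_of_continuous_of_isSeparable (g := fun n : W1inf d => multL n.1.1 f)
    (continuous_multL (by fun_prop) continuous_const) ?_ hM
  exact (isSeparable_range_multL f).mono (by rintro _ ⟨n, rfl⟩; exact ⟨n.1.1, rfl⟩)

/-- A Carathéodory function composed with a strongly measurable function. -/
theorem stronglyMeasurable_caratheodory {α Y Z : Type*} {mα : MeasurableSpace α}
    [TopologicalSpace Y] [TopologicalSpace Z] [TopologicalSpace.PseudoMetrizableSpace Z]
    {Φ : α → Y → Z} {y : α → Y} (hΦ : ∀ c, StronglyMeasurable fun x => Φ x c)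
    (hc : ∀ x, Continuous (Φ x)) (hy : StronglyMeasurable y) :
    StronglyMeasurable fun x => Φ x (y x) := by
  -- For a simple second argument only finitely many functions `Φ · c` occur; their simple
  -- approximations are glued along its fibres.
  have h1 : ∀ k, StronglyMeasurable fun x => Φ x (hy.approx k x) := fun k => by
    refine stronglyMeasurable_of_tendsto atTop
      (f := fun j => ⇑((hy.approx k).bind fun c => (hΦ c).approx j))
      (fun j => SimpleFunc.stronglyMeasurable _) (tendsto_pi_nhds.2 fun x => ?_)
    simp only [SimpleFunc.bind_apply]
    exact (hΦ (hy.approx k x)).tendsto_approx x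
  refine stronglyMeasurable_of_tendsto atTop h1 (tendsto_pi_nhds.2 fun x => ?_)
  exact ((hc x).tendsto _).comp (hy.tendsto_approx x)

end Separability

end KineticDiffusion
-- Time integrals are adapted up to null sets.
namespace KineticDiffusion

section Adapted

variable {Ω S X : Type*} {𝒢 : MeasurableSpace Ω} {mΩ : MeasurableSpace Ω} [MeasurableSpace S] {P : Measure Ω}
  [IsProbabilityMeasure P] {ν : Measure S} [IsFiniteMeasure ν]

theorem integral_mul_eq_zero_of_condExp (h𝒢 : 𝒢 ≤ mΩ) {Z D : Ω → ℝ}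
    (hZ : AEStronglyMeasurable[𝒢] Z P) (hD : Integrable D P) (hZD : Integrable (Z * D) P)
    (h : P[D|𝒢] =ᵐ[P] 0) : ∫ ω, Z ω * D ω ∂P = 0 := by
  have h1 := condExp_mul_of_aestronglyMeasurable_left hZ hZD hD
  have h2 : ∫ ω, (Z * D) ω ∂P = 0 := by
    rw [← integral_condExp h𝒢]
    refine integral_eq_zero_of_ae (h1.trans ?_)
    filter_upwards [h] with ω hω
    simp [hω]
  exact h2

variable {Φ : S → Ω → ℝ} {C : ℝ}

theorem integrable_uncurry_of_bound [NormedAddCommGroup X] {Φ : S → Ω → X}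
    (hΦ : StronglyMeasurable (Function.uncurry Φ))
    (hb : ∀ᵐ s ∂ν, ∀ ω, ‖Φ s ω‖ ≤ C) : Integrable (Function.uncurry Φ) (ν.prod P) := by
  refine Integrable.of_bound hΦ.aestronglyMeasurable C ?_
  have := (Measure.quasiMeasurePreserving_fst (μ := ν) (ν := P)).ae hb
  filter_upwards [this] with p hp
  exact hp p.2

theorem norm_integral_le_of_ae_bound [NormedAddCommGroup X] [NormedSpace ℝ X] {Φ : S → Ω → X}
    (hb : ∀ᵐ s ∂ν, ∀ ω, ‖Φ s ω‖ ≤ C) (ω : Ω) : ‖∫ s, Φ s ω ∂ν‖ ≤ C * ν.real univ :=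
  norm_integral_le_of_norm_le_const (hb.mono fun _ hs => hs ω)

/-- Averages in time of measurable random variables are measurable up to null sets. -/
theorem aestronglyMeasurable_integral_real (h𝒢 : 𝒢 ≤ mΩ)
    (hΦ : StronglyMeasurable (Function.uncurry Φ)) (hb : ∀ᵐ s ∂ν, ∀ ω, ‖Φ s ω‖ ≤ C)
    (hm : ∀ᵐ s ∂ν, AEStronglyMeasurable[𝒢] (Φ s) P) :
    (fun ω => ∫ s, Φ s ω ∂ν) =ᵐ[P] P[fun ω => ∫ s, Φ s ω ∂ν|𝒢] := by
  set Y : Ω → ℝ := fun ω => ∫ s, Φ s ω ∂ν with hY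
  have hYi : Integrable Y P := (integrable_uncurry_of_bound (P := P) hΦ hb).integral_prod_right
  set R := C * ν.real univ with hR
  have hYb : ∀ ω, |Y ω| ≤ R := fun ω => norm_integral_le_of_ae_bound hb ω
  have hY'b : ∀ᵐ ω ∂P, |P[Y|𝒢] ω| ≤ R :=
    ae_bdd_abs_condExp_of_ae_bdd_abs (Eventually.of_forall hYb)
  set D : Ω → ℝ := Y - P[Y|𝒢] with hD
  have hDi : Integrable D P := hYi.sub integrable_condExp
  have hDb : ∀ᵐ ω ∂P, ‖D ω‖ ≤ 2 * R := by
    filter_upwards [hY'b] with ω h2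
    have h1 := hYb ω
    rw [hD, Pi.sub_apply]
    refine (norm_sub_le _ _).trans ?_
    rw [Real.norm_eq_abs, Real.norm_eq_abs]
    linarith
  have hDc : P[D|𝒢] =ᵐ[P] 0 := by
    refine (condExp_sub hYi integrable_condExp 𝒢).trans ?_
    rw [condExp_of_stronglyMeasurable h𝒢 stronglyMeasurable_condExp integrable_condExp, sub_self]
  -- By Fubini `E[Y D]` is the integral over `s` of `E[Φ_s D]`, and each of these vanishes as `Φ_s`
  -- is `𝒢`-measurable and `E[D | 𝒢] = 0`. With the analogous `e2` this gives `E[D²] = 0`; no joint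
  -- measurability with respect to `𝒢` is used.
  have e1 : ∫ ω, Y ω * D ω ∂P = 0 := by
    have hint : Integrable (Function.uncurry fun ω s => Φ s ω * D ω) (P.prod ν) := by
      have h1 : Integrable (fun p : Ω × S => Φ p.2 p.1) (P.prod ν) :=
        (integrable_uncurry_of_bound hΦ hb).swap
      refine h1.mul_bdd (c := 2 * R) (hDi.1.comp_fst) ?_
      exact (Measure.quasiMeasurePreserving_fst (μ := P) (ν := ν)).ae hDb
    calc ∫ ω, Y ω * D ω ∂P = ∫ ω, ∫ s, Φ s ω * D ω ∂ν ∂P := by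
          simp only [hY, integral_mul_const]
      _ = ∫ s, ∫ ω, Φ s ω * D ω ∂P ∂ν := integral_integral_swap hint
      _ = 0 := by
          refine integral_eq_zero_of_ae ?_
          filter_upwards [hm, hb] with s hs hsb
          refine integral_mul_eq_zero_of_condExp h𝒢 hs hDi ?_ hDc
          exact hDi.bdd_mul (c := C) (hs.mono h𝒢) (Eventually.of_forall hsb)
  have e2 : ∫ ω, P[Y|𝒢] ω * D ω ∂P = 0 :=
    integral_mul_eq_zero_of_condExp h𝒢 stronglyMeasurable_condExp.aestronglyMeasurable hDi
      (hDi.bdd_mul (c := R) integrable_condExp.1 hY'b) hDc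
  have e3 : ∫ ω, D ω ^ 2 ∂P = 0 := by
    have : ∀ ω, D ω ^ 2 = Y ω * D ω - P[Y|𝒢] ω * D ω := fun ω => by
      rw [hD, Pi.sub_apply]; ring
    simp only [this]
    rw [integral_sub (hDi.bdd_mul (c := R) hYi.1 (Eventually.of_forall hYb))
      (hDi.bdd_mul (c := R) integrable_condExp.1 hY'b), e1, e2, sub_zero]
  have hD2 : Integrable (fun ω => D ω ^ 2) P := by
    simp only [pow_two]
    exact hDi.bdd_mul (c := 2 * R) hDi.1 hDb
  have h0 := (integral_eq_zero_iff_of_nonneg (fun ω => sq_nonneg (D ω)) hD2).1 e3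
  filter_upwards [h0] with ω hω
  have : D ω = 0 := by simpa using hω
  exact sub_eq_zero.1 this

variable [NormedAddCommGroup X] [NormedSpace ℝ X] [CompleteSpace X]

/-- Continuous linear functionals reduce this to the real case. They detect that `Y - E[Y | 𝒢]`
vanishes almost surely because this variable has a separable range, even if `X` itself is not
separable. -/
theorem aestronglyMeasurable_integral (h𝒢 : 𝒢 ≤ mΩ) {Φ : S → Ω → X}
    (hΦ : StronglyMeasurable (Function.uncurry Φ)) (hb : ∀ᵐ s ∂ν, ∀ ω, ‖Φ s ω‖ ≤ C)
    (hm : ∀ᵐ s ∂ν, AEStronglyMeasurable[𝒢] (Φ s) P) :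
    AEStronglyMeasurable[𝒢] (fun ω => ∫ s, Φ s ω ∂ν) P := by
  set Y : Ω → X := fun ω => ∫ s, Φ s ω ∂ν with hY
  have hYm : StronglyMeasurable Y := hΦ.integral_prod_left
  have hYi : Integrable Y P := (integrable_uncurry_of_bound (P := P) hΦ hb).integral_prod_right
  refine ⟨P[Y|𝒢], stronglyMeasurable_condExp, ?_⟩
  have hi : ∀ ω, Integrable (fun s => Φ s ω) ν := fun ω =>
    Integrable.of_bound (hΦ.comp_measurable measurable_prodMk_right).aestronglyMeasurable C
      (hb.mono fun _ hs => hs ω)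
  have key : ∀ c : StrongDual ℝ X, (fun ω => c (Y ω - P[Y|𝒢] ω)) =ᵐ[P] 0 := by
    intro c
    have h1 := aestronglyMeasurable_integral_real (P := P) (ν := ν) (Φ := fun s ω => c (Φ s ω))
      (C := ‖c‖ * C) h𝒢 (c.continuous.comp_stronglyMeasurable hΦ)
      (hb.mono fun s hs ω => (c.le_opNorm _).trans (by gcongr; exact hs ω))
      (hm.mono fun s hs => c.continuous.comp_aestronglyMeasurable hs)
    have h2 : (fun ω => ∫ s, c (Φ s ω) ∂ν) = c ∘ Y := by
      funext ω
      exact c.integral_comp_comm (hi ω)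
    rw [h2] at h1
    filter_upwards [h1, c.comp_condExp_comm hYi (m := 𝒢)] with ω h1 h2
    rw [map_sub, Pi.zero_apply, sub_eq_zero]
    exact h1.trans h2.symm
  have hs : TopologicalSpace.IsSeparable (range fun ω => Y ω - P[Y|𝒢] ω) :=
    (hYm.sub (stronglyMeasurable_condExp.mono h𝒢)).isSeparable_range
  have := ae_eq_zero_of_forall_dual_of_isSeparable ℝ hs key
    (Eventually.of_forall fun ω => mem_range_self ω)
  filter_upwards [this] with ω hω
  exact sub_eq_zero.1 hω

end Adapted

/-! ### The Dyson series of a bounded linear equation, and Gronwall's lemma. -/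

section Dyson

open scoped Nat

variable {Ω H : Type*} {mΩ : MeasurableSpace Ω} [NormedAddCommGroup H] [NormedSpace ℝ H]
 (C : ℝ → Ω → H →L[ℝ] H) (u₀ : H)

/-- The terms of the Dyson series of the linear equation `g' = C g`, `g(0) = u₀`. -/
def dysonTerm : ℕ → ℝ → Ω → H
  | 0 => fun _ _ => u₀
  | k + 1 => fun t ω => ∫ s in Ioc 0 t, C s ω (dysonTerm k s ω)

/-- The solution of the linear equation `g' = C g`, `g(0) = u₀`. -/
def dyson (t : ℝ) (ω : Ω) : H := ∑' k, dysonTerm C u₀ k t ω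

variable {C u₀} {K : ℝ}

/-- Iterated integration produces the factorial. For `t ≤ 0` the domain `Ioc 0 t` is empty, whence
`max t 0`. -/
theorem norm_dysonTerm_le (hK0 : 0 ≤ K) (hK : ∀ s ω, ‖C s ω‖ ≤ K) (k : ℕ) (t : ℝ) (ω : Ω) :
    ‖dysonTerm C u₀ k t ω‖ ≤ ‖u₀‖ * ((K * max t 0) ^ k / k !) := by
  induction k generalizing t with
  | zero => simp [dysonTerm]
  | succ k ih =>
    by_cases ht : t ≤ 0
    · simp [dysonTerm, Ioc_eq_empty (not_lt.2 ht)]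
      positivity
    push Not at ht
    have hbound : ∀ s ∈ Ioc 0 t, ‖C s ω (dysonTerm C u₀ k s ω)‖ ≤
        K * (‖u₀‖ * ((K * s) ^ k / k !)) := fun s hs => by
      have h1 := ih s
      rw [max_eq_left hs.1.le] at h1
      exact ((C s ω).le_opNorm _).trans (mul_le_mul (hK s ω) h1 (norm_nonneg _) hK0)
    have hint : IntegrableOn (fun s : ℝ => K * (‖u₀‖ * ((K * s) ^ k / k !))) (Ioc 0 t) :=
      ((by fun_prop : Continuous fun s : ℝ => K * (‖u₀‖ * ((K * s) ^ k / k !))).integrableOn_Icc).mono_set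
        Ioc_subset_Icc_self
    have h1 : ‖dysonTerm C u₀ (k + 1) t ω‖ ≤ ∫ s in Ioc 0 t, K * (‖u₀‖ * ((K * s) ^ k / k !)) :=
      norm_integral_le_of_norm_le hint ((ae_restrict_iff' measurableSet_Ioc).2
        (Eventually.of_forall hbound))
    refine h1.trans_eq ?_
    rw [← intervalIntegral.integral_of_le ht.le, max_eq_left ht.le]
    have : ∀ s : ℝ, K * (‖u₀‖ * ((K * s) ^ k / k !)) = (K * ‖u₀‖ * K ^ k / k !) * s ^ k := fun s => by
      rw [mul_pow]; ring
    simp only [this]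
    rw [intervalIntegral.integral_const_mul, integral_pow, Nat.factorial_succ]
    push_cast
    field_simp
    ring

end Dyson

end KineticDiffusion
namespace KineticDiffusion

/-- Since `𝒢` need not contain the null sets, the limit is taken of `𝒢`-measurable versions, through
`limUnder`, which is `𝒢`-measurable everywhere. -/
theorem aestronglyMeasurable_of_tendsto {Ω X : Type*} {𝒢 mΩ : MeasurableSpace Ω} {P : Measure Ω}
    [NormedAddCommGroup X] [CompleteSpace X] {f : ℕ → Ω → X} {g : Ω → X}
    (hf : ∀ n, AEStronglyMeasurable[𝒢] (f n) P)
    (h : ∀ᵐ ω ∂P, Tendsto (fun n => f n ω) atTop (𝓝 (g ω))) : AEStronglyMeasurable[𝒢] g P := by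
  choose f' hf' he using hf
  have : Nonempty X := ⟨0⟩
  refine ⟨fun ω => limUnder atTop fun n => f' n ω,
    @StronglyMeasurable.limUnder ℕ Ω X 𝒢 _ _ atTop _ f' _ _ hf', ?_⟩
  filter_upwards [h, ae_all_iff.2 he] with ω h1 h2
  simp only [h2] at h1
  exact h1.limUnder_eq.symm

section Dyson

open scoped Nat

variable {Ω H : Type*} {mΩ : MeasurableSpace Ω} [NormedAddCommGroup H] [NormedSpace ℝ H]
  {C : ℝ → Ω → H →L[ℝ] H} {u₀ : H} {K : ℝ}

/-- Measurability of `B` is required pointwise in the vector only: in operator norm the noise would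
be out of reach, its range being nonseparable. -/
theorem stronglyMeasurable_clm_apply {α : Type*} [MeasurableSpace α] {B : α → H →L[ℝ] H} {g : α → H}
    (hB : ∀ u, StronglyMeasurable fun x => B x u) (hg : StronglyMeasurable g) :
    StronglyMeasurable fun x => B x (g x) :=
  stronglyMeasurable_caratheodory hB (fun x => (B x).continuous) hg

theorem stronglyMeasurable_dysonTerm (hC : ∀ u, StronglyMeasurable fun p : ℝ × Ω => C p.1 p.2 u)
    (k : ℕ) : StronglyMeasurable (Function.uncurry (dysonTerm C u₀ k)) := by
  induction k with
  | zero => exact stronglyMeasurable_const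
  | succ k ih =>
    have h1 : StronglyMeasurable fun p : ℝ × Ω => C p.1 p.2 (dysonTerm C u₀ k p.1 p.2) :=
      stronglyMeasurable_clm_apply hC ih
    set A : Set ((ℝ × Ω) × ℝ) := {q | 0 < q.2 ∧ q.2 ≤ q.1.1} with hA
    have hAm : MeasurableSet A :=
      (measurableSet_lt measurable_const measurable_snd).inter
        (measurableSet_le measurable_snd (measurable_fst.comp measurable_fst))
    have h2 : StronglyMeasurable fun q : (ℝ × Ω) × ℝ => A.indicator
        (fun q => C q.2 q.1.2 (dysonTerm C u₀ k q.2 q.1.2)) q :=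
      (h1.comp_measurable (measurable_snd.prodMk (measurable_snd.comp measurable_fst))).indicator hAm
    have h3 := h2.integral_prod_right' (ν := volume)
    convert! h3 using 2 with p
    simp only [Function.uncurry, dysonTerm]
    rw [← integral_indicator measurableSet_Ioc]
    rfl

theorem aestronglyMeasurable_dysonTerm [CompleteSpace H] {P : Measure Ω} [IsProbabilityMeasure P]
    {𝒢 : ℝ → MeasurableSpace Ω} (hle : ∀ t, 𝒢 t ≤ mΩ) (hmono : Monotone 𝒢) (hK0 : 0 ≤ K)
    (hK : ∀ s ω, ‖C s ω‖ ≤ K) (hC : ∀ u, StronglyMeasurable fun p : ℝ × Ω => C p.1 p.2 u)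
    (hC' : ∀ s u, StronglyMeasurable[𝒢 s] fun ω => C s ω u) (k : ℕ) (t : ℝ) :
    AEStronglyMeasurable[𝒢 t] (dysonTerm C u₀ k t) P := by
  induction k generalizing t with
  | zero => exact (@stronglyMeasurable_const _ _ (𝒢 t) _ u₀).aestronglyMeasurable
  | succ k ih =>
    refine aestronglyMeasurable_integral (S := ℝ) (ν := volume.restrict (Ioc 0 t))
      (C := K * (‖u₀‖ * ((K * max t 0) ^ k / k !))) (hle t)
      (Φ := fun s ω => C s ω (dysonTerm C u₀ k s ω))
      (stronglyMeasurable_clm_apply hC (stronglyMeasurable_dysonTerm hC k)) ?_ ?_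
    · refine (ae_restrict_iff' measurableSet_Ioc).2 (Eventually.of_forall fun s hs ω => ?_)
      refine ((C s ω).le_opNorm _).trans (mul_le_mul (hK s ω)
        ((norm_dysonTerm_le hK0 hK k s ω).trans ?_) (norm_nonneg _) hK0)
      gcongr
      exact hs.2
    · refine (ae_restrict_iff' measurableSet_Ioc).2 (Eventually.of_forall fun s hs => ?_)
      obtain ⟨d', hd', he⟩ := ih s
      -- The inductive term is replaced by a `𝒢 s`-measurable version before `C` is applied to it.
      refine ⟨fun ω => C s ω (d' ω), ?_, ?_⟩
      · exact (@stronglyMeasurable_clm_apply _ _ _ _ (𝒢 s) _ _ (hC' s) hd').mono (hmono hs.2)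
      · filter_upwards [he] with ω hω
        rw [hω]

theorem norm_dyson_le (hK0 : 0 ≤ K) (hK : ∀ s ω, ‖C s ω‖ ≤ K) (t : ℝ) (ω : Ω) :
    ‖dyson C u₀ t ω‖ ≤ ‖u₀‖ * Real.exp (K * max t 0) := by
  have h : HasSum (fun k : ℕ => ‖u₀‖ * ((K * max t 0) ^ k / k !))
      (‖u₀‖ * Real.exp (K * max t 0)) := by
    rw [Real.exp_eq_exp_ℝ]
    exact (NormedSpace.expSeries_div_hasSum_exp (K * max t 0)).mul_left _
  exact tsum_of_norm_bounded h fun k => norm_dysonTerm_le hK0 hK k t ω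

variable [CompleteSpace H]

theorem summable_dysonTerm (hK0 : 0 ≤ K) (hK : ∀ s ω, ‖C s ω‖ ≤ K) (t : ℝ) (ω : Ω) :
    Summable fun k => dysonTerm C u₀ k t ω :=
  Summable.of_norm_bounded ((Real.summable_pow_div_factorial _).mul_left ‖u₀‖)
    fun k => norm_dysonTerm_le hK0 hK k t ω

theorem stronglyMeasurable_dyson (hK0 : 0 ≤ K) (hK : ∀ s ω, ‖C s ω‖ ≤ K)
    (hC : ∀ u, StronglyMeasurable fun p : ℝ × Ω => C p.1 p.2 u) :
    StronglyMeasurable (Function.uncurry (dyson C u₀)) := by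
  refine stronglyMeasurable_of_tendsto atTop
    (f := fun n p => ∑ k ∈ Finset.range n, Function.uncurry (dysonTerm C u₀ k) p)
    (fun n => Finset.stronglyMeasurable_fun_sum _ fun k _ => stronglyMeasurable_dysonTerm hC k)
    (tendsto_pi_nhds.2 fun p => ?_)
  exact (summable_dysonTerm hK0 hK p.1 p.2).hasSum.tendsto_sum_nat

theorem aestronglyMeasurable_dyson {P : Measure Ω} [IsProbabilityMeasure P]
    {𝒢 : ℝ → MeasurableSpace Ω} (hle : ∀ t, 𝒢 t ≤ mΩ) (hmono : Monotone 𝒢) (hK0 : 0 ≤ K)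
    (hK : ∀ s ω, ‖C s ω‖ ≤ K) (hC : ∀ u, StronglyMeasurable fun p : ℝ × Ω => C p.1 p.2 u)
    (hC' : ∀ s u, StronglyMeasurable[𝒢 s] fun ω => C s ω u) (t : ℝ) :
    AEStronglyMeasurable[𝒢 t] (dyson C u₀ t) P := by
  refine aestronglyMeasurable_of_tendsto
    (f := fun n ω => ∑ k ∈ Finset.range n, dysonTerm C u₀ k t ω)
    (fun n => ?_) (Eventually.of_forall fun ω => ?_)
  · induction n with
    | zero => simpa using (@stronglyMeasurable_const _ _ (𝒢 t) _ (0 : H)).aestronglyMeasurable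
    | succ n ih =>
      simp only [Finset.sum_range_succ]
      exact ih.add (aestronglyMeasurable_dysonTerm hle hmono hK0 hK hC hC' n t)
  · exact (summable_dysonTerm hK0 hK t ω).hasSum.tendsto_sum_nat

/-- Termwise integration, justified by the exponential majorant; the integral of the `k`-th term is
term `k + 1`. -/
theorem dyson_eq (hK0 : 0 ≤ K) (hK : ∀ s ω, ‖C s ω‖ ≤ K)
    (hC : ∀ u, StronglyMeasurable fun p : ℝ × Ω => C p.1 p.2 u) (t : ℝ) (ω : Ω) :
    dyson C u₀ t ω = u₀ + ∫ s in Ioc 0 t, C s ω (dyson C u₀ s ω) := by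
  have hb : ∀ k, ∀ᵐ s ∂(volume.restrict (Ioc 0 t)), ‖C s ω (dysonTerm C u₀ k s ω)‖ ≤
      K * (‖u₀‖ * ((K * max t 0) ^ k / k !)) := fun k => by
    refine (ae_restrict_iff' measurableSet_Ioc).2 (Eventually.of_forall fun s hs => ?_)
    refine ((C s ω).le_opNorm _).trans (mul_le_mul (hK s ω)
      ((norm_dysonTerm_le hK0 hK k s ω).trans ?_) (norm_nonneg _) hK0)
    gcongr
    exact hs.2
  have hi : ∀ k, Integrable (fun s => C s ω (dysonTerm C u₀ k s ω)) (volume.restrict (Ioc 0 t)) :=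
    fun k => Integrable.of_bound
      ((stronglyMeasurable_clm_apply hC (stronglyMeasurable_dysonTerm hC k)).comp_measurable
        measurable_prodMk_right).aestronglyMeasurable _ (hb k)
  have hs : Summable fun k => ∫ s in Ioc 0 t, ‖C s ω (dysonTerm C u₀ k s ω)‖ := by
    refine Summable.of_nonneg_of_le (fun k => integral_nonneg fun _ => norm_nonneg _) (fun k => ?_)
      ((((Real.summable_pow_div_factorial (K * max t 0)).mul_left ‖u₀‖).mul_left K).mul_right
        (volume.real (Ioc 0 t)))
    have := norm_integral_le_of_norm_le_const
      (f := fun s => ‖C s ω (dysonTerm C u₀ k s ω)‖) (by simpa only [norm_norm] using hb k)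
    rw [Real.norm_of_nonneg (integral_nonneg fun _ => norm_nonneg _)] at this
    simpa using this
  have h1 := hasSum_integral_of_summable_integral_norm hi hs
  have h2 : ∀ s, ∑' k, C s ω (dysonTerm C u₀ k s ω) = C s ω (dyson C u₀ s ω) := fun s =>
    ((C s ω).map_tsum (summable_dysonTerm hK0 hK s ω)).symm
  simp only [h2] at h1
  rw [dyson, (summable_dysonTerm hK0 hK t ω).tsum_eq_zero_add, ← h1.tsum_eq]
  rfl

/-- Iterating the inequality from a bound `B` on `[0, t]` gives `B (K t)^k / k!`, which tends to
`0`. -/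
theorem eq_zero_of_norm_le_integral {X : Type*} [NormedAddCommGroup X] {δ : ℝ → X}
    (hc : ContinuousOn δ (Ici 0)) (hK0 : 0 ≤ K)
    (h : ∀ t, 0 ≤ t → ‖δ t‖ ≤ K * ∫ s in (0 : ℝ)..t, ‖δ s‖) (t : ℝ) (ht : 0 ≤ t) : δ t = 0 := by
  obtain ⟨B, hB⟩ := (isCompact_Icc (a := (0 : ℝ)) (b := t)).exists_bound_of_continuousOn
    (hc.mono Icc_subset_Ici_self)
  have key : ∀ (k : ℕ) (s : ℝ), s ∈ Icc 0 t → ‖δ s‖ ≤ B * ((K * s) ^ k / k !) := by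
    intro k
    induction k with
    | zero => simpa using hB
    | succ k ih =>
      intro s hs
      refine (h s hs.1).trans ?_
      have h1 : ∫ r in (0 : ℝ)..s, ‖δ r‖ ≤ ∫ r in (0 : ℝ)..s, B * ((K * r) ^ k / k !) := by
        refine intervalIntegral.integral_mono_on hs.1 ?_ ?_ fun r hr => ih r ⟨hr.1, hr.2.trans hs.2⟩
        · refine ContinuousOn.intervalIntegrable (hc.norm.mono ?_)
          rw [uIcc_of_le hs.1]
          exact Icc_subset_Ici_self
        · exact (by fun_prop : Continuous fun r : ℝ => B * ((K * r) ^ k / k !)).intervalIntegrable _ _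
      refine (mul_le_mul_of_nonneg_left h1 hK0).trans_eq ?_
      have : ∀ r : ℝ, B * ((K * r) ^ k / k !) = (B * K ^ k / k !) * r ^ k := fun r => by
        rw [mul_pow]; ring
      simp only [this]
      rw [intervalIntegral.integral_const_mul, integral_pow, Nat.factorial_succ]
      push_cast
      field_simp
      ring
  have hl : Tendsto (fun k : ℕ => B * ((K * t) ^ k / k !)) atTop (𝓝 0) := by
    simpa using (FloorSemiring.tendsto_pow_div_factorial_atTop (K * t)).const_mul B
  have := ge_of_tendsto' hl fun k => key k t ⟨ht, le_rfl⟩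
  simpa using this

end Dyson

end KineticDiffusion
-- The solution in `L²(V; H¹)`, built in the interaction picture.
namespace KineticDiffusion

section Instances

variable {V : Type*} [MeasurableSpace V] {d : ℕ} {μ : Measure V} [IsProbabilityMeasure μ]

instance instNormedAddCommGroupL2H1 : NormedAddCommGroup (L2H1 d μ) := inferInstance
instance instSeminormedAddCommGroupL2H1 : SeminormedAddCommGroup (L2H1 d μ) := inferInstance
instance instNormedSpaceL2H1 : NormedSpace ℝ (L2H1 d μ) := inferInstance
instance instAddCommGroupL2H1 : AddCommGroup (L2H1 d μ) := inferInstance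
instance instAddCommMonoidL2H1 : AddCommMonoid (L2H1 d μ) := inferInstance
instance instModuleL2H1 : Module ℝ (L2H1 d μ) := inferInstance
instance instMulActionL2H1 : MulAction ℝ (L2H1 d μ) := inferInstance
instance instPseudoMetrizableSpaceL2H1 : TopologicalSpace.PseudoMetrizableSpace (L2H1 d μ) :=
  inferInstance
instance instSecondCountableTopologyEitherL2H1 : SecondCountableTopologyEither ℝ (L2H1 d μ) :=
  ⟨Or.inl inferInstance⟩
instance instSMulL2H1 : SMul ℝ (L2H1 d μ) := inferInstance
instance instAddL2H1 : Add (L2H1 d μ) := inferInstance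
instance instSubL2H1 : Sub (L2H1 d μ) := inferInstance
instance instNormL2H1 : Norm (L2H1 d μ) := inferInstance
instance instIsTopologicalAddGroupL2H1 : IsTopologicalAddGroup (L2H1 d μ) := inferInstance
instance instContinuousAddL2H1 : ContinuousAdd (L2H1 d μ) := inferInstance
instance instContinuousConstSMulL2H1 : ContinuousConstSMul ℝ (L2H1 d μ) := inferInstance

end Instances

section Solution

variable {V : Type*} [MeasurableSpace V] {d : ℕ} {μ : Measure V} [IsProbabilityMeasure μ]
  (a : Lp (EuclideanSpace ℝ (Fin d)) ⊤ μ) (ε : ℝ)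

/-- `f ↦ ε⁻² L f + ε⁻¹ f n` on `L²_{x,v}`. -/
def driftL (n : W1inf d) : L2xv d μ →L[ℝ] L2xv d μ := (ε ^ 2)⁻¹ • collisionL + ε⁻¹ • multL n.1.1

theorem driftL_apply (n : W1inf d) (f : L2xv d μ) :
    driftL ε n f = (ε ^ 2)⁻¹ • collision f + ε⁻¹ • mulNoise f n := rfl

/-- `f ↦ ε⁻² L f + ε⁻¹ f n` on `L²(V; H¹)`. -/
def driftH (n : W1inf d) : L2H1 d μ →L[ℝ] L2H1 d μ := 
  (ε ^ 2)⁻¹ • (collisionH : L2H1 d μ →L[ℝ] L2H1 d μ) + ε⁻¹ • (noiseH n : L2H1 d μ →L[ℝ] L2H1 d μ)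

theorem driftH_apply (n : W1inf d) (u : L2H1 d μ) :
    driftH ε n u = (ε ^ 2)⁻¹ • (collisionH u : L2H1 d μ) + ε⁻¹ • (noiseH n u : L2H1 d μ) := rfl

theorem toL2_driftH (n : W1inf d) (u : L2H1 d μ) :
    toL2 (driftH ε n u) = driftL ε n (toL2 u) := by
  rw [driftH_apply, driftL_apply, toL2.map_add, toL2.map_smul, toL2.map_smul, toL2_collisionH,
    toL2_noiseH, mulNoise_eq]

theorem exists_norm_driftH_le (R : ℝ) (hR : 0 ≤ R) : ∃ K, 0 ≤ K ∧ ∀ n : W1inf d, ‖n‖ ≤ R →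
    ‖(driftH ε n : L2H1 d μ →L[ℝ] L2H1 d μ)‖ ≤ K ∧
    ‖(driftL ε n : L2xv d μ →L[ℝ] L2xv d μ)‖ ≤ K := by
  refine ⟨|(ε ^ 2)⁻¹| * ‖(collisionH : L2H1 d μ →L[ℝ] L2H1 d μ)‖ +
    |(ε ^ 2)⁻¹| * ‖(collisionL : L2xv d μ →L[ℝ] L2xv d μ)‖ + |ε⁻¹| * ((1 + 2 * d) * R),
    by positivity, fun n hn => ⟨?_, ?_⟩⟩
  · have h1 : ‖(noiseH n : L2H1 d μ →L[ℝ] L2H1 d μ)‖ ≤ (1 + 2 * d) * R :=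
      ContinuousLinearMap.opNorm_le_bound _ (by positivity) fun u =>
        (norm_noiseH_le n u).trans (by gcongr)
    refine (norm_add_le _ _).trans ?_
    rw [norm_smul, norm_smul, Real.norm_eq_abs, Real.norm_eq_abs]
    have h2 : |ε⁻¹| * ‖(noiseH n : L2H1 d μ →L[ℝ] L2H1 d μ)‖ ≤ |ε⁻¹| * ((1 + 2 * d) * R) := by
      gcongr
    have h3 : 0 ≤ |(ε ^ 2)⁻¹| * ‖(collisionL : L2xv d μ →L[ℝ] L2xv d μ)‖ := by positivity
    linarith
  · have h1 : ‖(multL n.1.1 : L2xv d μ →L[ℝ] L2xv d μ)‖ ≤ (1 + 2 * d) * R := by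
      refine ContinuousLinearMap.opNorm_le_bound _ (by positivity) fun u =>
        (norm_multL_le _ u).trans ?_
      gcongr
      have := (norm_fst_le n.1).trans hn
      nlinarith
    refine (norm_add_le _ _).trans ?_
    rw [norm_smul, norm_smul, Real.norm_eq_abs, Real.norm_eq_abs]
    have h2 : |ε⁻¹| * ‖(multL n.1.1 : L2xv d μ →L[ℝ] L2xv d μ)‖ ≤ |ε⁻¹| * ((1 + 2 * d) * R) := by
      gcongr
    have h3 : 0 ≤ |(ε ^ 2)⁻¹| * ‖(collisionH : L2H1 d μ →L[ℝ] L2H1 d μ)‖ := by positivity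
    linarith

/-- A strongly continuous family of isometries is jointly continuous: moving the vector costs
exactly its own displacement. -/
theorem continuous_isometry_family {α X : Type*} [TopologicalSpace α] [NormedAddCommGroup X]
    {T : ℝ → X → X} (hT : ∀ f, Continuous fun τ => T τ f) (hn : ∀ τ f g, ‖T τ f - T τ g‖ = ‖f - g‖)
    {τ : α → ℝ} {F : α → X} (hτ : Continuous τ) (hF : Continuous F) :
    Continuous fun x => T (τ x) (F x) := by
  refine continuous_iff_continuousAt.2 fun x₀ => ?_
  rw [ContinuousAt, tendsto_iff_norm_sub_tendsto_zero]
  have h1 : Tendsto (fun x => ‖F x - F x₀‖ + ‖T (τ x) (F x₀) - T (τ x₀) (F x₀)‖) (𝓝 x₀) (𝓝 0) := by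
    have := (tendsto_iff_norm_sub_tendsto_zero.1 (hF.tendsto x₀)).add
      (tendsto_iff_norm_sub_tendsto_zero.1 (((hT (F x₀)).comp hτ).tendsto x₀))
    simpa using this
  refine squeeze_zero (fun _ => norm_nonneg _) (fun x => ?_) h1
  rw [← hn (τ x) (F x) (F x₀)]
  exact norm_sub_le_norm_sub_add_norm_sub _ _ _

theorem continuous_transport₂ {α : Type*} [TopologicalSpace α] {τ : α → ℝ} {F : α → L2xv d μ}
    (hτ : Continuous τ) (hF : Continuous F) : Continuous fun x => transport a (τ x) (F x) :=
  continuous_isometry_family (continuous_transport a)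
    (fun τ f g => by rw [← transport_sub, norm_transport]) hτ hF

theorem continuous_transportH₂ {α : Type*} [TopologicalSpace α] {τ : α → ℝ} {F : α → L2H1 d μ}
    (hτ : Continuous τ) (hF : Continuous F) : Continuous fun x => transportH a (τ x) (F x) :=
  continuous_isometry_family (T := fun τ u => transportH a τ u) (continuous_transportH a)
    (fun τ f g => by rw [← (transportH a τ).map_sub, norm_transportH]) hτ hF

theorem stronglyMeasurable_transportH {α : Type*} [MeasurableSpace α] {τ : α → ℝ}
    {F : α → L2H1 d μ} (hτ : Measurable τ) (hF : StronglyMeasurable F) :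
    StronglyMeasurable fun x => transportH a (τ x) (F x) :=
  stronglyMeasurable_clm_apply (B := fun x => transportH a (τ x))
    (fun u => (continuous_transportH a u).stronglyMeasurable.comp_measurable hτ) hF

theorem stronglyMeasurable_transport {α : Type*} [MeasurableSpace α] {τ : α → ℝ}
    {F : α → L2xv d μ} (hτ : Measurable τ) (hF : StronglyMeasurable F) :
    StronglyMeasurable fun x => transport a (τ x) (F x) :=
  stronglyMeasurable_clm_apply (B := fun x => (transportL a (τ x)).toContinuousLinearMap)
    (fun f => (continuous_transport a f).stronglyMeasurable.comp_measurable hτ) hF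

theorem stronglyMeasurable_driftH {α : Type*} [MeasurableSpace α] {M : α → W1inf d}
    {F : α → L2H1 d μ} (hM : Measurable M) (hF : StronglyMeasurable F) :
    StronglyMeasurable fun x => driftH ε (M x) (F x) :=
  stronglyMeasurable_clm_apply
    (fun u => stronglyMeasurable_const.add ((stronglyMeasurable_noiseH hM u).const_smul ε⁻¹)) hF

theorem stronglyMeasurable_driftL {α : Type*} [MeasurableSpace α] {M : α → W1inf d}
    {F : α → L2xv d μ} (hM : Measurable M) (hF : StronglyMeasurable F) :
    StronglyMeasurable fun x => driftL ε (M x) (F x) :=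
  stronglyMeasurable_clm_apply
    (fun u => stronglyMeasurable_const.add ((stronglyMeasurable_mulNoise hM u).const_smul ε⁻¹)) hF

variable {Ω : Type*} {mΩ : MeasurableSpace Ω} (M : ℝ → Ω → W1inf d)

/-- The drift in the interaction picture. -/
def interaction (s : ℝ) (ω : Ω) : L2H1 d μ →L[ℝ] L2H1 d μ :=
  (transportH a (s / ε)).comp ((driftH ε (M s ω)).comp (transportH a (-(s / ε))))

theorem interaction_apply (s : ℝ) (ω : Ω) (u : L2H1 d μ) : interaction a ε M s ω u =
    transportH a (s / ε) (driftH ε (M s ω) (transportH a (-(s / ε)) u)) := rfl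

/-- The solution of the kinetic equation in `L²(V; H¹)`, in the interaction picture. -/
def solG (u₀ : L2H1 d μ) : ℝ → Ω → L2H1 d μ := dyson (interaction a ε M) u₀

/-- The solution of the kinetic equation in `L²(V; H¹)`. -/
def solH (u₀ : L2H1 d μ) (t : ℝ) (ω : Ω) : L2H1 d μ :=
  transportH a (-(t / ε)) (solG a ε M u₀ t ω)

variable {a ε M} {K R : ℝ} {u₀ : L2H1 d μ}

theorem norm_interaction_le (hK0 : 0 ≤ K)
    (hK : ∀ s ω, ‖(driftH ε (M s ω) : L2H1 d μ →L[ℝ] L2H1 d μ)‖ ≤ K) (s : ℝ) (ω : Ω) :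
    ‖interaction a ε M s ω‖ ≤ K := by
  refine ContinuousLinearMap.opNorm_le_bound _ hK0 fun u => ?_
  rw [interaction_apply, norm_transportH]
  refine ((driftH ε (M s ω)).le_opNorm _).trans ?_
  rw [norm_transportH]
  gcongr
  exact hK s ω

theorem stronglyMeasurable_interaction (hM : Measurable (Function.uncurry M)) (u : L2H1 d μ) :
    StronglyMeasurable fun p : ℝ × Ω => interaction a ε M p.1 p.2 u := by
  simp only [interaction_apply]
  have h1 : StronglyMeasurable fun p : ℝ × Ω => transportH a (-(p.1 / ε)) u :=
    stronglyMeasurable_transportH a (τ := fun p : ℝ × Ω => -(p.1 / ε)) (F := fun _ => u)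
      (measurable_fst.div_const ε).neg stronglyMeasurable_const
  have h2 : StronglyMeasurable fun p : ℝ × Ω =>
      driftH ε (M p.1 p.2) (transportH a (-(p.1 / ε)) u) :=
    stronglyMeasurable_driftH ε (M := fun p : ℝ × Ω => M p.1 p.2) hM h1
  exact stronglyMeasurable_transportH a (τ := fun p : ℝ × Ω => p.1 / ε)
    (measurable_fst.div_const ε) h2

theorem stronglyMeasurable_interaction_fixed {𝒢 : MeasurableSpace Ω} {s : ℝ}
    (hM : Measurable[𝒢] (M s)) (u : L2H1 d μ) :
    StronglyMeasurable[𝒢] fun ω => interaction a ε M s ω u := by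
  simp only [interaction_apply]
  have h2 : StronglyMeasurable[𝒢] fun ω =>
      driftH ε (M s ω) (transportH a (-(s / ε)) u) :=
    stronglyMeasurable_driftH ε (M := fun ω => M s ω) (F := fun _ => transportH a (-(s / ε)) u)
      hM stronglyMeasurable_const
  exact (transportH a (s / ε)).continuous.comp_stronglyMeasurable h2

theorem stronglyMeasurable_solH (hM : Measurable (Function.uncurry M)) (hK0 : 0 ≤ K)
    (hK : ∀ s ω, ‖(driftH ε (M s ω) : L2H1 d μ →L[ℝ] L2H1 d μ)‖ ≤ K) :
    StronglyMeasurable (Function.uncurry (solH a ε M u₀)) :=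
  stronglyMeasurable_transportH a (measurable_fst.div_const ε).neg
    (stronglyMeasurable_dyson hK0 (norm_interaction_le hK0 hK)
      (stronglyMeasurable_interaction hM))

theorem norm_solH_le (hK0 : 0 ≤ K)
    (hK : ∀ s ω, ‖(driftH ε (M s ω) : L2H1 d μ →L[ℝ] L2H1 d μ)‖ ≤ K) (t : ℝ) (ω : Ω) :
    ‖solH a ε M u₀ t ω‖ ≤ ‖u₀‖ * Real.exp (K * max t 0) := by
  rw [solH, norm_transportH]
  exact norm_dyson_le hK0 (norm_interaction_le hK0 hK) t ω

theorem aestronglyMeasurable_solG {P : Measure Ω} [IsProbabilityMeasure P]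
    {𝒢 : ℝ → MeasurableSpace Ω} (hle : ∀ t, 𝒢 t ≤ mΩ) (hmono : Monotone 𝒢)
    (hM : Measurable (Function.uncurry M)) (hM' : ∀ t, Measurable[𝒢 t] (M t)) (hK0 : 0 ≤ K)
    (hK : ∀ s ω, ‖(driftH ε (M s ω) : L2H1 d μ →L[ℝ] L2H1 d μ)‖ ≤ K) (t : ℝ) :
    AEStronglyMeasurable[𝒢 t] (solG a ε M u₀ t) P :=
  aestronglyMeasurable_dyson hle hmono hK0 (norm_interaction_le hK0 hK)
    (stronglyMeasurable_interaction hM)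
    (fun s u => stronglyMeasurable_interaction_fixed (hM' s) u) t

theorem aestronglyMeasurable_solH {P : Measure Ω} [IsProbabilityMeasure P]
    {𝒢 : ℝ → MeasurableSpace Ω} (hle : ∀ t, 𝒢 t ≤ mΩ) (hmono : Monotone 𝒢)
    (hM : Measurable (Function.uncurry M)) (hM' : ∀ t, Measurable[𝒢 t] (M t)) (hK0 : 0 ≤ K)
    (hK : ∀ s ω, ‖(driftH ε (M s ω) : L2H1 d μ →L[ℝ] L2H1 d μ)‖ ≤ K) (t : ℝ) :
    AEStronglyMeasurable[𝒢 t] (solH a ε M u₀ t) P :=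
  (transportH a (-(t / ε))).continuous.comp_aestronglyMeasurable
    (aestronglyMeasurable_solG hle hmono hM hM' hK0 hK t)

theorem stronglyMeasurable_interaction_solG (hM : Measurable (Function.uncurry M)) (hK0 : 0 ≤ K)
    (hK : ∀ s ω, ‖(driftH ε (M s ω) : L2H1 d μ →L[ℝ] L2H1 d μ)‖ ≤ K) :
    StronglyMeasurable fun p : ℝ × Ω => interaction a ε M p.1 p.2 (solG a ε M u₀ p.1 p.2) :=
  stronglyMeasurable_clm_apply (B := fun p : ℝ × Ω => interaction a ε M p.1 p.2)
    (stronglyMeasurable_interaction hM)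
    (stronglyMeasurable_dyson hK0 (norm_interaction_le hK0 hK) (stronglyMeasurable_interaction hM))

theorem norm_interaction_solG_le (hK0 : 0 ≤ K)
    (hK : ∀ s ω, ‖(driftH ε (M s ω) : L2H1 d μ →L[ℝ] L2H1 d μ)‖ ≤ K) (t : ℝ) (ω : Ω) :
    ‖interaction a ε M t ω (solG a ε M u₀ t ω)‖ ≤ K * (‖u₀‖ * Real.exp (K * max t 0)) :=
  ((interaction a ε M t ω).le_opNorm _).trans (mul_le_mul (norm_interaction_le hK0 hK t ω)
    (norm_dyson_le hK0 (norm_interaction_le hK0 hK) t ω) (norm_nonneg _) hK0)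

theorem intervalIntegrable_interaction (hM : Measurable (Function.uncurry M)) (hK0 : 0 ≤ K)
    (hK : ∀ s ω, ‖(driftH ε (M s ω) : L2H1 d μ →L[ℝ] L2H1 d μ)‖ ≤ K) (ω : Ω) (r t : ℝ) :
    IntervalIntegrable (fun s => interaction a ε M s ω (solG a ε M u₀ s ω)) volume r t := by
  have h1 : Continuous fun s : ℝ => K * (‖u₀‖ * Real.exp (K * max s 0)) := by fun_prop
  refine (h1.intervalIntegrable r t).mono_fun'
    ((stronglyMeasurable_interaction_solG hM hK0 hK).comp_measurable
      measurable_prodMk_right).aestronglyMeasurable ?_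
  exact Eventually.of_forall fun s => norm_interaction_solG_le hK0 hK s ω

theorem solG_eq (hM : Measurable (Function.uncurry M)) (hK0 : 0 ≤ K)
    (hK : ∀ s ω, ‖(driftH ε (M s ω) : L2H1 d μ →L[ℝ] L2H1 d μ)‖ ≤ K) {t : ℝ} (ht : 0 ≤ t) (ω : Ω) :
    solG a ε M u₀ t ω = u₀ + ∫ s in (0 : ℝ)..t, interaction a ε M s ω (solG a ε M u₀ s ω) := by
  rw [intervalIntegral.integral_of_le ht]
  exact dyson_eq hK0 (norm_interaction_le hK0 hK) (stronglyMeasurable_interaction hM) t ω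

/-- For negative times the series reduces to `u₀`. The formula valid on all of `ℝ` yields continuity
of `solG` there. -/
theorem solG_eq_max (hM : Measurable (Function.uncurry M)) (hK0 : 0 ≤ K)
    (hK : ∀ s ω, ‖(driftH ε (M s ω) : L2H1 d μ →L[ℝ] L2H1 d μ)‖ ≤ K) (t : ℝ) (ω : Ω) :
    solG a ε M u₀ t ω =
      u₀ + ∫ s in (0 : ℝ)..max t 0, interaction a ε M s ω (solG a ε M u₀ s ω) := by
  rw [intervalIntegral.integral_of_le (le_max_right _ _), solG,
    dyson_eq hK0 (norm_interaction_le hK0 hK) (stronglyMeasurable_interaction hM) t ω]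
  congr 3
  by_cases h : 0 ≤ t
  · rw [max_eq_left h]
  · rw [max_eq_right (not_le.1 h).le, Ioc_self, Ioc_eq_empty (fun h' => h h'.le)]

theorem continuous_solG (hM : Measurable (Function.uncurry M)) (hK0 : 0 ≤ K)
    (hK : ∀ s ω, ‖(driftH ε (M s ω) : L2H1 d μ →L[ℝ] L2H1 d μ)‖ ≤ K) (ω : Ω) :
    Continuous fun t => solG a ε M u₀ t ω := by
  rw [show (fun t => solG a ε M u₀ t ω) = _ from
    funext fun t => solG_eq_max (u₀ := u₀) (a := a) hM hK0 hK t ω]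
  exact continuous_const.add ((intervalIntegral.continuous_primitive
    (fun r t => intervalIntegrable_interaction hM hK0 hK ω r t) 0).comp
    (continuous_id.max continuous_const))

theorem continuous_solH (hM : Measurable (Function.uncurry M)) (hK0 : 0 ≤ K)
    (hK : ∀ s ω, ‖(driftH ε (M s ω) : L2H1 d μ →L[ℝ] L2H1 d μ)‖ ≤ K) (ω : Ω) :
    Continuous fun t => solH a ε M u₀ t ω :=
  continuous_transportH₂ a (continuous_id.div_const ε).neg (continuous_solG hM hK0 hK ω)

end Solution

end KineticDiffusion
-- Identification with the mild solution in `L²_{x,v}`.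
namespace KineticDiffusion

section Identification

variable {V : Type*} [MeasurableSpace V] {d : ℕ} {μ : Measure V} [IsProbabilityMeasure μ]
  {a : Lp (EuclideanSpace ℝ (Fin d)) ⊤ μ} {ε : ℝ}
  {Ω : Type*} {mΩ : MeasurableSpace Ω} {M : ℝ → Ω → W1inf d} {K : ℝ} {u₀ : L2H1 d μ}

/-- The group law turns the integrand of the interaction picture into that of the mild formulation.
-/
theorem toL2_transportH_interaction (s t : ℝ) (ω : Ω) (u : L2H1 d μ) :
    toL2 (transportH a (-(t / ε)) (interaction a ε M s ω u)) =
      transport a (-((t - s) / ε)) (driftL ε (M s ω) (toL2 (transportH a (-(s / ε)) u))) := by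
  rw [interaction_apply, transportH_transportH, toL2_transportH, toL2_driftH]
  congr 1
  ring

theorem intervalIntegrable_mild (hM : Measurable (Function.uncurry M))
    (hKL : ∀ s ω, ‖(driftL ε (M s ω) : L2xv d μ →L[ℝ] L2xv d μ)‖ ≤ K) (ω : Ω)
    {y : ℝ → L2xv d μ} (hy : ContinuousOn y (Ici 0)) {t : ℝ} (ht : 0 ≤ t) :
    IntervalIntegrable (fun s => transport a (-((t - s) / ε)) (driftL ε (M s ω) (y s)))
      volume 0 t := by
  -- `y` is controlled on `[0, ∞)` only; extending it by its value at `0` gives a continuous, hence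
  -- measurable, function on `ℝ`.
  have hy' : Continuous fun s => y (max s 0) :=
    hy.comp_continuous (continuous_id.max continuous_const) fun s => mem_Ici.2 (le_max_right _ _)
  have hb : Continuous fun s => K * ‖y (max s 0)‖ := continuous_const.mul hy'.norm
  have hMω : Measurable fun s => M s ω := hM.comp measurable_prodMk_right
  have h1 : StronglyMeasurable fun s => transport a (-((t - s) / ε))
      (driftL ε (M s ω) (y (max s 0))) :=
    stronglyMeasurable_transport a (by fun_prop)
      (stronglyMeasurable_driftL ε hMω hy'.stronglyMeasurable)
  have h2 : IntervalIntegrable (fun s => transport a (-((t - s) / ε))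
      (driftL ε (M s ω) (y (max s 0)))) volume 0 t := by
    refine (hb.intervalIntegrable 0 t).mono_fun' h1.aestronglyMeasurable
      (Eventually.of_forall fun s => ?_)
    simp only [norm_transport]
    exact ((driftL ε (M s ω)).le_opNorm _).trans (by gcongr; exact hKL s ω)
  refine h2.congr fun s hs => ?_
  rw [uIoc_of_le ht] at hs
  simp only [max_eq_left hs.1.le]

theorem toL2_solH_eq (hM : Measurable (Function.uncurry M)) (hK0 : 0 ≤ K)
    (hK : ∀ s ω, ‖(driftH ε (M s ω) : L2H1 d μ →L[ℝ] L2H1 d μ)‖ ≤ K) {t : ℝ} (ht : 0 ≤ t) (ω : Ω) :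
    toL2 (solH a ε M u₀ t ω) = transport a (-(t / ε)) (toL2 u₀) + ∫ s in (0 : ℝ)..t,
      transport a (-((t - s) / ε)) (driftL ε (M s ω) (toL2 (solH a ε M u₀ s ω))) := by
  have h1 := solG_eq (u₀ := u₀) (a := a) hM hK0 hK ht ω
  have h2 := ((toL2.comp (transportH a (-(t / ε)))).intervalIntegral_comp_comm
    (intervalIntegrable_interaction (u₀ := u₀) (a := a) hM hK0 hK ω 0 t))
  simp only [ContinuousLinearMap.comp_apply, toL2_transportH_interaction] at h2
  rw [solH, h1, (transportH a (-(t / ε))).map_add, toL2.map_add, toL2_transportH]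
  exact congrArg _ h2.symm

/-- Solutions in `L²_{x,v}` with initial datum in `L²(V; H¹)` are `L²(V; H¹)`-valued. -/
theorem eq_toL2_solH (hM : Measurable (Function.uncurry M)) (hK0 : 0 ≤ K)
    (hK : ∀ s ω, ‖(driftH ε (M s ω) : L2H1 d μ →L[ℝ] L2H1 d μ)‖ ≤ K)
    (hKL : ∀ s ω, ‖(driftL ε (M s ω) : L2xv d μ →L[ℝ] L2xv d μ)‖ ≤ K) (ω : Ω)
    {y : ℝ → L2xv d μ} (hy : ContinuousOn y (Ici 0))
    (h : ∀ t, 0 ≤ t → y t = transport a (-(t / ε)) (toL2 u₀) + ∫ s in (0 : ℝ)..t,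
      transport a (-((t - s) / ε)) (driftL ε (M s ω) (y s))) {t : ℝ} (ht : 0 ≤ t) :
    y t = toL2 (solH a ε M u₀ t ω) := by
  set z : ℝ → L2xv d μ := fun t => toL2 (solH a ε M u₀ t ω) with hz
  have hzc : Continuous z := toL2.continuous.comp (continuous_solH hM hK0 hK ω)
  -- The difference solves the mild equation with zero datum. The transport being isometric, its
  -- norm is at most `K` times the integral of its norm.
  have key := eq_zero_of_norm_le_integral (K := K) (δ := fun t => y t - z t)
    (hy.sub hzc.continuousOn) hK0 (fun t ht => ?_) t ht
  · exact sub_eq_zero.1 key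
  · have e : y t - z t = ∫ s in (0 : ℝ)..t,
        transport a (-((t - s) / ε)) (driftL ε (M s ω) (y s - z s)) := by
      rw [h t ht, hz]
      simp only
      rw [toL2_solH_eq hM hK0 hK ht ω, add_sub_add_left_eq_sub, ← intervalIntegral.integral_sub
        (intervalIntegrable_mild hM hKL ω hy ht)
        (intervalIntegrable_mild hM hKL ω hzc.continuousOn ht)]
      simp only [map_sub, transport_sub]
      rfl
    simp only [e]
    rw [← intervalIntegral.integral_const_mul]
    refine intervalIntegral.norm_integral_le_of_norm_le ht (Eventually.of_forall fun s hs => ?_) ?_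
    · rw [norm_transport]
      exact ((driftL ε (M s ω)).le_opNorm _).trans (by gcongr; exact hKL s ω)
    · have : ContinuousOn (fun s => K * ‖y s - z s‖) (Ici 0) :=
        continuousOn_const.mul (hy.sub hzc.continuousOn).norm
      exact (this.mono fun s hs => (by rw [uIcc_of_le ht] at hs; exact hs.1)).intervalIntegrable

theorem along_eq {E : Set (W1inf d)} {m : ℝ → Ω → E} {f : ℝ → Ω → L2xv d μ} {u : L2H1 d μ}
    (F : L2H1 d μ → E → ℝ) {t : ℝ} {ω : Ω} (h : f t ω = toL2 u) :
    along m ε f F t ω = F u (m (t / ε ^ 2) ω) := by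
  rw [along, h, toH1_toL2]

end Identification

end KineticDiffusion
-- Composition with the noise, freezing of parameters, martingale criteria.
namespace KineticDiffusion

section Composition

variable {Ω G E : Type*} {𝒢 : MeasurableSpace Ω} {mΩ : MeasurableSpace Ω} {P : Measure Ω}
  [TopologicalSpace G] [TopologicalSpace E] [MeasurableSpace E] [BorelSpace E]
  {F : G → E → ℝ}

/-- The noise is only Borel measurable, so it plays the role of the parameter: for a fixed first
argument `F` is real-valued and Borel measurability is enough. The strongly measurable path is the
variable that gets approximated. -/
theorem stronglyMeasurable_comp₂ {α : Type*} {mα : MeasurableSpace α} {u : α → G} {n : α → E}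
    (hF : Continuous (Function.uncurry F)) (hu : StronglyMeasurable u) (hn : Measurable n) :
    StronglyMeasurable fun ω => F (u ω) (n ω) :=
  stronglyMeasurable_caratheodory (Φ := fun ω y => F y (n ω))
    (fun c => ((hF.comp (Continuous.prodMk_right c)).measurable.comp hn).stronglyMeasurable)
    (fun ω => hF.comp (Continuous.prodMk_left (n ω))) hu

theorem aestronglyMeasurable_comp₂ {u : Ω → G} {n : Ω → E}
    (hF : Continuous (Function.uncurry F)) (hu : AEStronglyMeasurable[𝒢] u P)
    (hn : Measurable[𝒢] n) : AEStronglyMeasurable[𝒢] (fun ω => F (u ω) (n ω)) P := by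
  obtain ⟨u', hu', he⟩ := hu
  exact ⟨fun ω => F (u' ω) (n ω), stronglyMeasurable_comp₂ (mα := 𝒢) hF hu' hn,
    he.mono fun ω h => by simp only [h]⟩

end Composition

/-- Convergence of expectations along a stochastically continuous process. -/
theorem tendsto_integral_of_tendstoInMeasure {Ω E ι : Type*} {mΩ : MeasurableSpace Ω} {P : Measure Ω}
    [IsFiniteMeasure P] [PseudoMetricSpace E] {l : Filter ι} [l.IsCountablyGenerated]
    {n : ι → Ω → E} {n₀ : Ω → E} (hn : TendstoInMeasure P n l n₀) {X : ι → Ω → ℝ} {Y : Ω → ℝ}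
    {C : ℝ} (hX : ∀ᶠ r in l, AEStronglyMeasurable (X r) P) (hb : ∀ᶠ r in l, ∀ ω, |X r ω| ≤ C)
    (h : ∀ ω, ∀ r : ℕ → ι, Tendsto r atTop l → Tendsto (fun k => n (r k) ω) atTop (𝓝 (n₀ ω)) →
      Tendsto (fun k => X (r k) ω) atTop (𝓝 (Y ω))) (A : Set Ω) :
    Tendsto (fun r => ∫ ω in A, X r ω ∂P) l (𝓝 (∫ ω in A, Y ω ∂P)) := by
  -- Convergence in measure gives an almost surely convergent subsequence of every sequence, and
  -- dominated convergence applies along it.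
  refine tendsto_of_subseq_tendsto fun r hr => ?_
  have h1 : TendstoInMeasure P (fun k => n (r k)) atTop n₀ := fun δ hδ => (hn δ hδ).comp hr
  obtain ⟨ms, hms, hae⟩ := h1.exists_seq_tendsto_ae
  have hr' : Tendsto (fun k => r (ms k)) atTop l := hr.comp hms.tendsto_atTop
  refine ⟨ms, tendsto_integral_filter_of_dominated_convergence (fun _ => C) ?_ ?_
    (integrable_const C) ?_⟩
  · exact (hr'.eventually hX).mono fun k hk => hk.mono_measure Measure.restrict_le_self
  · exact (hr'.eventually hb).mono fun k hk => Eventually.of_forall hk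
  · exact ae_mono Measure.restrict_le_self (hae.mono fun ω hω => h ω _ hr' hω)

/-- Freezing of a random parameter. -/
theorem setIntegral_freezing {Ω G : Type*} {𝒢 : MeasurableSpace Ω} {mΩ : MeasurableSpace Ω}
    {P : Measure Ω} [IsFiniteMeasure P] (h𝒢 : 𝒢 ≤ mΩ) [NormedAddCommGroup G] [NormedSpace ℝ G]
    {D : G → Ω → ℝ} {R C : ℝ} (hDm : ∀ y, StronglyMeasurable (D y))
    (hDc : ∀ ω, Continuous fun y => D y ω) (hDb : ∀ y, ‖y‖ ≤ R → ∀ ω, |D y ω| ≤ C)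
    (h0 : ∀ y B, MeasurableSet[𝒢] B → ∫ ω in B, D y ω ∂P = 0) {y₀ : Ω → G}
    (hy : AEStronglyMeasurable[𝒢] y₀ P) (hyb : ∀ ω, ‖y₀ ω‖ ≤ R) {A : Set Ω}
    (hA : MeasurableSet[𝒢] A) : ∫ ω in A, D (y₀ ω) ω ∂P = 0 := by
  obtain ⟨y', hy', he⟩ := hy
  by_cases hΩ : Nonempty Ω
  swap
  · have : IsEmpty Ω := not_nonempty_iff.1 hΩ
    simp [Measure.eq_zero_of_isEmpty P]
  have hR : 0 ≤ R := (norm_nonneg _).trans (hyb hΩ.some)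
  have hy'b : ∀ᵐ ω ∂P, ‖y' ω‖ ≤ R := he.mono fun ω h => h ▸ hyb ω
  set s := fun k => hy'.approxBounded R k with hs
  have hi : ∀ y, ‖y‖ ≤ R → Integrable (D y) P := fun y hyR =>
    Integrable.of_bound (hDm y).aestronglyMeasurable C (Eventually.of_forall (hDb y hyR))
  have hsm : ∀ k, StronglyMeasurable fun ω => D (s k ω) ω := fun k =>
    stronglyMeasurable_caratheodory (Φ := fun ω y => D y ω) hDm hDc
      ((@SimpleFunc.stronglyMeasurable Ω G 𝒢 _ (s k)).mono h𝒢)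
  have hsb : ∀ k ω, ‖s k ω‖ ≤ R := hy'.norm_approxBounded_le hR
  have hzero : ∀ k, ∫ ω in A, D (s k ω) ω ∂P = 0 := fun k => by
    -- A simple parameter is constant on finitely many `𝒢`-measurable events, and on each of them
    -- the hypothesis for deterministic parameters applies.
    have h1 : ∀ ω, D (s k ω) ω = ∑ y ∈ @SimpleFunc.range Ω G 𝒢 (s k), (s k ⁻¹' {y}).indicator (D y) ω := by
      intro ω
      rw [Finset.sum_eq_single (s k ω)]
      · simp
      · intro y _ hne
        exact indicator_of_notMem (by simpa using hne.symm) _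
      · intro h
        exact absurd (@SimpleFunc.mem_range_self Ω G 𝒢 (s k) ω) h
    have hm : ∀ y, MeasurableSet[𝒢] (s k ⁻¹' {y}) := fun y =>
      @SimpleFunc.measurableSet_fiber Ω G 𝒢 (s k) y
    simp only [h1]
    rw [integral_finsetSum]
    · refine Finset.sum_eq_zero fun y hyr => ?_
      rw [setIntegral_indicator (h𝒢 _ (hm y))]
      exact h0 y _ (hA.inter (hm y))
    · intro y hyr
      obtain ⟨ω, rfl⟩ := (@SimpleFunc.mem_range Ω G 𝒢 _ _).1 hyr
      exact ((hi _ (hsb k ω)).indicator (h𝒢 _ (hm _))).integrableOn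
  have hlim : Tendsto (fun k => ∫ ω in A, D (s k ω) ω ∂P) atTop
      (𝓝 (∫ ω in A, D (y' ω) ω ∂P)) := by
    refine tendsto_integral_of_dominated_convergence (fun _ => C)
      (fun k => (hsm k).aestronglyMeasurable) (integrable_const C)
      (fun k => Eventually.of_forall fun ω => hDb _ (hsb k ω) ω) ?_
    refine ae_mono Measure.restrict_le_self ?_
    filter_upwards [hy'.tendsto_approxBounded_ae hy'b] with ω hω
    exact ((hDc ω).tendsto _).comp hω
  simp only [hzero] at hlim
  have h2 : ∫ ω in A, D (y₀ ω) ω ∂P = ∫ ω in A, D (y' ω) ω ∂P :=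
    integral_congr_ae (ae_mono Measure.restrict_le_self (he.mono fun ω h => by simp only [h]))
  rw [h2]
  exact tendsto_nhds_unique hlim tendsto_const_nhds

/-- A process adapted up to null sets, with constant integrals over past events, is a martingale. -/
theorem isContMartingale_of_setIntegral {Ω : Type*} {mΩ : MeasurableSpace Ω} {P : Measure Ω}
    [IsFiniteMeasure P] {ℱ : Filtration ℝ≥0 mΩ} {X : ℝ≥0 → Ω → ℝ}
    (hX : ∀ t, AEStronglyMeasurable[ℱ t] (X t) P) (hi : ∀ t, Integrable (X t) P)
    (h : ∀ s t, s ≤ t → ∀ A, MeasurableSet[ℱ s] A → ∫ ω in A, X t ω ∂P = ∫ ω in A, X s ω ∂P)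
    (hc : ∀ᵐ ω ∂P, Continuous fun t => X t ω) : IsContMartingale X ℱ P := by
  have he : ∀ t, X t =ᵐ[P] P[X t|ℱ t] := fun t =>
    (condExp_of_aestronglyMeasurable' (ℱ.le t) (hX t) (hi t)).symm
  -- `X t` is adapted up to null sets only, so its conditional expectations serve as the martingale
  -- version.
  refine ⟨hi, ⟨fun t => P[X t|ℱ t], ⟨fun t => stronglyMeasurable_condExp, fun s t hst => ?_⟩, he⟩,
    hc⟩
  refine (condExp_condExp_of_le (ℱ.mono hst) (ℱ.le t)).trans ?_
  refine (ae_eq_condExp_of_forall_setIntegral_eq (ℱ.le s) (hi t)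
    (fun _ _ _ => integrable_condExp.integrableOn) (fun A hA _ => ?_)
    stronglyMeasurable_condExp.aestronglyMeasurable).symm
  rw [setIntegral_condExp (ℱ.le s) (hi s) hA, h s t hst A hA]

/-- Conversely, a martingale has constant integrals over past events. -/
theorem IsContMartingale.setIntegral_eq {Ω : Type*} {mΩ : MeasurableSpace Ω} {P : Measure Ω}
    [IsFiniteMeasure P] {ℱ : Filtration ℝ≥0 mΩ} {X : ℝ≥0 → Ω → ℝ} (h : IsContMartingale X ℱ P)
    {s t : ℝ≥0} (hst : s ≤ t) {A : Set Ω} (hA : MeasurableSet[ℱ s] A) :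
    ∫ ω in A, X t ω ∂P = ∫ ω in A, X s ω ∂P := by
  obtain ⟨Y, hY, he⟩ := h.martingale
  have h1 : ∀ t, ∫ ω in A, X t ω ∂P = ∫ ω in A, Y t ω ∂P := fun t =>
    integral_congr_ae (ae_mono Measure.restrict_le_self (he t))
  rw [h1, h1, hY.setIntegral_eq hst hA]

end KineticDiffusion
-- Dynkin's formula for a path driven by a stochastically continuous process.
namespace KineticDiffusion

section Dynkin

variable {Ω G E : Type*} {mΩ : MeasurableSpace Ω} {P : Measure Ω}
  [NormedAddCommGroup G] [NormedSpace ℝ G] [PseudoMetricSpace E]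

/-- A function `Φ(y, n)`, continuously differentiable in `y`, with differential `DΦ`, and its image
`Γ` under an operator acting on `n`. -/
structure IsTestDatum (Φ : G → E → ℝ) (DΦ : G → E → G →L[ℝ] ℝ) (Γ : G → E → ℝ) : Prop where
  hasFDerivAt : ∀ y n, HasFDerivAt (fun y => Φ y n) (DΦ y n) y
  continuous_fun : Continuous (Function.uncurry Φ)
  continuous_deriv : Continuous (Function.uncurry DΦ)
  continuous_gen : Continuous (Function.uncurry Γ)
  bounded : ∀ R, ∃ B, 0 ≤ B ∧ ∀ y n, ‖y‖ ≤ R → |Φ y n| ≤ B ∧ ‖DΦ y n‖ ≤ B ∧ |Γ y n| ≤ B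

variable {Φ : G → E → ℝ} {DΦ : G → E → G →L[ℝ] ℝ} {Γ : G → E → ℝ}

theorem IsTestDatum.abs_sub_le (hΦ : IsTestDatum Φ DΦ Γ) {R B : ℝ}
    (hB : ∀ y n, ‖y‖ ≤ R → |Φ y n| ≤ B ∧ ‖DΦ y n‖ ≤ B ∧ |Γ y n| ≤ B) {y y' : G}
    (hy : ‖y‖ ≤ R) (hy' : ‖y'‖ ≤ R) (n : E) : |Φ y' n - Φ y n| ≤ B * ‖y' - y‖ :=
  (convex_closedBall (0 : G) R).norm_image_sub_le_of_norm_hasFDerivWithin_le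
    (fun z _ => (hΦ.hasFDerivAt z n).hasFDerivWithinAt)
    (fun z hz => (hB z n (by simpa using hz)).2.1) (by simpa using hy) (by simpa using hy')

/-- The noise argument varies along with the path argument. Joint continuity of `DΦ` keeps the
differential within `c` of `DΦ z₀ e₀` on a ball for all nearby `e`, and the mean value inequality
concludes. -/
theorem IsTestDatum.isLittleO_remainder (hΦ : IsTestDatum Φ DΦ Γ) {ι : Type*} {l : Filter ι}
    {z : ι → G} {e : ι → E} {z₀ : G} {e₀ : E} (hz : Tendsto z l (𝓝 z₀)) (he : Tendsto e l (𝓝 e₀)) :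
    (fun k => Φ (z k) (e k) - Φ z₀ (e k) - DΦ z₀ e₀ (z k - z₀)) =o[l] fun k => z k - z₀ := by
  refine Asymptotics.isLittleO_iff.2 fun c hc => ?_
  have h1 : ∀ᶠ p : G × E in 𝓝 (z₀, e₀), ‖DΦ p.1 p.2 - DΦ z₀ e₀‖ ≤ c := by
    have := (hΦ.continuous_deriv.tendsto (z₀, e₀)).eventually
      (Metric.closedBall_mem_nhds (DΦ z₀ e₀) hc)
    exact this.mono fun p hp => mem_closedBall_iff_norm.1 hp
  rw [nhds_prod_eq, eventually_prod_iff] at h1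
  obtain ⟨pa, hpa, pb, hpb, h⟩ := h1
  obtain ⟨δ, hδ, hball⟩ := Metric.eventually_nhds_iff_ball.1 hpa
  filter_upwards [hz.eventually (Metric.ball_mem_nhds z₀ hδ), he.eventually hpb] with k h1 h2
  exact (convex_ball z₀ δ).norm_image_sub_le_of_norm_hasFDerivWithin_le'
    (fun w _ => (hΦ.hasFDerivAt w (e k)).hasFDerivWithinAt)
    (fun w hw => h (hball w hw) h2) (Metric.mem_ball_self hδ) h1

theorem setIntegral_sub_sub {f g h : Ω → ℝ} (hf : Integrable f P) (hg : Integrable g P)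
    (hh : Integrable h P) (A : Set Ω) : ∫ ω in A, (f ω - g ω - h ω) ∂P =
      ∫ ω in A, f ω ∂P - ∫ ω in A, g ω ∂P - ∫ ω in A, h ω ∂P := by
  rw [← integral_sub hf.integrableOn hg.integrableOn]
  exact integral_sub (hf.sub hg).integrableOn hh.integrableOn

variable [MeasurableSpace E]

/-- A path `y` in a normed space, with velocity `C(y, n)`, driven by the stochastically continuous
process `n`. -/
structure IsDrivenPath (P : Measure Ω) (𝒢 : ℝ → MeasurableSpace Ω) (n : ℝ → Ω → E)
    (C : G → E → G) (y : ℝ → Ω → G) : Prop where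
  le : ∀ t, 𝒢 t ≤ mΩ
  measurable_noise : Measurable (Function.uncurry n)
  tendsto_noise : ∀ t, TendstoInMeasure P n (𝓝 t) (n t)
  measurable_path : StronglyMeasurable (Function.uncurry y)
  adapted_path : ∀ t, AEStronglyMeasurable[𝒢 t] (y t) P
  continuous_path : ∀ ω, Continuous fun t => y t ω
  continuous_velocity : Continuous (Function.uncurry C)
  measurable_velocity : StronglyMeasurable fun p : ℝ × Ω => C (y p.1 p.2) (n p.1 p.2)
  path_sub : ∀ ω r t, 0 ≤ r → r ≤ t → y t ω - y r ω = ∫ s in r..t, C (y s ω) (n s ω)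
  bounded : ∀ T, ∃ R, 0 ≤ R ∧ ∀ t ω, |t| ≤ T → ‖y t ω‖ ≤ R ∧ ‖C (y t ω) (n t ω)‖ ≤ R

variable {𝒢 : ℝ → MeasurableSpace Ω} {n : ℝ → Ω → E} {C : G → E → G} {y : ℝ → Ω → G}

theorem IsDrivenPath.norm_path_sub_le (hp : IsDrivenPath P 𝒢 n C y) {T R : ℝ}
    (hR : ∀ t ω, |t| ≤ T → ‖y t ω‖ ≤ R ∧ ‖C (y t ω) (n t ω)‖ ≤ R) {r t : ℝ} (hr : 0 ≤ r)
    (hrt : r ≤ t) (ht : t ≤ T) (ω : Ω) : ‖y t ω - y r ω‖ ≤ R * (t - r) := by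
  rw [hp.path_sub ω r t hr hrt]
  refine (intervalIntegral.norm_integral_le_of_norm_le_const (C := R) fun s hs => ?_).trans ?_
  · rw [uIoc_of_le hrt] at hs
    exact (hR s ω (by rw [abs_of_nonneg (hr.trans hs.1.le)]; exact hs.2.trans ht)).2
  · rw [abs_of_nonneg (sub_nonneg.2 hrt)]

variable [IsFiniteMeasure P]

/-- Expectations are continuous in time although the noise may have discontinuous paths. `Q` may
depend on `ω`, to allow quantities frozen at an earlier time. -/
theorem IsDrivenPath.continuous_setIntegral (hp : IsDrivenPath P 𝒢 n C y) {Q : Ω → G → E → ℝ}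
    (hQm : StronglyMeasurable fun p : ℝ × Ω => Q p.2 (y p.1 p.2) (n p.1 p.2))
    (hQc : ∀ ω, Continuous (Function.uncurry (Q ω)))
    (hQb : ∀ T, ∃ B, ∀ r ω, |r| ≤ T → |Q ω (y r ω) (n r ω)| ≤ B) (A : Set Ω) :
    Continuous fun r => ∫ ω in A, Q ω (y r ω) (n r ω) ∂P := by
  refine continuous_iff_continuousAt.2 fun t => ?_
  obtain ⟨B, hB⟩ := hQb (|t| + 1)
  refine tendsto_integral_of_tendstoInMeasure (C := B) (hp.tendsto_noise t)
    (Eventually.of_forall fun r =>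
      (hQm.comp_measurable measurable_prodMk_left).aestronglyMeasurable) ?_ ?_ A
  · have : ∀ᶠ r in 𝓝 t, |r| < |t| + 1 :=
      continuous_abs.continuousAt.eventually_lt continuousAt_const (lt_add_one _)
    exact this.mono fun r hr ω => hB r ω hr.le
  · intro ω r hr hn
    exact ((hQc ω).tendsto (y t ω, n t ω)).comp
      ((((hp.continuous_path ω).tendsto t).comp hr).prodMk_nhds hn)

theorem setIntegral_intervalIntegral_swap {f : ℝ → Ω → ℝ}
    (hf : StronglyMeasurable (Function.uncurry f)) {r t B : ℝ} (hrt : r ≤ t)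
    (hb : ∀ s ω, r ≤ s → s ≤ t → |f s ω| ≤ B) (A : Set Ω) :
    ∫ ω in A, (∫ s in r..t, f s ω) ∂P = ∫ s in r..t, (∫ ω in A, f s ω ∂P) := by
  simp only [intervalIntegral.integral_of_le hrt]
  refine integral_integral_swap (Integrable.of_bound (C := B)
    (hf.comp_measurable measurable_swap).aestronglyMeasurable ?_)
  have h : ∀ᵐ s ∂(volume.restrict (Ioc r t)), ∀ ω, |f s ω| ≤ B :=
    (ae_restrict_iff' measurableSet_Ioc).2 (Eventually.of_forall fun s hs ω => hb s ω hs.1.le hs.2)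
  exact ((Measure.quasiMeasurePreserving_snd (μ := P.restrict A)
    (ν := volume.restrict (Ioc r t))).ae h).mono fun p hp => hp p.1

/-- The first-order remainder in the path variable is negligible, in expectation. -/
theorem IsDrivenPath.tendsto_remainder [BorelSpace E] (hp : IsDrivenPath P 𝒢 n C y)
    (hΦ : IsTestDatum Φ DΦ Γ) {t : ℝ} (ht : 0 ≤ t) (A : Set Ω) :
    Tendsto (fun r => ∫ ω in A, (r - t)⁻¹ * (Φ (y r ω) (n r ω) - Φ (y t ω) (n r ω) -
      DΦ (y t ω) (n t ω) (y r ω - y t ω)) ∂P) (𝓝[>] t) (𝓝 0) := by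
  obtain ⟨R, hR0, hR⟩ := hp.bounded (t + 1)
  obtain ⟨B, hB0, hB⟩ := hΦ.bounded R
  have hIoo : ∀ᶠ r in 𝓝[>] t, r ∈ Ioo t (t + 1) := Ioo_mem_nhdsGT (lt_add_one t)
  have hym : ∀ r, StronglyMeasurable (y r) := fun r =>
    hp.measurable_path.comp_measurable measurable_prodMk_left
  have hnm : ∀ r, Measurable (n r) := fun r => hp.measurable_noise.comp measurable_prodMk_left
  have habs : ∀ r, t ≤ r → r ≤ t + 1 → |r| ≤ t + 1 := fun r h1 h2 => by
    rw [abs_of_nonneg (ht.trans h1)]; exact h2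
  -- Dominating constant `2BR`: the increment of `Φ` and its linearisation are each at most `B`
  -- times the displacement, which is at most `R (r - t)`.
  have h := tendsto_integral_of_tendstoInMeasure (P := P) (l := 𝓝[>] t) (n := n) (n₀ := n t)
    (X := fun r ω => (r - t)⁻¹ * (Φ (y r ω) (n r ω) - Φ (y t ω) (n r ω) -
      DΦ (y t ω) (n t ω) (y r ω - y t ω))) (Y := fun _ => 0) (C := 2 * B * R)
    (fun δ hδ => (hp.tendsto_noise t δ hδ).mono_left nhdsWithin_le_nhds)
    (Eventually.of_forall fun r => ?_) (hIoo.mono fun r hr ω => ?_) (fun ω r hr hn => ?_) A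
  · simpa using h
  · refine StronglyMeasurable.aestronglyMeasurable (StronglyMeasurable.const_mul ?_ _)
    refine ((stronglyMeasurable_comp₂ hΦ.continuous_fun (hym r) (hnm r)).sub
      (stronglyMeasurable_comp₂ hΦ.continuous_fun (hym t) (hnm r))).sub ?_
    exact stronglyMeasurable_comp₂ (G := G × G) (F := fun q e => DΦ q.1 e q.2)
      (u := fun ω => (y t ω, y r ω - y t ω))
      ((hΦ.continuous_deriv.comp (by fun_prop : Continuous fun p : (G × G) × E => (p.1.1, p.2))).clm_apply
        (by fun_prop : Continuous fun p : (G × G) × E => p.1.2))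
      ((hym t).prodMk ((hym r).sub (hym t))) (hnm t)
  · have hpos : 0 < r - t := sub_pos.2 hr.1
    have h1 := hp.norm_path_sub_le hR ht hr.1.le hr.2.le ω
    have hyt := (hR t ω (habs t le_rfl (by linarith))).1
    have h2 := hΦ.abs_sub_le hB hyt (hR r ω (habs r hr.1.le hr.2.le)).1 (n r ω)
    have h3 : |DΦ (y t ω) (n t ω) (y r ω - y t ω)| ≤ B * ‖y r ω - y t ω‖ :=
      ((DΦ (y t ω) (n t ω)).le_opNorm _).trans (by gcongr; exact (hB _ _ hyt).2.1)
    have h4 : B * ‖y r ω - y t ω‖ ≤ B * (R * (r - t)) := by gcongr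
    rw [abs_mul, abs_of_pos (inv_pos.2 hpos), inv_mul_le_iff₀ hpos]
    refine (abs_sub _ _).trans ?_
    nlinarith
  · have hr0 : Tendsto r atTop (𝓝 t) := hr.mono_right nhdsWithin_le_nhds
    have hyr : Tendsto (fun k => y (r k) ω) atTop (𝓝 (y t ω)) :=
      ((hp.continuous_path ω).tendsto t).comp hr0
    have h1 := hΦ.isLittleO_remainder hyr hn
    have h2 : (fun k => y (r k) ω - y t ω) =O[atTop] fun k => r k - t := by
      refine Asymptotics.IsBigO.of_bound R ?_
      filter_upwards [hr.eventually hIoo] with k hk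
      rw [Real.norm_of_nonneg (sub_nonneg.2 hk.1.le)]
      exact hp.norm_path_sub_le hR ht hk.1.le hk.2.le ω
    refine (h1.trans_isBigO h2).tendsto_div_nhds_zero.congr fun k => ?_
    rw [div_eq_inv_mul]

/-- Dynkin's formula. -/
theorem IsDrivenPath.dynkin [BorelSpace E] [CompleteSpace G] (hp : IsDrivenPath P 𝒢 n C y)
    (hΦ : IsTestDatum Φ DΦ Γ) (h𝒢 : Monotone 𝒢)
    (hΓ : ∀ z s t, 0 ≤ s → s ≤ t → ∀ A, MeasurableSet[𝒢 s] A →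
      ∫ ω in A, (Φ z (n t ω) - Φ z (n s ω) - ∫ r in s..t, Γ z (n r ω)) ∂P = 0)
    {s t : ℝ} (hs : 0 ≤ s) (hst : s ≤ t) {A : Set Ω} (hA : MeasurableSet[𝒢 s] A) :
    ∫ ω in A, (Φ (y t ω) (n t ω) - Φ (y s ω) (n s ω) -
      ∫ r in s..t, (DΦ (y r ω) (n r ω) (C (y r ω) (n r ω)) + Γ (y r ω) (n r ω))) ∂P = 0 := by
  have hym : ∀ r, StronglyMeasurable (y r) := fun r =>
    hp.measurable_path.comp_measurable measurable_prodMk_left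
  have hnm : ∀ r, Measurable (n r) := fun r => hp.measurable_noise.comp measurable_prodMk_left
  have hDc : Continuous fun p : (G × G) × E => DΦ p.1.1 p.2 p.1.2 :=
    (hΦ.continuous_deriv.comp (by fun_prop : Continuous fun p : (G × G) × E => (p.1.1, p.2))).clm_apply
      (by fun_prop : Continuous fun p : (G × G) × E => p.1.2)
  -- the generator along the path
  set L : G → E → ℝ := fun z e => DΦ z e (C z e) + Γ z e with hL
  have hLm : StronglyMeasurable fun p : ℝ × Ω => L (y p.1 p.2) (n p.1 p.2) :=
    (stronglyMeasurable_comp₂ (G := G × G) (F := fun q e => DΦ q.1 e q.2)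
      (u := fun p : ℝ × Ω => (y p.1 p.2, C (y p.1 p.2) (n p.1 p.2))) hDc
      (hp.measurable_path.prodMk hp.measurable_velocity) hp.measurable_noise).add
    (stronglyMeasurable_comp₂ hΦ.continuous_gen hp.measurable_path hp.measurable_noise)
  have hLc : Continuous (Function.uncurry L) :=
    (hΦ.continuous_deriv.clm_apply hp.continuous_velocity).add hΦ.continuous_gen
  have hLb : ∀ T, ∃ B, ∀ r ω, |r| ≤ T → |L (y r ω) (n r ω)| ≤ B := fun T => by
    obtain ⟨R, hR0, hR⟩ := hp.bounded T
    obtain ⟨B, hB0, hB⟩ := hΦ.bounded R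
    refine ⟨B * R + B, fun r ω hr => (abs_add_le _ _).trans ?_⟩
    have h1 := hR r ω hr
    have h2 := hB (y r ω) (n r ω) h1.1
    refine add_le_add (((DΦ (y r ω) (n r ω)).le_opNorm _).trans ?_) h2.2.2
    exact mul_le_mul h2.2.1 h1.2 (norm_nonneg _) hB0
  have hΦm : ∀ r r', StronglyMeasurable fun ω => Φ (y r ω) (n r' ω) := fun r r' =>
    stronglyMeasurable_comp₂ hΦ.continuous_fun (hym r) (hnm r')
  have hΦi : ∀ r r', Integrable (fun ω => Φ (y r ω) (n r' ω)) P := fun r r' => by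
    obtain ⟨R, hR0, hR⟩ := hp.bounded |r|
    obtain ⟨B, hB0, hB⟩ := hΦ.bounded R
    exact Integrable.of_bound (hΦm r r').aestronglyMeasurable B
      (Eventually.of_forall fun ω => (hB _ _ (hR r ω le_rfl).1).1)
  -- Once `φ` is continuous with continuous right derivative `γ`, the fundamental theorem of
  -- calculus and Fubini give the claim.
  set φ : ℝ → ℝ := fun r => ∫ ω in A, Φ (y r ω) (n r ω) ∂P with hφ
  set γ : ℝ → ℝ := fun r => ∫ ω in A, L (y r ω) (n r ω) ∂P with hγ
  have hφc : Continuous φ := hp.continuous_setIntegral (Q := fun _ => Φ)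
    (stronglyMeasurable_comp₂ hΦ.continuous_fun hp.measurable_path hp.measurable_noise)
    (fun _ => hΦ.continuous_fun) (fun T => by
      obtain ⟨R, hR0, hR⟩ := hp.bounded T
      obtain ⟨B, hB0, hB⟩ := hΦ.bounded R
      exact ⟨B, fun r ω hr => (hB _ _ (hR r ω hr).1).1⟩) A
  have hγc : Continuous γ := hp.continuous_setIntegral (Q := fun _ => L) hLm (fun _ => hLc) hLb A
  have hderiv : ∀ t, s ≤ t → HasDerivWithinAt φ (γ t) (Ioi t) t := by
    intro t hst
    have ht : 0 ≤ t := hs.trans hst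
    have hA' : MeasurableSet[𝒢 t] A := h𝒢 hst _ hA
    have hQ1 : StronglyMeasurable fun p : ℝ × Ω =>
        DΦ (y t p.2) (n t p.2) (C (y p.1 p.2) (n p.1 p.2)) :=
      stronglyMeasurable_comp₂ (G := G × G) (F := fun q e => DΦ q.1 e q.2)
        (u := fun p : ℝ × Ω => (y t p.2, C (y p.1 p.2) (n p.1 p.2))) hDc
        (((hym t).comp_measurable measurable_snd).prodMk hp.measurable_velocity)
        ((hnm t).comp measurable_snd)
    have hQ2 : StronglyMeasurable fun p : ℝ × Ω => Γ (y t p.2) (n p.1 p.2) :=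
      stronglyMeasurable_comp₂ hΦ.continuous_gen
        ((hym t).comp_measurable measurable_snd) hp.measurable_noise
    have hb1 : ∀ T, ∃ B, ∀ r ω, |r| ≤ T → |DΦ (y t ω) (n t ω) (C (y r ω) (n r ω))| ≤ B ∧
        |Γ (y t ω) (n r ω)| ≤ B := fun T => by
      obtain ⟨R, hR0, hR⟩ := hp.bounded (max T |t|)
      obtain ⟨B, hB0, hB⟩ := hΦ.bounded R
      refine ⟨B * R + B, fun r ω hr => ?_⟩
      have h1 := (hR r ω (hr.trans (le_max_left _ _))).2
      have h2 := fun e => hB (y t ω) e (hR t ω (le_max_right _ _)).1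
      have h3 : 0 ≤ B * R := mul_nonneg hB0 hR0
      refine ⟨?_, (h2 _).2.2.trans (by linarith)⟩
      refine (((DΦ (y t ω) (n t ω)).le_opNorm _).trans
        (mul_le_mul (h2 _).2.1 h1 (norm_nonneg _) hB0)).trans (by linarith)
    -- `k₁` is the velocity of the path tested against the differential frozen at time `t`; `k₂` is
    -- the generator of the noise with the path frozen at time `t`. At time `t` they add up to `γ
    -- t`.
    set k₁ : ℝ → ℝ := fun r => ∫ ω in A, DΦ (y t ω) (n t ω) (C (y r ω) (n r ω)) ∂P with hk₁
    set k₂ : ℝ → ℝ := fun r => ∫ ω in A, Γ (y t ω) (n r ω) ∂P with hk₂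
    have hk₁c : Continuous k₁ :=
      hp.continuous_setIntegral (Q := fun ω z e => DΦ (y t ω) (n t ω) (C z e)) hQ1
        (fun ω => (DΦ (y t ω) (n t ω)).continuous.comp hp.continuous_velocity)
        (fun T => (hb1 T).imp fun B hB r ω hr => (hB r ω hr).1) A
    have hk₂c : Continuous k₂ :=
      hp.continuous_setIntegral (Q := fun ω z e => Γ (y t ω) e) hQ2
        (fun ω => hΦ.continuous_gen.comp (by fun_prop : Continuous fun p : G × E => (y t ω, p.2)))
        (fun T => (hb1 T).imp fun B hB r ω hr => (hB r ω hr).2) A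
    have hγt : γ t = k₁ t + k₂ t := by
      obtain ⟨B, hB⟩ := hb1 |t|
      refine integral_add (Integrable.integrableOn ?_) (Integrable.integrableOn ?_)
      · exact Integrable.of_bound (hQ1.comp_measurable measurable_prodMk_left).aestronglyMeasurable
          B (Eventually.of_forall fun ω => (hB t ω le_rfl).1)
      · exact Integrable.of_bound (hQ2.comp_measurable measurable_prodMk_left).aestronglyMeasurable
          B (Eventually.of_forall fun ω => (hB t ω le_rfl).2)
    -- the increment of the path
    have e1 : ∀ r, t ≤ r → ∫ ω in A, DΦ (y t ω) (n t ω) (y r ω - y t ω) ∂P = ∫ σ in t..r, k₁ σ := by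
      intro r hr
      obtain ⟨B, hB⟩ := hb1 r
      obtain ⟨R, hR0, hR⟩ := hp.bounded r
      have habs : ∀ σ, t ≤ σ → σ ≤ r → |σ| ≤ r := fun σ h1 h2 => by
        rw [abs_of_nonneg (ht.trans h1)]; exact h2
      rw [← setIntegral_intervalIntegral_swap (P := P) (f := fun σ ω =>
        DΦ (y t ω) (n t ω) (C (y σ ω) (n σ ω))) hQ1 hr
        (fun σ ω h1 h2 => (hB σ ω (habs σ h1 h2)).1) A]
      congr 1
      funext ω
      rw [hp.path_sub ω t r ht hr]
      refine ((DΦ (y t ω) (n t ω)).intervalIntegral_comp_comm ?_).symm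
      refine (intervalIntegrable_const (c := R)).mono_fun'
        (hp.measurable_velocity.comp_measurable measurable_prodMk_right).aestronglyMeasurable ?_
      refine (ae_restrict_iff' measurableSet_uIoc).2 (Eventually.of_forall fun σ hσ => ?_)
      rw [uIoc_of_le hr] at hσ
      exact (hR σ ω (habs σ hσ.1.le hσ.2)).2
    -- the increment of the noise
    have e2 : ∀ r, t ≤ r → ∫ ω in A, (Φ (y t ω) (n r ω) - Φ (y t ω) (n t ω)) ∂P =
        ∫ σ in t..r, k₂ σ := by
      intro r hr
      obtain ⟨R, hR0, hR⟩ := hp.bounded t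
      obtain ⟨B₂, hB₂⟩ := hb1 r
      have habs : ∀ σ, t ≤ σ → σ ≤ r → |σ| ≤ r := fun σ h1 h2 => by
        rw [abs_of_nonneg (ht.trans h1)]; exact h2
      have hΓm : ∀ z : G, StronglyMeasurable fun p : ℝ × Ω => Γ z (n p.1 p.2) := fun z =>
        stronglyMeasurable_comp₂ hΦ.continuous_gen stronglyMeasurable_const hp.measurable_noise
      have hint : Integrable (fun ω => ∫ σ in t..r, Γ (y t ω) (n σ ω)) P := by
        simp only [intervalIntegral.integral_of_le hr]
        refine Integrable.of_bound (C := B₂ * (volume.restrict (Ioc t r)).real univ)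
          hQ2.integral_prod_left.aestronglyMeasurable (Eventually.of_forall fun ω => ?_)
        exact norm_integral_le_of_norm_le_const ((ae_restrict_iff' measurableSet_Ioc).2
          (Eventually.of_forall fun σ hσ => (hB₂ σ ω (habs σ hσ.1.le hσ.2)).2))
      -- The martingale identity is assumed for deterministic `z` only; freezing inserts the `𝒢
      -- t`-measurable value `y t`.
      have h0 := setIntegral_freezing (P := P) (hp.le t)
        (D := fun z ω => Φ z (n r ω) - Φ z (n t ω) - ∫ σ in t..r, Γ z (n σ ω)) (R := R)
        (C := (hΦ.bounded R).choose + (hΦ.bounded R).choose +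
          (hΦ.bounded R).choose * |r - t|) (fun z => ?_) (fun ω => ?_) (fun z hz ω => ?_)
        (fun z B hB => hΓ z t r ht hr B hB) (hp.adapted_path t)
        (fun ω => (hR t ω (abs_of_nonneg ht).le).1) hA'
      · rw [setIntegral_sub_sub (hΦi t r) (hΦi t t) hint, sub_eq_zero] at h0
        rw [integral_sub (hΦi t r).integrableOn (hΦi t t).integrableOn, h0, setIntegral_intervalIntegral_swap (f := fun σ ω => Γ (y t ω) (n σ ω)) hQ2 hr
          (fun σ ω h1 h2 => (hB₂ σ ω (habs σ h1 h2)).2)]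
      · refine ((stronglyMeasurable_comp₂ hΦ.continuous_fun stronglyMeasurable_const (hnm r)).sub
          (stronglyMeasurable_comp₂ hΦ.continuous_fun stronglyMeasurable_const (hnm t))).sub ?_
        simp only [intervalIntegral.integral_of_le hr]
        exact (hΓm z).integral_prod_left
      · refine ((hΦ.continuous_fun.comp (Continuous.prodMk_left (n r ω))).sub
          (hΦ.continuous_fun.comp (Continuous.prodMk_left (n t ω)))).sub
          (continuous_iff_continuousAt.2 fun z => ?_)
        obtain ⟨B, hB0, hB⟩ := hΦ.bounded (‖z‖ + 1)
        refine intervalIntegral.continuousAt_of_dominated_interval (bound := fun _ => B)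
          (Eventually.of_forall fun z =>
            ((hΓm z).comp_measurable measurable_prodMk_right).aestronglyMeasurable) ?_
          intervalIntegrable_const (Eventually.of_forall fun σ _ =>
            (hΦ.continuous_gen.comp (Continuous.prodMk_left (n σ ω))).continuousAt)
        have : ∀ᶠ z' in 𝓝 z, ‖z'‖ < ‖z‖ + 1 :=
          continuous_norm.continuousAt.eventually_lt continuousAt_const (lt_add_one _)
        exact this.mono fun z' hz' => Eventually.of_forall fun σ _ => (hB z' _ hz'.le).2.2
      · have hB := (hΦ.bounded R).choose_spec.2
        refine (abs_sub _ _).trans (add_le_add ((abs_sub _ _).trans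
          (add_le_add (hB z _ hz).1 (hB z _ hz).1)) ?_)
        exact intervalIntegral.norm_integral_le_of_norm_le_const
          (f := fun σ => Γ z (n σ ω)) fun σ _ => (hB z _ hz).2.2
    -- What remains of the increment after subtracting the two first-order parts; its right
    -- derivative at `t` is zero by `tendsto_remainder`.
    set J : ℝ → ℝ := fun r => ∫ ω in A, (Φ (y r ω) (n r ω) - Φ (y t ω) (n r ω) -
      DΦ (y t ω) (n t ω) (y r ω - y t ω)) ∂P with hJ
    have hJd : HasDerivWithinAt J 0 (Ioi t) t := by
      rw [hasDerivWithinAt_iff_tendsto_slope' (by simp)]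
      refine (hp.tendsto_remainder hΦ ht A).congr fun r => ?_
      have hJt : J t = 0 := by simp [hJ]
      rw [slope_def_module, hJt, sub_zero, smul_eq_mul, integral_const_mul]
    have hkd : ∀ k : ℝ → ℝ, Continuous k →
        HasDerivWithinAt (fun r => ∫ σ in t..r, k σ) (k t) (Ioi t) t := fun k hk =>
      (intervalIntegral.integral_hasDerivAt_right (hk.intervalIntegrable t t)
        hk.stronglyMeasurable.stronglyMeasurableAtFilter hk.continuousAt).hasDerivWithinAt
    have hφe : ∀ r, t ≤ r →
        φ r = φ t + (J r + ((∫ σ in t..r, k₁ σ) + ∫ σ in t..r, k₂ σ)) := by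
      intro r hr
      have hDi : Integrable (fun ω => DΦ (y t ω) (n t ω) (y r ω - y t ω)) P := by
        obtain ⟨R, hR0, hR⟩ := hp.bounded r
        obtain ⟨B, hB0, hB⟩ := hΦ.bounded R
        have hyt := fun ω => (hR t ω (by rw [abs_of_nonneg ht]; exact hr)).1
        refine Integrable.of_bound (C := B * (R * (r - t)))
          (stronglyMeasurable_comp₂ (G := G × G) (F := fun q e => DΦ q.1 e q.2)
            (u := fun ω => (y t ω, y r ω - y t ω)) hDc
            ((hym t).prodMk ((hym r).sub (hym t))) (hnm t)).aestronglyMeasurable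
          (Eventually.of_forall fun ω => ((DΦ (y t ω) (n t ω)).le_opNorm _).trans ?_)
        exact mul_le_mul (hB _ _ (hyt ω)).2.1 (hp.norm_path_sub_le hR ht hr le_rfl ω)
          (norm_nonneg _) hB0
      rw [← e1 r hr, ← e2 r hr, hJ]
      simp only [hφ]
      rw [setIntegral_sub_sub (hΦi r r) (hΦi t r) hDi,
        integral_sub (hΦi t r).integrableOn (hΦi t t).integrableOn]
      ring
    have := ((hJd.add ((hkd k₁ hk₁c).add (hkd k₂ hk₂c))).const_add (φ t)).congr
      (fun r hr => hφe r (le_of_lt hr)) (hφe t le_rfl)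
    rwa [zero_add, ← hγt] at this
  have hmain := intervalIntegral.integral_eq_sub_of_hasDeriv_right (a := s) (b := t)
    hφc.continuousOn (f' := γ) (fun r hr => hderiv r (by
      rw [min_eq_left hst] at hr; exact hr.1.le)) (hγc.intervalIntegrable _ _)
  obtain ⟨B, hB⟩ := hLb t
  have habs : ∀ σ, s ≤ σ → σ ≤ t → |σ| ≤ t := fun σ h1 h2 => by
    rw [abs_of_nonneg (hs.trans h1)]; exact h2
  have hint : Integrable (fun ω => ∫ σ in s..t, L (y σ ω) (n σ ω)) P := by
    simp only [intervalIntegral.integral_of_le hst]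
    refine Integrable.of_bound (C := B * (volume.restrict (Ioc s t)).real univ)
      hLm.integral_prod_left.aestronglyMeasurable (Eventually.of_forall fun ω => ?_)
    exact norm_integral_le_of_norm_le_const ((ae_restrict_iff' measurableSet_Ioc).2
      (Eventually.of_forall fun σ hσ => hB σ ω (habs σ hσ.1.le hσ.2)))
  rw [setIntegral_sub_sub (hΦi t t) (hΦi s s) hint,
    setIntegral_intervalIntegral_swap (f := fun σ ω => L (y σ ω) (n σ ω)) hLm hst
      (fun σ ω h1 h2 => hB σ ω (habs σ h1 h2)), hmain, sub_self]

end Dynkin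

end KineticDiffusion
-- Regularity of good test functions.
namespace KineticDiffusion

section TestFunction

variable {V : Type*} [MeasurableSpace V] {d : ℕ} {μ : Measure V} [IsProbabilityMeasure μ]
  {E : Set (W1inf d)}

/-- An exact mean value formula: the increment is seen only through its `L²_{x,v}` part, so a curve
differentiable merely in `L²_{x,v}` can be followed. -/
theorem HasL2Gradient.exists_eq_inner {φ : L2H1 d μ → ℝ} {g : L2H1 d μ → L2xv d μ}
    (h : ∀ u, HasL2Gradient φ (g u) u) (u w : L2H1 d μ) :
    ∃ z ∈ segment ℝ u w, φ w - φ u = inner ℝ (g z) (toL2 w - toL2 u) := by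
  obtain ⟨z, hz, he⟩ := domain_mvt (s := univ) (f' := fun u => (innerSL ℝ (g u)).comp toL2)
    (fun u _ => (h u).hasFDerivWithinAt) convex_univ (mem_univ u) (mem_univ w)
  refine ⟨z, hz, ?_⟩
  rw [he, ← toL2.map_sub]
  rfl

/-- Differentiation along a curve which is differentiable in `L²_{x,v}` only. -/
theorem HasL2Gradient.tendsto_slope {φ : L2H1 d μ → ℝ} {g : L2H1 d μ → L2xv d μ}
    (h : ∀ u, HasL2Gradient φ (g u) u) (hg : Continuous g) {ι : Type*} {l : Filter ι}
    {w : ι → L2H1 d μ} {w₀ : L2H1 d μ} {c : ι → ℝ} {v : L2xv d μ} (hw : Tendsto w l (𝓝 w₀))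
    (hv : Tendsto (fun k => c k • (toL2 (w k) - toL2 w₀)) l (𝓝 v)) :
    Tendsto (fun k => c k * (φ (w k) - φ w₀)) l (𝓝 (inner ℝ (g w₀) v)) := by
  choose z hz he using fun k => HasL2Gradient.exists_eq_inner h w₀ (w k)
  have hzt : Tendsto z l (𝓝 w₀) := by
    rw [tendsto_iff_norm_sub_tendsto_zero] at hw ⊢
    refine squeeze_zero (fun _ => norm_nonneg _) (fun k => ?_) hw
    have := norm_sub_le_of_mem_segment (hz k)
    exact this
  have := ((hg.tendsto w₀).comp hzt).inner (𝕜 := ℝ) hv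
  refine this.congr fun k => ?_
  rw [Function.comp_apply, inner_smul_right, ← he k]

/-- The orbit is continuous in `L²(V; H¹)`, which places the intermediate point of the mean value
formula near the base point, while its difference quotients converge in `L²_{x,v}` only. -/
theorem hasDerivAt_transportH (a : Lp (EuclideanSpace ℝ (Fin d)) ⊤ μ) {φ : L2H1 d μ → ℝ}
    {g : L2H1 d μ → L2xv d μ} (h : ∀ u, HasL2Gradient φ (g u) u) (hg : Continuous g)
    (u : L2H1 d μ) (t : ℝ) : HasDerivAt (fun s => φ (transportH a s u))
      (inner ℝ (g (transportH a t u)) (advection a (transportH a t u))) t := by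
  rw [hasDerivAt_iff_tendsto_slope_zero]
  have e : ∀ s, transportH a (t + s) u = transportH a s (transportH a t u) := fun s => by
    rw [transportH_transportH, add_comm]
  simp only [e, smul_eq_mul]
  set w := transportH a t u
  refine HasL2Gradient.tendsto_slope h hg ?_ ?_
  · have := ((continuous_transportH a w).tendsto 0).mono_left (nhdsWithin_le_nhds (s := {0}ᶜ))
    rwa [transportH_zero] at this
  · simp only [toL2_transportH]
    exact tendsto_transport_slope a w

variable {Pt : ℝ≥0 → Kernel E E} {DM : Set (E →ᵇ ℝ)} {Ψ : L2H1 d μ → E → ℝ}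

theorem IsGoodTestFunction.hasL2Gradient (hΨ : IsGoodTestFunction Pt DM Ψ) (u : L2H1 d μ) (n : E) :
    HasL2Gradient (fun u => Ψ u n) (gradient Ψ u n) u := by
  have h := hΨ.differentiable u n
  rw [gradient, dif_pos h]
  exact h.choose_spec

theorem isBounded_closedBall_prod (hE : Bornology.IsBounded E) (R : ℝ) :
    Bornology.IsBounded (Metric.closedBall (0 : L2H1 d μ) R ×ˢ (univ : Set E)) := by
  refine Metric.isBounded_closedBall.prod ?_
  rw [← Bornology.isBounded_image_subtype_val]
  simpa using hE

/-- Boundedness of `Ψ` itself is not part of the definition: `Ψ 0` is bounded because it belongs to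
`D_M`, and the gradient controls the rest along the segment from `0`. -/
theorem IsGoodTestFunction.exists_bound (hΨ : IsGoodTestFunction Pt DM Ψ)
    (hE : Bornology.IsBounded E) (R : ℝ) : ∃ B, 0 ≤ B ∧ ∀ u n, ‖u‖ ≤ R →
      |Ψ u n| ≤ B ∧ ‖gradient Ψ u n‖ ≤ B ∧ |markovGenerator Pt (Ψ u) n| ≤ B := by
  have hb := isBounded_closedBall_prod (μ := μ) hE R
  obtain ⟨B₁, h₁⟩ := (hΨ.bounded_gradient _ hb).exists_norm_le
  obtain ⟨B₂, h₂⟩ := (hΨ.bounded_generator _ hb).exists_norm_le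
  obtain ⟨ψ, -, hψ⟩ := hΨ.mem_domain 0
  have h₁' : ∀ u n, ‖u‖ ≤ R → ‖gradient Ψ u n‖ ≤ max B₁ 0 := fun u n hu =>
    (h₁ _ ⟨(u, n), ⟨by simpa using hu, mem_univ _⟩, rfl⟩).trans (le_max_left _ _)
  have h₂' : ∀ u n, ‖u‖ ≤ R → |markovGenerator Pt (Ψ u) n| ≤ max B₂ 0 := fun u n hu =>
    (h₂ _ ⟨(u, n), ⟨by simpa using hu, mem_univ _⟩, rfl⟩).trans (le_max_left _ _)
  have p1 : 0 ≤ max B₁ 0 := le_max_right _ _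
  have p2 : 0 ≤ max B₂ 0 := le_max_right _ _
  have p3 : 0 ≤ ‖ψ‖ := norm_nonneg _
  have p4 : 0 ≤ max B₁ 0 * |R| := by positivity
  refine ⟨‖ψ‖ + max B₁ 0 * |R| + max B₁ 0 + max B₂ 0, by positivity, fun u n hu =>
    ⟨?_, (h₁' u n hu).trans (by linarith), (h₂' u n hu).trans (by linarith)⟩⟩
  obtain ⟨z, hz, he⟩ := HasL2Gradient.exists_eq_inner (fun u => hΨ.hasL2Gradient u n) 0 u
  have hzR : ‖z‖ ≤ R := by
    have := norm_sub_le_of_mem_segment hz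
    simp only [sub_zero] at this
    exact this.trans hu
  have h3 : |Ψ u n - Ψ 0 n| ≤ max B₁ 0 * |R| := by
    rw [he]
    refine (abs_real_inner_le_norm _ _).trans (mul_le_mul (h₁' z n hzR) ?_ (norm_nonneg _) p1)
    rw [← toL2.map_sub, sub_zero]
    exact (norm_toL2_le u).trans (hu.trans (le_abs_self R))
  have h4 : |Ψ 0 n| ≤ ‖ψ‖ := by
    rw [← hψ]
    exact ψ.norm_coe_le_norm n
  have h5 : |Ψ u n| ≤ |Ψ u n - Ψ 0 n| + |Ψ 0 n| := by
    simpa using abs_add_le (Ψ u n - Ψ 0 n) (Ψ 0 n)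
  linarith

theorem IsGoodTestFunction.abs_sub_le (hΨ : IsGoodTestFunction Pt DM Ψ) {R B : ℝ}
    (hB : ∀ u n, ‖u‖ ≤ R →
      |Ψ u n| ≤ B ∧ ‖gradient Ψ u n‖ ≤ B ∧ |markovGenerator Pt (Ψ u) n| ≤ B)
    {u w : L2H1 d μ} (hu : ‖u‖ ≤ R) (hw : ‖w‖ ≤ R) (n : E) : |Ψ w n - Ψ u n| ≤ B * ‖w - u‖ := by
  obtain ⟨z, hz, he⟩ := HasL2Gradient.exists_eq_inner (fun u => hΨ.hasL2Gradient u n) u w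
  have hzR : ‖z‖ ≤ R := by
    have := (convex_closedBall (0 : L2H1 d μ) R).segment_subset (by simpa using hu)
      (by simpa using hw) hz
    simpa using this
  rw [he, ← toL2.map_sub]
  exact (abs_real_inner_le_norm _ _).trans (mul_le_mul (hB z n hzR).2.1 (norm_toL2_le _)
    (norm_nonneg _) ((norm_nonneg _).trans (hB z n hzR).2.1))

/-- Joint continuity follows from continuity in `n` for each `u` and a Lipschitz bound in `u` which
is local but uniform in `n`. -/
theorem IsGoodTestFunction.continuous (hΨ : IsGoodTestFunction Pt DM Ψ)
    (hE : Bornology.IsBounded E) : Continuous (Function.uncurry Ψ) := by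
  refine continuous_iff_continuousAt.2 fun p => ?_
  obtain ⟨B, hB0, hB⟩ := hΨ.exists_bound hE (‖p.1‖ + 1)
  obtain ⟨ψ, -, hψ⟩ := hΨ.mem_domain p.1
  rw [ContinuousAt, tendsto_iff_dist_tendsto_zero]
  have hlim : Tendsto (fun q : L2H1 d μ × E => B * ‖q.1 - p.1‖ + dist (Ψ p.1 q.2) (Ψ p.1 p.2))
      (𝓝 p) (𝓝 0) := by
    have h1 : Continuous fun q : L2H1 d μ × E =>
        B * ‖q.1 - p.1‖ + dist (Ψ p.1 q.2) (Ψ p.1 p.2) := by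
      rw [← hψ]
      have := ψ.continuous
      fun_prop
    have h2 := h1.tendsto p
    simpa using h2
  have hev : ∀ᶠ q : L2H1 d μ × E in 𝓝 p, ‖q.1‖ < ‖p.1‖ + 1 :=
    (continuous_fst.norm.continuousAt).eventually_lt continuousAt_const (lt_add_one _)
  refine squeeze_zero' (Eventually.of_forall fun _ => dist_nonneg) (hev.mono fun q hq => ?_) hlim
  refine (dist_triangle _ (Ψ p.1 q.2) _).trans (add_le_add ?_ le_rfl)
  exact hΨ.abs_sub_le hB (by linarith) hq.le q.2

end TestFunction

end KineticDiffusion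
-- Test functions in the interaction picture.
namespace KineticDiffusion

theorem continuous_uncurry_comp {α A B C : Type*} [TopologicalSpace α] [TopologicalSpace A]
    [TopologicalSpace B] [TopologicalSpace C] (F : A → B → C)
    (hF : Continuous fun p : A × B => F p.1 p.2) {u : α → A} {n : α → B} (hu : Continuous u)
    (hn : Continuous n) : Continuous fun x => F (u x) (n x) :=
  hF.comp (hu.prodMk hn)

section SplitDifferential

variable {X H : Type*} [NormedAddCommGroup X] [InnerProductSpace ℝ X] [NormedAddCommGroup H]
  [NormedSpace ℝ H]

/-- The linear form `(τ, w) ↦ τ c + (g, J w)`. -/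
def splitForm (J : H →L[ℝ] X) (c : ℝ) (g : X) : ℝ × H →L[ℝ] ℝ :=
  (ContinuousLinearMap.toSpanSingleton ℝ c).coprod ((innerSL ℝ g).comp J)

theorem splitForm_apply (J : H →L[ℝ] X) (c : ℝ) (g : X) (p : ℝ × H) :
    splitForm J c g p = p.1 * c + inner ℝ g (J p.2) := rfl

theorem continuous_toSpanSingleton {α : Type*} [TopologicalSpace α] {c : α → ℝ}
    (hc : Continuous c) : Continuous fun x => ContinuousLinearMap.toSpanSingleton ℝ (c x) :=
  (ContinuousLinearMap.toSpanSingletonCLE (𝕜 := ℝ) (E := ℝ)).continuous.comp hc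

theorem continuous_inner_comp {α : Type*} [TopologicalSpace α] (J : H →L[ℝ] X) {g : α → X}
    (hg : Continuous g) : Continuous fun x => (innerSL ℝ (g x)).comp J :=
  ((innerSL ℝ).continuous.comp hg).clm_comp continuous_const

theorem continuous_splitForm {α : Type*} [TopologicalSpace α] (J : H →L[ℝ] X) {c : α → ℝ}
    {g : α → X} (hc : Continuous c) (hg : Continuous g) :
    Continuous fun x => splitForm J (c x) (g x) :=
  ((continuous_toSpanSingleton hc).clm_comp
    (continuous_const (y := ContinuousLinearMap.fst ℝ ℝ H))).add
    ((continuous_inner_comp J hg).clm_comp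
      (continuous_const (y := ContinuousLinearMap.snd ℝ ℝ H)))

theorem norm_splitForm_le {J : H →L[ℝ] X} (hJ : ∀ w, ‖J w‖ ≤ ‖w‖) (c : ℝ) (g : X) :
    ‖splitForm J c g‖ ≤ |c| + ‖g‖ := by
  refine ContinuousLinearMap.opNorm_le_bound _ (by positivity) fun p => ?_
  rw [splitForm_apply, add_mul]
  refine (norm_add_le _ _).trans (add_le_add ?_ ?_)
  · rw [norm_mul, mul_comm]
    exact mul_le_mul_of_nonneg_left (norm_fst_le p) (abs_nonneg c)
  · exact (norm_inner_le_norm _ _).trans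
      (mul_le_mul_of_nonneg_left ((hJ _).trans (norm_snd_le p)) (norm_nonneg g))

/-- Jointly continuous partial differentials in `τ` and `u` give a total differential. -/
theorem hasFDerivAt_splitForm {J : H →L[ℝ] X} {F : ℝ → H → ℝ} {c : ℝ → H → ℝ} {g : ℝ → H → X}
    (hc : Continuous (Function.uncurry c)) (hg : Continuous (Function.uncurry g))
    (h1 : ∀ τ u, HasDerivAt (fun τ => F τ u) (c τ u) τ)
    (h2 : ∀ τ u, HasFDerivAt (F τ) ((innerSL ℝ (g τ u)).comp J) u) (p : ℝ × H) :
    HasFDerivAt (Function.uncurry F) (splitForm J (c p.1 p.2) (g p.1 p.2)) p :=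
  (hasStrictFDerivAt_uncurry_coprod (𝕜 := ℝ) (u := p) (f := F)
    (f₁ := fun τ u => ContinuousLinearMap.toSpanSingleton ℝ (c τ u))
    (f₂ := fun τ u => (innerSL ℝ (g τ u)).comp J)
    (Eventually.of_forall fun q => (h1 q.1 q.2).hasFDerivAt)
    (Eventually.of_forall fun q => h2 q.1 q.2)
    (continuous_toSpanSingleton hc).continuousAt
    (continuous_inner_comp J hg).continuousAt).hasFDerivAt

end SplitDifferential

section Instantiation

variable {V : Type*} [MeasurableSpace V] {d : ℕ} {μ : Measure V} [IsProbabilityMeasure μ]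
  (a : Lp (EuclideanSpace ℝ (Fin d)) ⊤ μ) (ε : ℝ) {E : Set (W1inf d)}

theorem continuous_driftH {α : Type*} [TopologicalSpace α] {n : α → W1inf d} {u : α → L2H1 d μ}
    (hn : Continuous n) (hu : Continuous u) : Continuous fun x => driftH ε (n x) (u x) := by
  have h1 : Continuous fun x => (collisionH : L2H1 d μ →L[ℝ] L2H1 d μ) (u x) :=
    (collisionH : L2H1 d μ →L[ℝ] L2H1 d μ).continuous.comp hu
  have h2 : Continuous fun x => noiseH (n x) (u x) :=
    continuous_uncurry_comp (fun (n : W1inf d) (u : L2H1 d μ) => noiseH n u) continuous_noiseH hn hu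
  have h3 : Continuous fun x => (ε ^ 2)⁻¹ • (collisionH : L2H1 d μ →L[ℝ] L2H1 d μ) (u x) :=
    h1.const_smul (ε ^ 2)⁻¹
  have h4 : Continuous fun x => ε⁻¹ • noiseH (n x) (u x) := h2.const_smul ε⁻¹
  exact h3.add h4

/-- The velocity of the interaction picture, with time as an additional variable. -/
def velocity (p : ℝ × L2H1 d μ) (n : E) : ℝ × L2H1 d μ :=
  (1, transportH a (p.1 / ε) (driftH ε (n : W1inf d) (transportH a (-(p.1 / ε)) p.2)))

/-- The observable `Ψ` in the interaction picture. -/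
def pictureFun (Ψ : L2H1 d μ → E → ℝ) (p : ℝ × L2H1 d μ) (n : E) : ℝ :=
  Ψ (transportH a (-(p.1 / ε)) p.2) n

/-- The differential of `Ψ` in the interaction picture. -/
def pictureDeriv (Ψ : L2H1 d μ → E → ℝ) (p : ℝ × L2H1 d μ) (n : E) : ℝ × L2H1 d μ →L[ℝ] ℝ :=
  splitForm toL2 (-ε⁻¹ * inner ℝ (gradient Ψ (transportH a (-(p.1 / ε)) p.2) n)
      (advection a (transportH a (-(p.1 / ε)) p.2)))
    (transport a (p.1 / ε) (gradient Ψ (transportH a (-(p.1 / ε)) p.2) n))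

/-- The generator of the noise in the interaction picture. -/
def pictureGen (Pt : ℝ≥0 → Kernel E E) (Ψ : L2H1 d μ → E → ℝ) (p : ℝ × L2H1 d μ) (n : E) : ℝ :=
  (ε ^ 2)⁻¹ * markovGenerator Pt (Ψ (transportH a (-(p.1 / ε)) p.2)) n

variable {a ε}

theorem inner_transport (τ : ℝ) (f g : L2xv d μ) :
    inner ℝ (transport a τ f) g = inner ℝ f (transport a (-τ) g) := by
  have h := (transportL a (-τ)).inner_map_map (transport a τ f) g
  rw [transportL_apply, transportL_apply, transport_transport, neg_add_cancel, transport_zero] at h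
  exact h.symm

variable {Pt : ℝ≥0 → Kernel E E} {DM : Set (E →ᵇ ℝ)} {Ψ : L2H1 d μ → E → ℝ}

/-- The time component, whose speed is `1`, contributes `-ε⁻¹ (A u, DΨ)`. In the other component the
transports acting on gradient and drift cancel in the scalar product, leaving the collision and
noise terms. -/
theorem pictureDeriv_velocity (p : ℝ × L2H1 d μ) (n : E) :
    pictureDeriv a ε Ψ p n (velocity a ε p n) + pictureGen a ε Pt Ψ p n =
      generator a Pt ε Ψ (transportH a (-(p.1 / ε)) p.2) n := by
  rw [pictureDeriv, pictureGen, velocity]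
  set u := transportH a (-(p.1 / ε)) p.2
  simp only [splitForm_apply, toL2_transportH, toL2_driftH, driftL_apply]
  rw [← transportL_apply, ← transportL_apply, (transportL a (p.1 / ε)).inner_map_map,
    inner_add_right, inner_smul_right, inner_smul_right, generator, generatorA, generatorL,
    real_inner_comm (gradient Ψ u n) (collision (toL2 u)),
    real_inner_comm (gradient Ψ u n) (mulNoise (toL2 u) n),
    real_inner_comm (gradient Ψ u n) (advection a u)]
  ring

theorem continuous_pictureArg :
    Continuous fun q : (ℝ × L2H1 d μ) × E => transportH a (-(q.1.1 / ε)) q.1.2 :=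
  continuous_transportH₂ a (by fun_prop) (by fun_prop)

theorem continuous_pictureGradient (hΨ : IsGoodTestFunction Pt DM Ψ) :
    Continuous fun q : (ℝ × L2H1 d μ) × E =>
      gradient Ψ (transportH a (-(q.1.1 / ε)) q.1.2) q.2 :=
  continuous_uncurry_comp (fun u n => gradient Ψ u n) hΨ.continuous_gradient continuous_pictureArg
    continuous_snd

theorem continuous_pictureDeriv (hΨ : IsGoodTestFunction Pt DM Ψ) :
    Continuous (Function.uncurry (pictureDeriv a ε Ψ)) := by
  have hadv : Continuous fun q : (ℝ × L2H1 d μ) × E =>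
      advection a (transportH a (-(q.1.1 / ε)) q.1.2) := by
    simp only [← advectionL_apply]
    exact (advectionL a).continuous.comp continuous_pictureArg
  have hgr := continuous_pictureGradient (a := a) (ε := ε) hΨ
  exact continuous_splitForm toL2 (continuous_const.mul (hgr.inner hadv))
    (continuous_transport₂ a (by fun_prop) hgr)

theorem hasFDerivAt_pictureFun (hΨ : IsGoodTestFunction Pt DM Ψ) (p : ℝ × L2H1 d μ) (n : E) :
    HasFDerivAt (fun p => pictureFun a ε Ψ p n) (pictureDeriv a ε Ψ p n) p := by
  have hgrc : Continuous fun u => gradient Ψ u n :=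
    hΨ.continuous_gradient.comp (Continuous.prodMk_left n)
  have hu : Continuous fun q : ℝ × L2H1 d μ => transportH a (-(q.1 / ε)) q.2 :=
    continuous_transportH₂ a (by fun_prop) (by fun_prop)
  have hadv : Continuous fun q : ℝ × L2H1 d μ => advection a (transportH a (-(q.1 / ε)) q.2) := by
    simp only [← advectionL_apply]
    exact (advectionL a).continuous.comp hu
  refine hasFDerivAt_splitForm (J := toL2) (F := fun τ u => pictureFun a ε Ψ (τ, u) n)
    (c := fun τ u => -ε⁻¹ * inner ℝ (gradient Ψ (transportH a (-(τ / ε)) u) n)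
      (advection a (transportH a (-(τ / ε)) u)))
    (g := fun τ u => transport a (τ / ε) (gradient Ψ (transportH a (-(τ / ε)) u) n))
    (continuous_const.mul ((hgrc.comp hu).inner hadv))
    (continuous_transport₂ a (by fun_prop) (hgrc.comp hu)) (fun τ u => ?_) (fun τ u => ?_) p
  · have e1 := hasDerivAt_transportH a (fun u => hΨ.hasL2Gradient u n) hgrc u (-(τ / ε))
    have e2 : HasDerivAt (fun τ : ℝ => -(τ / ε)) (-ε⁻¹) τ := by
      have := ((hasDerivAt_id' τ).div_const ε).fun_neg
      rwa [one_div] at this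
    have e3 := e1.comp τ e2
    rw [mul_comm] at e3
    exact e3
  · have e1 := (hΨ.hasL2Gradient (transportH a (-(τ / ε)) u) n).comp u
      (transportH a (-(τ / ε))).hasFDerivAt
    refine e1.congr_fderiv (ContinuousLinearMap.ext fun w => ?_)
    simp only [ContinuousLinearMap.comp_apply, innerSL_apply_apply, toL2_transportH]
    -- The adjoint of the transport is its inverse; this is why the gradient in `pictureDeriv` is
    -- transported by `τ / ε`.
    rw [inner_transport, real_inner_comm]

theorem continuous_pictureFun (hΨ : IsGoodTestFunction Pt DM Ψ) (hE : Bornology.IsBounded E) :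
    Continuous (Function.uncurry (pictureFun a ε Ψ)) :=
  continuous_uncurry_comp (fun u n => Ψ u n) (hΨ.continuous hE) continuous_pictureArg continuous_snd

theorem continuous_pictureGen (hΨ : IsGoodTestFunction Pt DM Ψ) :
    Continuous (Function.uncurry (pictureGen a ε Pt Ψ)) := by
  have h1 : Continuous fun q : (ℝ × L2H1 d μ) × E =>
      markovGenerator Pt (Ψ (transportH a (-(q.1.1 / ε)) q.1.2)) q.2 :=
    continuous_uncurry_comp (fun u n => markovGenerator Pt (Ψ u) n) hΨ.continuous_generator
      continuous_pictureArg continuous_snd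
  have h2 : Continuous fun q : (ℝ × L2H1 d μ) × E =>
      (ε ^ 2)⁻¹ * markovGenerator Pt (Ψ (transportH a (-(q.1.1 / ε)) q.1.2)) q.2 :=
    continuous_const.mul h1
  exact h2

theorem exists_bound_picture (hΨ : IsGoodTestFunction Pt DM Ψ) (hE : Bornology.IsBounded E)
    (R : ℝ) : ∃ B, 0 ≤ B ∧ ∀ (p : ℝ × L2H1 d μ) (n : E), ‖p‖ ≤ R → |pictureFun a ε Ψ p n| ≤ B ∧
      ‖pictureDeriv a ε Ψ p n‖ ≤ B ∧ |pictureGen a ε Pt Ψ p n| ≤ B := by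
  obtain ⟨B, hB0, hB⟩ := hΨ.exists_bound hE R
  have p1 : 0 ≤ |ε⁻¹| * (B * (‖advectionL a‖ * |R|)) := by positivity
  have p2 : 0 ≤ |(ε ^ 2)⁻¹| * B := by positivity
  refine ⟨B + |ε⁻¹| * (B * (‖advectionL a‖ * |R|)) + |(ε ^ 2)⁻¹| * B, by positivity,
    fun p n hp => ?_⟩
  have hu : ‖transportH a (-(p.1 / ε)) p.2‖ ≤ R := by
    rw [norm_transportH]
    exact (norm_snd_le p).trans hp
  obtain ⟨h1, h2, h3⟩ := hB _ n hu
  refine ⟨h1.trans (by linarith), ?_, ?_⟩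
  · refine (norm_splitForm_le norm_toL2_le _ _).trans ?_
    rw [norm_transport, abs_mul, abs_neg]
    have h4 : |inner ℝ (gradient Ψ (transportH a (-(p.1 / ε)) p.2) n)
        (advection a (transportH a (-(p.1 / ε)) p.2))| ≤ B * (‖advectionL a‖ * |R|) := by
      refine (abs_real_inner_le_norm _ _).trans (mul_le_mul h2 ?_ (norm_nonneg _) hB0)
      rw [← advectionL_apply]
      exact ((advectionL a).le_opNorm _).trans (by gcongr; exact hu.trans (le_abs_self R))
    have h5 := mul_le_mul_of_nonneg_left h4 (abs_nonneg ε⁻¹)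
    linarith
  · rw [pictureGen, abs_mul]
    have : |(ε ^ 2)⁻¹| * |markovGenerator Pt (Ψ (transportH a (-(p.1 / ε)) p.2)) n| ≤
        |(ε ^ 2)⁻¹| * B := by gcongr
    linarith

theorem isTestDatum_picture (hΨ : IsGoodTestFunction Pt DM Ψ) (hE : Bornology.IsBounded E) :
    IsTestDatum (pictureFun a ε Ψ) (pictureDeriv a ε Ψ) (pictureGen a ε Pt Ψ) where
  hasFDerivAt := hasFDerivAt_pictureFun hΨ
  continuous_fun := continuous_pictureFun hΨ hE
  continuous_deriv := continuous_pictureDeriv hΨ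
  continuous_gen := continuous_pictureGen hΨ
  bounded := exists_bound_picture hΨ hE

end Instantiation

end KineticDiffusion
-- The solution as a driven path, and its Dynkin formula.
namespace KineticDiffusion

/-- Time as an additional variable of a driven path. -/
theorem isDrivenPath_prodMk {Ω H E : Type*} {mΩ : MeasurableSpace Ω} {P : Measure Ω}
    [NormedAddCommGroup H] [NormedSpace ℝ H] [CompleteSpace H] [PseudoMetricSpace E]
    [MeasurableSpace E] {𝒢 : ℝ → MeasurableSpace Ω} {n : ℝ → Ω → E} {I : ℝ × H → E → H}
    {g : ℝ → Ω → H} (hle : ∀ t, 𝒢 t ≤ mΩ) (hn : Measurable (Function.uncurry n))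
    (hnt : ∀ t, TendstoInMeasure P n (𝓝 t) (n t))
    (hg : StronglyMeasurable (Function.uncurry g)) (hg' : ∀ t, AEStronglyMeasurable[𝒢 t] (g t) P)
    (hgc : ∀ ω, Continuous fun t => g t ω) (hI : Continuous (Function.uncurry I))
    (hIm : StronglyMeasurable fun p : ℝ × Ω => I (p.1, g p.1 p.2) (n p.1 p.2))
    (hsub : ∀ ω r t, 0 ≤ r → r ≤ t → g t ω - g r ω = ∫ s in r..t, I (s, g s ω) (n s ω))
    {R : ℝ → ℝ} (hgb : ∀ T t ω, |t| ≤ T → ‖g t ω‖ ≤ R T)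
    (hIb : ∀ T t ω, |t| ≤ T → ‖I (t, g t ω) (n t ω)‖ ≤ R T) :
    IsDrivenPath P 𝒢 n (fun p e => (1, I p e)) (fun t ω => (t, g t ω)) := by
  -- In the bound, `|T|` controls the time component, `1` is the speed of time, and `|R T|` controls
  -- the path and its velocity.
  refine ⟨hle, hn, hnt, measurable_fst.stronglyMeasurable.prodMk hg,
    fun t => aestronglyMeasurable_const.prodMk (hg' t), fun ω => continuous_id.prodMk (hgc ω),
    continuous_const.prodMk hI, stronglyMeasurable_const.prodMk hIm, fun ω r t hr hrt => ?_,
    fun T => ⟨|T| + 1 + |R T|, by positivity, fun t ω ht => ⟨?_, ?_⟩⟩⟩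
  · have hi : IntegrableOn (fun s => I (s, g s ω) (n s ω)) (Ioc r t) := by
      refine Measure.integrableOn_of_bounded (M := R t) (by simp)
        (hIm.comp_measurable measurable_prodMk_right).aestronglyMeasurable
        ((ae_restrict_iff' measurableSet_Ioc).2 (Eventually.of_forall fun s hs => hIb t s ω ?_))
      rw [abs_of_nonneg (hr.trans hs.1.le)]
      exact hs.2
    have e := integral_pair (μ := volume.restrict (Ioc r t)) (f := fun _ : ℝ => (1 : ℝ))
      (integrable_const _) hi
    rw [intervalIntegral.integral_of_le hrt, e, Prod.mk_sub_mk, hsub ω r t hr hrt,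
      intervalIntegral.integral_of_le hrt]
    simp [hrt]
  · refine (Prod.norm_def _).trans_le (max_le ?_ ?_)
    · have := abs_nonneg (R T)
      have := le_abs_self T
      rw [Real.norm_eq_abs]
      linarith
    · have := abs_nonneg T
      exact (hgb T t ω ht).trans (by linarith [le_abs_self (R T)])
  · have := abs_nonneg T
    refine (Prod.norm_def _).trans_le (max_le ?_ ?_)
    · exact (norm_one (α := ℝ)).le.trans (by linarith [abs_nonneg (R T)])
    · exact (hIb T t ω ht).trans (by linarith [le_abs_self (R T)])

section SolutionProcess

variable {V : Type*} [MeasurableSpace V] {d : ℕ} {μ : Measure V} [IsProbabilityMeasure μ]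
  {a : Lp (EuclideanSpace ℝ (Fin d)) ⊤ μ} {ε : ℝ}
  {Ω : Type*} {mΩ : MeasurableSpace Ω} {P : Measure Ω}
  {ℱ : Filtration ℝ mΩ} {E : Set (W1inf d)} {m : ℝ → Ω → E} {Pt : ℝ≥0 → Kernel E E}
  {DM : Set (E →ᵇ ℝ)} {Ψ : L2H1 d μ → E → ℝ} {u₀ : L2H1 d μ}

/-- The rescaled process `m^ε`. -/
def noise (m : ℝ → Ω → E) (ε t : ℝ) (ω : Ω) : E := m (t / ε ^ 2) ω

/-- The rescaled process `m^ε`, with values in `W^{1,∞}`. -/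
def noiseW (m : ℝ → Ω → E) (ε t : ℝ) (ω : Ω) : W1inf d := noise m ε t ω

theorem measurable_noise (hm : IsDrivingProcess P ℱ E m Pt DM) (ε : ℝ) :
    Measurable (Function.uncurry (noise m ε)) :=
  hm.measurable.comp ((measurable_fst.div_const _).prodMk measurable_snd)

theorem measurable_noiseW (hm : IsDrivingProcess P ℱ E m Pt DM) (ε : ℝ) :
    Measurable (Function.uncurry (noiseW m ε)) :=
  measurable_subtype_coe.comp (measurable_noise hm ε)

theorem tendsto_noise (hm : IsDrivingProcess P ℱ E m Pt DM) (ε t : ℝ) :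
    TendstoInMeasure P (noise m ε) (𝓝 t) (noise m ε t) := fun δ hδ =>
  (hm.stochasticallyContinuous (t / ε ^ 2) δ hδ).comp
    ((continuous_id.div_const (ε ^ 2)).tendsto t)

variable [IsProbabilityMeasure P]

theorem exists_norm_drift_le (hE : Bornology.IsBounded E) (m : ℝ → Ω → E) (ε : ℝ) (μ : Measure V)
    [IsProbabilityMeasure μ] : ∃ K, 0 ≤ K ∧
      (∀ s ω, ‖(driftH ε (noiseW m ε s ω) : L2H1 d μ →L[ℝ] L2H1 d μ)‖ ≤ K) ∧
      ∀ s ω, ‖(driftL ε (noiseW m ε s ω) : L2xv d μ →L[ℝ] L2xv d μ)‖ ≤ K := by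
  obtain ⟨R, hR⟩ := hE.exists_norm_le
  obtain ⟨K, hK0, hK⟩ := exists_norm_driftH_le (μ := μ) (d := d) ε (max R 0) (le_max_right _ _)
  have h : ∀ s ω, ‖noiseW m ε s ω‖ ≤ max R 0 := fun s ω =>
    (hR _ (noise m ε s ω).2).trans (le_max_left _ _)
  exact ⟨K, hK0, fun s ω => (hK _ (h s ω)).1, fun s ω => (hK _ (h s ω)).2⟩

theorem isDrivenPath_solG (hm : IsDrivingProcess P ℱ E m Pt DM) (u₀ : L2H1 d μ) :
    IsDrivenPath P (fun t => ℱ (t / ε ^ 2)) (noise m ε) (velocity a ε)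
      (fun t ω => (t, solG a ε (noiseW m ε) u₀ t ω)) := by
  obtain ⟨K, hK0, hK, -⟩ := exists_norm_drift_le hm.bounded m ε μ
  have hM := measurable_noiseW hm ε
  have h1 : StronglyMeasurable (Function.uncurry (solG a ε (noiseW m ε) u₀)) :=
    stronglyMeasurable_dyson hK0 (norm_interaction_le hK0 hK) (stronglyMeasurable_interaction hM)
  have h2 : ∀ t, AEStronglyMeasurable[ℱ (t / ε ^ 2)] (solG a ε (noiseW m ε) u₀ t) P := fun t =>
    aestronglyMeasurable_solG (𝒢 := fun t => ℱ (t / ε ^ 2)) (fun t => ℱ.le _)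
      (fun s t hst => ℱ.mono (div_le_div_of_nonneg_right hst (sq_nonneg ε))) hM
      (fun t => measurable_subtype_coe.comp (hm.adapted _)) hK0 hK t
  have h3 : ∀ ω r t, 0 ≤ r → r ≤ t → solG a ε (noiseW m ε) u₀ t ω - solG a ε (noiseW m ε) u₀ r ω =
      ∫ s in r..t, interaction a ε (noiseW m ε) s ω (solG a ε (noiseW m ε) u₀ s ω) :=
    fun ω r t hr hrt => by
      have h1 := intervalIntegrable_interaction (u₀ := u₀) (a := a) hM hK0 hK ω
      rw [solG_eq hM hK0 hK hr, solG_eq hM hK0 hK (hr.trans hrt), add_sub_add_left_eq_sub,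
        intervalIntegral.integral_interval_sub_left (h1 _ _) (h1 _ _)]
  have hexp : ∀ T t, |t| ≤ T →
      ‖u₀‖ * Real.exp (K * max t 0) ≤ ‖u₀‖ * Real.exp (K * max T 0) := fun T t ht => by
    gcongr
    exact (le_abs_self t).trans ht
  have hI : Continuous (Function.uncurry fun (p : ℝ × L2H1 d μ) (n : E) =>
      transportH a (p.1 / ε) (driftH ε (n : W1inf d) (transportH a (-(p.1 / ε)) p.2))) :=
    continuous_transportH₂ a (by fun_prop) (continuous_driftH ε
      (by fun_prop) (continuous_transportH₂ a (by fun_prop) (by fun_prop)))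
  have hIm := stronglyMeasurable_interaction_solG (u₀ := u₀) (a := a) hM hK0 hK
  exact isDrivenPath_prodMk (I := fun (p : ℝ × L2H1 d μ) (n : E) =>
      transportH a (p.1 / ε) (driftH ε (n : W1inf d) (transportH a (-(p.1 / ε)) p.2)))
    (R := fun T => ‖u₀‖ * Real.exp (K * max T 0) + K * (‖u₀‖ * Real.exp (K * max T 0)))
    (fun t => ℱ.le _) (measurable_noise hm ε) (tendsto_noise hm ε) h1 h2
    (continuous_solG hM hK0 hK) hI hIm h3
    (fun T t ω ht => (norm_dyson_le hK0 (norm_interaction_le hK0 hK) t ω).trans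
      ((hexp T t ht).trans (le_add_of_nonneg_right (by positivity))))
    (fun T t ω ht => (norm_interaction_solG_le hK0 hK t ω).trans
      ((mul_le_mul_of_nonneg_left (hexp T t ht) hK0).trans (le_add_of_nonneg_left (by positivity))))

/-- The martingale property of the noise, in rescaled time. -/
theorem setIntegral_noise (hm : IsDrivingProcess P ℱ E m Pt DM) (hε : 0 < ε) {ψ : E →ᵇ ℝ}
    (hψ : ψ ∈ DM) (hc : Continuous (markovGenerator Pt ψ)) {B : ℝ}
    (hB : ∀ n, |markovGenerator Pt ψ n| ≤ B) {s t : ℝ} (hs : 0 ≤ s) (hst : s ≤ t) {A : Set Ω}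
    (hA : MeasurableSet[ℱ (s / ε ^ 2)] A) :
    ∫ ω in A, (ψ (noise m ε t ω) - ψ (noise m ε s ω) -
      ∫ r in s..t, (ε ^ 2)⁻¹ * markovGenerator Pt ψ (noise m ε r ω)) ∂P = 0 := by
  have hε2 : 0 < ε ^ 2 := by positivity
  have hs' : 0 ≤ s / ε ^ 2 := by positivity
  have hst' : s / ε ^ 2 ≤ t / ε ^ 2 := by gcongr
  have hX := hm.generator_martingale ψ hψ
  obtain ⟨s', hs'e⟩ : ∃ s' : ℝ≥0, (s' : ℝ) = s / ε ^ 2 := ⟨⟨_, hs'⟩, rfl⟩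
  obtain ⟨t', ht'e⟩ : ∃ t' : ℝ≥0, (t' : ℝ) = t / ε ^ 2 := ⟨⟨_, hs'.trans hst'⟩, rfl⟩
  have hA' : MeasurableSet[nonnegFiltration ℱ s'] A := by
    change MeasurableSet[ℱ (s' : ℝ)] A
    rwa [hs'e]
  have h1 := hX.setIntegral_eq (t := t') (NNReal.coe_le_coe.1 (by rwa [hs'e, ht'e])) hA'
  rw [← sub_eq_zero, ← integral_sub (hX.integrable _).integrableOn
    (hX.integrable _).integrableOn] at h1
  rw [← h1]
  refine congrArg _ ?_
  funext ω
  have hi : ∀ r t, IntervalIntegrable (fun s => markovGenerator Pt ψ (m s ω)) volume r t :=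
    fun r t => by
      have h0 : Measurable fun s => m s ω := hm.measurable.comp measurable_prodMk_right
      have h1 : Measurable fun s => markovGenerator Pt ψ (m s ω) := hc.measurable.comp h0
      exact (intervalIntegrable_const (c := B)).mono_fun' h1.aestronglyMeasurable
        (Eventually.of_forall fun s => hB (m s ω))
  -- The substitution `r ↦ r / ε²` produces the factor `ε⁻²` in front of `M`.
  have h2 : ∫ r in s..t, (ε ^ 2)⁻¹ * markovGenerator Pt ψ (noise m ε r ω) =
      ∫ r in s / ε ^ 2..t / ε ^ 2, markovGenerator Pt ψ (m r ω) := by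
    simp only [noise]
    rw [intervalIntegral.integral_const_mul, ← intervalIntegral.inv_smul_integral_comp_div]
    simp
  have h3 := intervalIntegral.integral_interval_sub_left (hi 0 (t / ε ^ 2)) (hi 0 (s / ε ^ 2))
  have h4 : ψ (m (t' : ℝ) ω) = ψ (noise m ε t ω) := by rw [ht'e]; rfl
  have h5 : ψ (m (s' : ℝ) ω) = ψ (noise m ε s ω) := by rw [hs'e]; rfl
  have h6 : ∫ r in (0 : ℝ)..t', markovGenerator Pt ψ (m r ω) =
      ∫ r in (0 : ℝ)..t / ε ^ 2, markovGenerator Pt ψ (m r ω) := by rw [ht'e]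
  have h7 : ∫ r in (0 : ℝ)..s', markovGenerator Pt ψ (m r ω) =
      ∫ r in (0 : ℝ)..s / ε ^ 2, markovGenerator Pt ψ (m r ω) := by rw [hs'e]
  linarith

/-- Dynkin's formula for the solution of the kinetic equation. -/
theorem setIntegral_generator (hm : IsDrivingProcess P ℱ E m Pt DM) (hε : 0 < ε)
    (hΨ : IsGoodTestFunction Pt DM Ψ) {s t : ℝ} (hs : 0 ≤ s) (hst : s ≤ t) {A : Set Ω}
    (hA : MeasurableSet[ℱ (s / ε ^ 2)] A) :
    ∫ ω in A, (Ψ (solH a ε (noiseW m ε) u₀ t ω) (noise m ε t ω) -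
      Ψ (solH a ε (noiseW m ε) u₀ s ω) (noise m ε s ω) -
      ∫ r in s..t, generator a Pt ε Ψ (solH a ε (noiseW m ε) u₀ r ω) (noise m ε r ω)) ∂P = 0 := by
  have hp := isDrivenPath_solG (a := a) (ε := ε) hm u₀
  have h := hp.dynkin (isTestDatum_picture (a := a) (ε := ε) hΨ hm.bounded)
    (fun s t hst => ℱ.mono (div_le_div_of_nonneg_right hst (sq_nonneg ε))) (fun z s t hs hst A hA => ?_)
    hs hst hA
  · simp only [pictureDeriv_velocity] at h
    exact h
  -- For a deterministic `z` the picture is `Ψ u` at one fixed `u`, which belongs to `D_M`.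
  · obtain ⟨ψ, hψ, he⟩ := hΨ.mem_domain (transportH a (-(z.1 / ε)) z.2)
    obtain ⟨B, -, hB⟩ := hΨ.exists_bound hm.bounded ‖transportH a (-(z.1 / ε)) z.2‖
    have := setIntegral_noise hm hε hψ (by
      rw [he]
      exact continuous_uncurry_comp (fun u n => markovGenerator Pt (Ψ u) n) hΨ.continuous_generator
        continuous_const continuous_id) (B := B) (fun n => by
        rw [he]; exact (hB _ n le_rfl).2.2) hs hst hA
    rw [he] at this
    exact this

end SolutionProcess

end KineticDiffusion
-- Processes with centred increments, integration by parts and the bracket.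
namespace KineticDiffusion

/-- This is `∫ J dJ = J²/2` for a primitive `J` that is only absolutely continuous: integration by
parts of `J` against itself. -/
theorem integral_mul_primitive {g : ℝ → ℝ} {a b : ℝ} (hg : IntervalIntegrable g volume a b) :
    ∫ s in a..b, (∫ r in a..s, g r) * g s = (∫ r in a..b, g r) ^ 2 / 2 := by
  have hac : AbsolutelyContinuousOnInterval (fun s => ∫ r in a..s, g r) a b :=
    hg.absolutelyContinuousOnInterval_intervalIntegral (by simp)
  have h := hac.integral_mul_deriv_eq_deriv_mul hac
  have h1 : ∀ᵐ s, s ∈ uIoc a b → deriv (fun s => ∫ r in a..s, g r) s = g s := by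
    filter_upwards [hg.ae_hasDerivAt_integral] with s hs hs'
    exact (hs (uIoc_subset_uIcc hs') a (by simp)).deriv
  have h2 : ∫ s in a..b, (∫ r in a..s, g r) * deriv (fun s => ∫ r in a..s, g r) s =
      ∫ s in a..b, (∫ r in a..s, g r) * g s :=
    intervalIntegral.integral_congr_ae (h1.mono fun s hs h => by simp only [hs h])
  have h3 : ∫ s in a..b, deriv (fun s => ∫ r in a..s, g r) s * (∫ r in a..s, g r) =
      ∫ s in a..b, (∫ r in a..s, g r) * g s :=
    intervalIntegral.integral_congr_ae (h1.mono fun s hs h => by simp only [hs h, mul_comm])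
  rw [h2, h3] at h
  simp only [intervalIntegral.integral_same] at h
  linarith

section TameProcess

variable {Ω : Type*} {mΩ : MeasurableSpace Ω} {P : Measure Ω}
  {𝒢 : ℝ → MeasurableSpace Ω} {X Y N j : ℝ → Ω → ℝ}

/-- A jointly measurable, adapted (up to null sets), locally bounded process. -/
structure IsTame (P : Measure Ω) (𝒢 : ℝ → MeasurableSpace Ω) (X : ℝ → Ω → ℝ) : Prop where
  measurable : StronglyMeasurable (Function.uncurry X)
  adapted : ∀ t, AEStronglyMeasurable[𝒢 t] (X t) P
  bounded : ∀ T, ∃ B, 0 ≤ B ∧ ∀ t ω, |t| ≤ T → |X t ω| ≤ B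

theorem IsTame.mul (hX : IsTame P 𝒢 X) (hY : IsTame P 𝒢 Y) :
    IsTame P 𝒢 fun t ω => X t ω * Y t ω := by
  refine ⟨hX.1.mul hY.1, fun t => (hX.2 t).mul (hY.2 t), fun T => ?_⟩
  obtain ⟨B, hB0, hB⟩ := hX.3 T
  obtain ⟨C, hC0, hC⟩ := hY.3 T
  refine ⟨B * C, mul_nonneg hB0 hC0, fun t ω ht => ?_⟩
  rw [abs_mul]
  exact mul_le_mul (hB t ω ht) (hC t ω ht) (abs_nonneg _) hB0

theorem IsTame.sub (hX : IsTame P 𝒢 X) (hY : IsTame P 𝒢 Y) :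
    IsTame P 𝒢 fun t ω => X t ω - Y t ω := by
  refine ⟨hX.1.sub hY.1, fun t => (hX.2 t).sub (hY.2 t), fun T => ?_⟩
  obtain ⟨B, hB0, hB⟩ := hX.3 T
  obtain ⟨C, hC0, hC⟩ := hY.3 T
  exact ⟨B + C, add_nonneg hB0 hC0, fun t ω ht =>
    (abs_sub _ _).trans (add_le_add (hB t ω ht) (hC t ω ht))⟩

theorem IsTame.congr (hX : IsTame P 𝒢 X) (h : ∀ t ω, X t ω = Y t ω) :
    IsTame P 𝒢 Y := by
  rwa [show Y = X from funext fun t => funext fun ω => (h t ω).symm]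

theorem IsTame.stronglyMeasurable (hX : IsTame P 𝒢 X) (t : ℝ) :
    StronglyMeasurable (X t) := hX.1.comp_measurable measurable_prodMk_left

theorem IsTame.intervalIntegrable (hX : IsTame P 𝒢 X) (r t : ℝ) (ω : Ω) :
    IntervalIntegrable (fun s => X s ω) volume r t := by
  obtain ⟨B, -, hB⟩ := hX.3 (max |r| |t|)
  refine (intervalIntegrable_const (c := B)).mono_fun'
    (hX.1.comp_measurable measurable_prodMk_right).aestronglyMeasurable
    ((ae_restrict_iff' measurableSet_uIoc).2 (Eventually.of_forall fun s hs => hB s ω ?_))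
  rcases le_total r t with h | h
  · rw [uIoc_of_le h] at hs
    exact abs_le_max_abs_abs hs.1.le hs.2
  · rw [uIoc_of_ge h] at hs
    rw [max_comm]
    exact abs_le_max_abs_abs hs.1.le hs.2

theorem IsTame.continuous_integral (hX : IsTame P 𝒢 X) (ω : Ω) :
    Continuous fun t => ∫ s in (0 : ℝ)..t, X s ω :=
  intervalIntegral.continuous_primitive (fun r t => hX.intervalIntegrable r t ω) 0

/-- The process `∫_0^t X_s ds`, stopped at `0` for negative times. -/
def timeIntegral (X : ℝ → Ω → ℝ) (t : ℝ) (ω : Ω) : ℝ := ∫ s in Ioc 0 t, X s ω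

theorem timeIntegral_eq (X : ℝ → Ω → ℝ) {t : ℝ} (ht : 0 ≤ t) (ω : Ω) :
    timeIntegral X t ω = ∫ s in (0 : ℝ)..t, X s ω :=
  (intervalIntegral.integral_of_le ht).symm

theorem IsTame.timeIntegral_sub (hX : IsTame P 𝒢 X) {s t : ℝ} (hs : 0 ≤ s)
    (hst : s ≤ t) (ω : Ω) : timeIntegral X t ω - timeIntegral X s ω = ∫ r in s..t, X r ω := by
  rw [timeIntegral_eq X hs, timeIntegral_eq X (hs.trans hst),
    intervalIntegral.integral_interval_sub_left (hX.intervalIntegrable _ _ ω)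
      (hX.intervalIntegrable _ _ ω)]

theorem timeIntegral_mono (hX : IsTame P 𝒢 X) (h0 : ∀ t ω, 0 ≤ X t ω) {s t : ℝ≥0}
    (hst : s ≤ t) (ω : Ω) : KineticDiffusion.timeIntegral X s ω ≤ KineticDiffusion.timeIntegral X t ω := by
  rw [← sub_nonneg, hX.timeIntegral_sub s.coe_nonneg (NNReal.coe_le_coe.2 hst)]
  exact intervalIntegral.integral_nonneg (NNReal.coe_le_coe.2 hst) fun r _ => h0 r ω

theorem IsTame.continuous_timeIntegral (hX : IsTame P 𝒢 X) (ω : Ω) :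
    Continuous fun t : ℝ≥0 => KineticDiffusion.timeIntegral X t ω :=
  ((hX.continuous_integral ω).comp NNReal.continuous_coe).congr fun t =>
    (timeIntegral_eq X t.coe_nonneg ω).symm

variable [IsProbabilityMeasure P]

theorem IsTame.integrable (hX : IsTame P 𝒢 X) (t : ℝ) : Integrable (X t) P := by
  obtain ⟨B, -, hB⟩ := hX.3 |t|
  exact Integrable.of_bound (hX.stronglyMeasurable t).aestronglyMeasurable B
    (Eventually.of_forall fun ω => hB t ω le_rfl)

theorem IsTame.timeIntegral (hX : IsTame P 𝒢 X) (hle : ∀ t, 𝒢 t ≤ mΩ)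
    (hmono : Monotone 𝒢) : IsTame P 𝒢 (timeIntegral X) := by
  have hb : ∀ t, ∃ B, 0 ≤ B ∧ ∀ᵐ s ∂(volume.restrict (Ioc 0 t)), ∀ ω, ‖X s ω‖ ≤ B := fun t => by
    obtain ⟨B, hB0, hB⟩ := hX.3 t
    refine ⟨B, hB0, (ae_restrict_iff' measurableSet_Ioc).2
      (Eventually.of_forall fun s hs ω => hB s ω ?_)⟩
    rw [abs_of_pos hs.1]
    exact hs.2
  refine ⟨?_, fun t => ?_, fun T => ?_⟩
  · set A : Set ((ℝ × Ω) × ℝ) := {q | 0 < q.2 ∧ q.2 ≤ q.1.1} with hA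
    have hAm : MeasurableSet A :=
      (measurableSet_lt measurable_const measurable_snd).inter
        (measurableSet_le measurable_snd (measurable_fst.comp measurable_fst))
    have h2 : StronglyMeasurable fun q : (ℝ × Ω) × ℝ => A.indicator (fun q => X q.2 q.1.2) q :=
      (hX.1.comp_measurable (measurable_snd.prodMk (measurable_snd.comp measurable_fst))).indicator
        hAm
    have h3 := h2.integral_prod_right' (ν := (volume : Measure ℝ))
    have e : Function.uncurry (KineticDiffusion.timeIntegral X) = fun p : ℝ × Ω =>
        ∫ s, A.indicator (fun q => X q.2 q.1.2) (p, s) := by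
      funext p
      exact (integral_indicator (f := fun s => X s p.2) measurableSet_Ioc).symm
    rw [e]
    exact h3
  · obtain ⟨B, -, hB⟩ := hb t
    refine aestronglyMeasurable_integral (hle t) hX.1 hB
      ((ae_restrict_iff' measurableSet_Ioc).2 (Eventually.of_forall fun s hs => ?_))
    exact (hX.2 s).mono (hmono hs.2)
  · obtain ⟨B, hB0, hB⟩ := hX.3 T
    refine ⟨B * |T|, by positivity, fun t ω ht => ?_⟩
    have h1 : ∀ᵐ s ∂(volume.restrict (Ioc 0 t)), ‖X s ω‖ ≤ B :=
      (ae_restrict_iff' measurableSet_Ioc).2 (Eventually.of_forall fun s hs => hB s ω (by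
        rw [abs_of_pos hs.1]; exact hs.2.trans ((le_abs_self t).trans ht)))
    refine (norm_integral_le_of_norm_le_const h1).trans (mul_le_mul_of_nonneg_left ?_ hB0)
    simp only [Measure.real, Measure.restrict_apply_univ, Real.volume_Ioc, sub_zero]
    rw [ENNReal.toReal_ofReal', ]
    exact max_le ((le_abs_self t).trans (ht.trans (le_abs_self T))) (abs_nonneg T)

/-- `X` has centred increments over the past, for nonnegative times. -/
def HasCentredIncrements (P : Measure Ω) (𝒢 : ℝ → MeasurableSpace Ω) (X : ℝ → Ω → ℝ) : Prop :=
  ∀ s t, 0 ≤ s → s ≤ t → ∀ A, MeasurableSet[𝒢 s] A → ∫ ω in A, (X t ω - X s ω) ∂P = 0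

/-- Centred increments amount to a vanishing conditional expectation, which allows any bounded
factor measurable at time `s` up to null sets. -/
theorem HasCentredIncrements.setIntegral_mul (hN : HasCentredIncrements P 𝒢 N)
    (hNt : IsTame P 𝒢 N) (hle : ∀ t, 𝒢 t ≤ mΩ) {s t : ℝ} (hs : 0 ≤ s) (hst : s ≤ t)
    {Z : Ω → ℝ} {B : ℝ} (hZ : AEStronglyMeasurable[𝒢 s] Z P) (hZb : ∀ ω, |Z ω| ≤ B) {A : Set Ω}
    (hA : MeasurableSet[𝒢 s] A) : ∫ ω in A, Z ω * (N t ω - N s ω) ∂P = 0 := by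
  set D : Ω → ℝ := fun ω => N t ω - N s ω with hD
  have hDi : Integrable D P := (hNt.integrable t).sub (hNt.integrable s)
  have hc : P[D|𝒢 s] =ᵐ[P] 0 := by
    refine (ae_eq_condExp_of_forall_setIntegral_eq (hle s) hDi
      (fun _ _ _ => integrableOn_zero) (fun A hA _ => ?_)
      (@stronglyMeasurable_zero _ _ (𝒢 s) _ _).aestronglyMeasurable).symm
    rw [hN s t hs hst A hA]
    simp
  have hZA : AEStronglyMeasurable[𝒢 s] (A.indicator Z) P := by
    obtain ⟨Z', hZ', he⟩ := hZ
    exact ⟨A.indicator Z', hZ'.indicator hA, he.mono fun ω h => by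
      simp only [indicator, h]⟩
  have hZAb : ∀ ω, ‖A.indicator Z ω‖ ≤ B := fun ω =>
    (norm_indicator_le_norm_self _ _).trans (hZb ω)
  rw [← integral_indicator (hle s A hA)]
  have h := integral_mul_eq_zero_of_condExp (hle s) hZA hDi
    (hDi.bdd_mul (c := B) (hZA.mono (hle s)) (Eventually.of_forall hZAb)) hc
  rw [← h]
  congr 1
  funext ω
  by_cases hω : ω ∈ A <;> simp [hω, hD]

/-- Integration by parts: `N J - ∫ N dJ` has centred increments if `N` has, for `J = ∫ j`. -/
theorem HasCentredIncrements.mul_timeIntegral (hN : HasCentredIncrements P 𝒢 N)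
    (hNt : IsTame P 𝒢 N) (hj : IsTame P 𝒢 j) (hle : ∀ t, 𝒢 t ≤ mΩ)
    (hmono : Monotone 𝒢) : HasCentredIncrements P 𝒢 fun t ω =>
      N t ω * timeIntegral j t ω - timeIntegral (fun s ω => N s ω * j s ω) t ω := by
  intro s t hs hst A hA
  have hJ := hj.timeIntegral hle hmono
  have hNj := hNt.mul hj
  have habs : ∀ r, s ≤ r → r ≤ t → |r| ≤ t := fun r h1 h2 => by
    rw [abs_of_nonneg (hs.trans h1)]; exact h2
  -- Each term on the right pairs a future increment of `N` with a factor known at its starting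
  -- time: `J` at `s` in the first, `j` at `r` in the second.
  have e : ∀ ω, (N t ω * timeIntegral j t ω - timeIntegral (fun s ω => N s ω * j s ω) t ω) -
      (N s ω * timeIntegral j s ω - timeIntegral (fun s ω => N s ω * j s ω) s ω) =
      timeIntegral j s ω * (N t ω - N s ω) + ∫ r in s..t, j r ω * (N t ω - N r ω) := by
    intro ω
    have h1 : ∫ r in s..t, j r ω * (N t ω - N r ω) =
        N t ω * (∫ r in s..t, j r ω) - ∫ r in s..t, N r ω * j r ω := by
      rw [← intervalIntegral.integral_const_mul, ← intervalIntegral.integral_sub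
        ((hj.intervalIntegrable s t ω).const_mul _) (hNj.intervalIntegrable s t ω)]
      congr 1
      funext r
      ring
    rw [h1, ← hj.timeIntegral_sub hs hst, ← hNj.timeIntegral_sub hs hst]
    ring
  obtain ⟨B, hB0, hB⟩ := hNt.3 t
  obtain ⟨C, hC0, hC⟩ := hj.3 t
  have hm : StronglyMeasurable (Function.uncurry fun r ω => j r ω * (N t ω - N r ω)) :=
    hj.1.mul (((hNt.stronglyMeasurable t).comp_measurable measurable_snd).sub hNt.1)
  have hb : ∀ r ω, s ≤ r → r ≤ t → |j r ω * (N t ω - N r ω)| ≤ C * (B + B) := fun r ω h1 h2 => by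
    rw [abs_mul]
    exact mul_le_mul (hC r ω (habs r h1 h2)) ((abs_sub _ _).trans
      (add_le_add (hB t ω (habs t hst le_rfl)) (hB r ω (habs r h1 h2)))) (abs_nonneg _) hC0
  simp only [e]
  rw [integral_add, setIntegral_intervalIntegral_swap hm hst hb]
  · obtain ⟨B', -, hB'⟩ := hJ.3 |s|
    rw [hN.setIntegral_mul hNt hle hs hst (hJ.2 s) (fun ω => hB' s ω le_rfl) hA, zero_add]
    refine intervalIntegral.integral_zero_ae (Eventually.of_forall fun r hr => ?_)
    rw [uIoc_of_le hst] at hr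
    exact hN.setIntegral_mul hNt hle (hs.trans hr.1.le) hr.2 (hj.2 r)
      (fun ω => hC r ω (habs r hr.1.le hr.2)) (hmono hr.1.le A hA)
  · obtain ⟨B', -, hB'⟩ := hJ.3 |s|
    exact (((hNt.integrable t).sub (hNt.integrable s)).bdd_mul (c := B')
      (hJ.stronglyMeasurable s).aestronglyMeasurable
      (Eventually.of_forall fun ω => hB' s ω le_rfl)).integrableOn
  · refine Integrable.integrableOn ?_
    simp only [intervalIntegral.integral_of_le hst]
    refine Integrable.of_bound (C := C * (B + B) * (volume.restrict (Ioc s t)).real univ)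
      hm.integral_prod_left.aestronglyMeasurable (Eventually.of_forall fun ω => ?_)
    exact norm_integral_le_of_norm_le_const ((ae_restrict_iff' measurableSet_Ioc).2
      (Eventually.of_forall fun r hr => hb r ω hr.1.le hr.2))

/-- The bracket of `X - ∫ j`, if `X² - ∫ k` also has centred increments. -/
theorem HasCentredIncrements.sq_sub {k : ℝ → Ω → ℝ} (hle : ∀ t, 𝒢 t ≤ mΩ) (hmono : Monotone 𝒢)
    (hX : IsTame P 𝒢 X) (hj : IsTame P 𝒢 j) (hk : IsTame P 𝒢 k)
    (h1 : HasCentredIncrements P 𝒢 fun t ω => X t ω - timeIntegral j t ω)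
    (h2 : HasCentredIncrements P 𝒢 fun t ω => X t ω ^ 2 - timeIntegral k t ω) :
    HasCentredIncrements P 𝒢 fun t ω => (X t ω - timeIntegral j t ω) ^ 2 -
      timeIntegral (fun s ω => k s ω - 2 * X s ω * j s ω) t ω := by
  have hJ := hj.timeIntegral hle hmono
  have hN := hX.sub hJ
  have h3 := h1.mul_timeIntegral hN hj hle hmono
  have hXj := hX.mul hj
  have hJj := hJ.mul hj
  have hNj := hN.mul hj
  have hsq : ∀ t ω, 0 ≤ t → timeIntegral (fun s ω => timeIntegral j s ω * j s ω) t ω =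
      timeIntegral j t ω ^ 2 / 2 := by
    intro t ω ht
    rw [timeIntegral_eq _ ht, timeIntegral_eq _ ht,
      ← integral_mul_primitive (hj.intervalIntegrable 0 t ω)]
    refine intervalIntegral.integral_congr fun s hs => ?_
    rw [uIcc_of_le ht] at hs
    simp only [timeIntegral_eq _ hs.1]
  -- With `N = X - J`, expanding `∫ N dJ` and using `∫ J dJ = J²/2` leaves a combination of two
  -- processes with centred increments.
  have e : ∀ t ω, 0 ≤ t → (X t ω - timeIntegral j t ω) ^ 2 -
      timeIntegral (fun s ω => k s ω - 2 * X s ω * j s ω) t ω =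
      (X t ω ^ 2 - timeIntegral k t ω) - 2 * ((X t ω - timeIntegral j t ω) * timeIntegral j t ω -
        timeIntegral (fun s ω => (X s ω - timeIntegral j s ω) * j s ω) t ω) := by
    intro t ω ht
    have a1 : timeIntegral (fun s ω => k s ω - 2 * X s ω * j s ω) t ω =
        timeIntegral k t ω - 2 * timeIntegral (fun s ω => X s ω * j s ω) t ω := by
      rw [timeIntegral_eq _ ht, timeIntegral_eq _ ht, timeIntegral_eq _ ht,
        ← intervalIntegral.integral_const_mul, ← intervalIntegral.integral_sub
        (hk.intervalIntegrable 0 t ω) ((hXj.intervalIntegrable 0 t ω).const_mul 2)]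
      congr 1
      funext r
      ring
    have a2 : timeIntegral (fun s ω => (X s ω - timeIntegral j s ω) * j s ω) t ω =
        timeIntegral (fun s ω => X s ω * j s ω) t ω -
        timeIntegral (fun s ω => timeIntegral j s ω * j s ω) t ω := by
      rw [timeIntegral_eq _ ht, timeIntegral_eq _ ht, timeIntegral_eq _ ht,
        ← intervalIntegral.integral_sub (hXj.intervalIntegrable 0 t ω)
          (hJj.intervalIntegrable 0 t ω)]
      congr 1
      funext r
      ring
    rw [a1, a2, hsq t ω ht]
    ring
  intro s t hs hst A hA
  have hQ := (hX.mul hX).sub (hk.timeIntegral hle hmono)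
  have hR := (hN.mul hJ).sub (hNj.timeIntegral hle hmono)
  have i1 := ((hQ.integrable t).sub (hQ.integrable s)).integrableOn (s := A)
  have i2 := (((hR.integrable t).sub (hR.integrable s)).const_mul 2).integrableOn (s := A)
  have h4 := integral_sub i1 i2
  rw [integral_const_mul] at h4
  have h5 := h2 s t hs hst A hA
  have h6 := h3 s t hs hst A hA
  simp only [e t _ (hs.trans hst), e s _ hs]
  simp only [pow_two] at h5 ⊢
  simp only [Pi.sub_apply] at h4
  rw [h5, h6, mul_zero, sub_zero] at h4
  rw [← h4]
  refine congrArg _ ?_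
  funext ω
  ring

end TameProcess

end KineticDiffusion
-- Continuity and local boundedness of the generator and of the carré du champ.
namespace KineticDiffusion

section Observable

variable {H E X : Type*} [NormedAddCommGroup H] [TopologicalSpace E] [NormedAddCommGroup X]

/-- A continuous function on `H × E`, bounded on sets which are bounded in `H`. -/
structure IsObservable (F : H → E → X) : Prop where
  continuous : Continuous fun p : H × E => F p.1 p.2
  bounded : ∀ R, ∃ B, 0 ≤ B ∧ ∀ u n, ‖u‖ ≤ R → ‖F u n‖ ≤ B

theorem IsObservable.neg {F : H → E → X} (hF : IsObservable F) :
    IsObservable fun u n => -F u n :=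
  ⟨hF.1.neg, fun R => by simpa only [norm_neg] using hF.2 R⟩

theorem IsObservable.add {F G : H → E → X} (hF : IsObservable F) (hG : IsObservable G) :
    IsObservable fun u n => F u n + G u n := by
  refine ⟨hF.1.add hG.1, fun R => ?_⟩
  obtain ⟨B, hB0, hB⟩ := hF.2 R
  obtain ⟨C, hC0, hC⟩ := hG.2 R
  exact ⟨B + C, add_nonneg hB0 hC0, fun u n hu =>
    (norm_add_le _ _).trans (add_le_add (hB u n hu) (hC u n hu))⟩

theorem IsObservable.mul {F G : H → E → ℝ} (hF : IsObservable F) (hG : IsObservable G) :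
    IsObservable fun u n => F u n * G u n := by
  refine ⟨hF.1.mul hG.1, fun R => ?_⟩
  obtain ⟨B, hB0, hB⟩ := hF.2 R
  obtain ⟨C, hC0, hC⟩ := hG.2 R
  exact ⟨B * C, mul_nonneg hB0 hC0, fun u n hu =>
    (norm_mul_le _ _).trans (mul_le_mul (hB u n hu) (hC u n hu) (norm_nonneg _) hB0)⟩

theorem IsObservable.const (c : X) : IsObservable fun (_ : H) (_ : E) => c :=
  ⟨continuous_const, fun _ => ⟨‖c‖, norm_nonneg _, fun _ _ _ => le_rfl⟩⟩

theorem IsObservable.inner {Y : Type*} [NormedAddCommGroup Y] [InnerProductSpace ℝ Y]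
    {F G : H → E → Y} (hF : IsObservable F) (hG : IsObservable G) :
    IsObservable fun u n => inner ℝ (F u n) (G u n) := by
  refine ⟨hF.1.inner (𝕜 := ℝ) hG.1, fun R => ?_⟩
  obtain ⟨B, hB0, hB⟩ := hF.2 R
  obtain ⟨C, hC0, hC⟩ := hG.2 R
  exact ⟨B * C, mul_nonneg hB0 hC0, fun u n hu =>
    (norm_inner_le_norm _ _).trans (mul_le_mul (hB u n hu) (hC u n hu) (norm_nonneg _) hB0)⟩

theorem IsObservable.clm [NormedSpace ℝ H] [NormedSpace ℝ X] (L : H →L[ℝ] X) :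
    IsObservable fun (u : H) (_ : E) => L u := by
  refine ⟨L.continuous.comp continuous_fst, fun R => ⟨‖L‖ * |R|, by positivity, fun u n hu => ?_⟩⟩
  exact (L.le_opNorm u).trans (by gcongr; exact hu.trans (le_abs_self R))

end Observable

section Generator

variable {V : Type*} [MeasurableSpace V] {d : ℕ} {μ : Measure V} [IsProbabilityMeasure μ]
  {a : Lp (EuclideanSpace ℝ (Fin d)) ⊤ μ} {ε : ℝ} {E : Set (W1inf d)} {Pt : ℝ≥0 → Kernel E E}
  {DM : Set (E →ᵇ ℝ)} {Ψ : L2H1 d μ → E → ℝ}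

theorem isObservable_mulNoise (hE : Bornology.IsBounded E) :
    IsObservable fun (u : L2H1 d μ) (n : E) => mulNoise (toL2 u) (n : W1inf d) := by
  have hc : Continuous fun p : L2H1 d μ × E => noiseH (p.2 : W1inf d) p.1 :=
    continuous_uncurry_comp (fun (n : W1inf d) (u : L2H1 d μ) => noiseH n u) continuous_noiseH
      (continuous_subtype_val.comp continuous_snd) continuous_fst
  refine ⟨toL2.continuous.comp hc, fun R => ?_⟩
  obtain ⟨C, hC⟩ := hE.exists_norm_le
  refine ⟨(1 + 2 * d) * |C| * |R|, by positivity, fun u n hu => ?_⟩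
  have h1 : ‖(n : W1inf d)‖ ≤ |C| := (hC _ n.2).trans (le_abs_self C)
  have h2 : ‖u‖ ≤ |R| := hu.trans (le_abs_self R)
  have h3 : ‖mulNoise (toL2 u) (n : W1inf d)‖ ≤ ‖noiseH (n : W1inf d) u‖ :=
    norm_toL2_le (noiseH (n : W1inf d) u)
  refine h3.trans ((norm_noiseH_le _ u).trans ?_)
  exact mul_le_mul (mul_le_mul_of_nonneg_left h1 (by positivity)) h2 (norm_nonneg _) (by positivity)

theorem isObservable_advection (a : Lp (EuclideanSpace ℝ (Fin d)) ⊤ μ) :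
    IsObservable fun (u : L2H1 d μ) (_ : E) => advection a u := by
  simp only [← advectionL_apply]
  exact IsObservable.clm (advectionL a)

theorem isObservable_collision : IsObservable fun (u : L2H1 d μ) (_ : E) => collision (toL2 u) :=
  IsObservable.clm (collisionL.comp (toL2 : L2H1 d μ →L[ℝ] L2xv d μ))

theorem IsGoodTestFunction.isObservable (hΨ : IsGoodTestFunction Pt DM Ψ)
    (hE : Bornology.IsBounded E) : IsObservable Ψ := by
  refine ⟨hΨ.continuous hE, fun R => ?_⟩
  obtain ⟨B, hB0, hB⟩ := hΨ.exists_bound hE R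
  exact ⟨B, hB0, fun u n hu => (hB u n hu).1⟩

theorem IsGoodTestFunction.isObservable_gradient (hΨ : IsGoodTestFunction Pt DM Ψ)
    (hE : Bornology.IsBounded E) : IsObservable (gradient Ψ) := by
  refine ⟨hΨ.continuous_gradient, fun R => ?_⟩
  obtain ⟨B, hB0, hB⟩ := hΨ.exists_bound hE R
  exact ⟨B, hB0, fun u n hu => (hB u n hu).2.1⟩

theorem IsGoodTestFunction.isObservable_markovGenerator (hΨ : IsGoodTestFunction Pt DM Ψ)
    (hE : Bornology.IsBounded E) : IsObservable fun u => markovGenerator Pt (Ψ u) := by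
  refine ⟨hΨ.continuous_generator, fun R => ?_⟩
  obtain ⟨B, hB0, hB⟩ := hΨ.exists_bound hE R
  exact ⟨B, hB0, fun u n hu => (hB u n hu).2.2⟩

theorem IsGoodTestFunction.isObservable_generator (hΨ : IsGoodTestFunction Pt DM Ψ)
    (hE : Bornology.IsBounded E) (a : Lp (EuclideanSpace ℝ (Fin d)) ⊤ μ) (ε : ℝ) :
    IsObservable (generator a Pt ε Ψ) := by
  have hg := hΨ.isObservable_gradient hE
  have h1 := ((isObservable_advection a).inner hg).neg.add ((isObservable_mulNoise hE).inner hg)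
  have h2 := (isObservable_collision.inner hg).add (hΨ.isObservable_markovGenerator hE)
  exact ((IsObservable.const ε⁻¹).mul h1).add ((IsObservable.const (ε ^ 2)⁻¹).mul h2)

theorem isObservable_carreDuChamp (hΨ : IsGoodTestFunction Pt DM Ψ)
    (hΨ2 : IsGoodTestFunction Pt DM fun u n => Ψ u n ^ 2) (hE : Bornology.IsBounded E)
    (a : Lp (EuclideanSpace ℝ (Fin d)) ⊤ μ) (ε : ℝ) : IsObservable (carreDuChamp a Pt ε Ψ) := by
  have h1 := hΨ2.isObservable_generator hE a ε
  have h2 := ((IsObservable.const (2 : ℝ)).mul (hΨ.isObservable hE)).mul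
    (hΨ.isObservable_generator hE a ε)
  have e : carreDuChamp a Pt ε Ψ = fun u n =>
      generator a Pt ε (fun u' n' => Ψ u' n' ^ 2) u n + -(2 * Ψ u n * generator a Pt ε Ψ u n) := by
    funext u n
    exact sub_eq_add_neg _ _
  rw [e]
  exact h1.add h2.neg

/-! ### Positivity of the carré du champ -/

/-- The differential determines a gradient on the range of `toL2` and, by continuity, on its
closure. This suffices because the three vectors paired with the gradient in `𝓛^ε` lie there, so no
density statement is needed. -/
theorem HasL2Gradient.inner_eq {φ : L2H1 d μ → ℝ} {g g' : L2xv d μ} {u : L2H1 d μ}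
    (h : HasL2Gradient φ g u) (h' : HasL2Gradient φ g' u) {f : L2xv d μ}
    (hf : f ∈ closure (range (toL2 : L2H1 d μ → L2xv d μ))) : inner ℝ f g = inner ℝ f g' := by
  refine closure_minimal (s := range (toL2 : L2H1 d μ → L2xv d μ))
    (t := {f | inner ℝ f g = inner ℝ f g'}) ?_ (isClosed_eq (by fun_prop) (by fun_prop)) hf
  rintro _ ⟨w, rfl⟩
  have e := DFunLike.congr_fun (HasFDerivAt.unique h h') w
  change inner ℝ (toL2 w) g = inner ℝ (toL2 w) g'
  rw [real_inner_comm, real_inner_comm g']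
  exact e

theorem advection_mem_closure (a : Lp (EuclideanSpace ℝ (Fin d)) ⊤ μ) (u : L2H1 d μ) :
    advection a u ∈ closure (range (toL2 : L2H1 d μ → L2xv d μ)) := by
  refine mem_closure_of_tendsto (tendsto_transport_slope a u) (Eventually.of_forall fun τ =>
    ⟨τ⁻¹ • (transportH a τ u - u), ?_⟩)
  rw [toL2.map_smul, toL2.map_sub, toL2_transportH]

/-- The terms of `𝓛^ε` involving the gradient obey Leibniz's rule, `D(Ψ²) = 2Ψ DΨ`, and cancel; only
the Markov part survives. -/
theorem carreDuChamp_eq (hΨ : IsGoodTestFunction Pt DM Ψ)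
    (hΨ2 : IsGoodTestFunction Pt DM fun u n => Ψ u n ^ 2) (u : L2H1 d μ) (n : E) :
    carreDuChamp a Pt ε Ψ u n = (ε ^ 2)⁻¹ * (markovGenerator Pt (fun n => Ψ u n ^ 2) n -
      2 * Ψ u n * markovGenerator Pt (Ψ u) n) := by
  have h1 := hΨ2.hasL2Gradient u n
  have h2 : HasL2Gradient (fun u => Ψ u n ^ 2) ((2 * Ψ u n) • gradient Ψ u n) u := by
    have := HasFDerivAt.pow (hΨ.hasL2Gradient u n) 2
    refine this.congr_fderiv ?_
    ext w
    simp
  have e := fun {f : L2xv d μ} (hf : f ∈ closure (range (toL2 : L2H1 d μ → L2xv d μ))) =>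
    (h1.inner_eq h2 hf).trans (inner_smul_right _ _ _)
  have e1 := e (advection_mem_closure a u)
  have e2 := e (f := mulNoise (toL2 u) n) (subset_closure ⟨noiseH (n : W1inf d) u, rfl⟩)
  have e3 := e (subset_closure ⟨collisionH u, toL2_collisionH u⟩)
  simp only [carreDuChamp, generator, generatorA, generatorL]
  rw [e1, e2, e3]
  ring

theorem InGeneratorDomain.tendsto {ψ : E → ℝ} (h : InGeneratorDomain Pt ψ) (n : E) :
    Tendsto (semigroupQuotient Pt ψ n) (𝓝[>] 0) (𝓝 (markovGenerator Pt ψ n)) :=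
  tendsto_nhds_limUnder (h n)

/-- Before the limit the expression is `t⁻¹ ∫ (ψ(y) - ψ(n))² P_t(n, dy)`, as `P_t` has mass one. -/
theorem markovGenerator_sq_nonneg [∀ t, IsMarkovKernel (Pt t)] {ψ : E → ℝ} (hψc : Continuous ψ)
    {B : ℝ} (hB : ∀ n, |ψ n| ≤ B) (h1 : InGeneratorDomain Pt ψ)
    (h2 : InGeneratorDomain Pt fun n => ψ n ^ 2) (n : E) :
    0 ≤ markovGenerator Pt (fun n => ψ n ^ 2) n - 2 * ψ n * markovGenerator Pt ψ n := by
  have hlim := (h2.tendsto n).sub ((h1.tendsto n).const_mul (2 * ψ n))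
  refine ge_of_tendsto' hlim fun t => ?_
  have i1 : Integrable ψ (Pt t n) := Integrable.of_bound hψc.aestronglyMeasurable B
    (Eventually.of_forall hB)
  have i2 : Integrable (fun y => ψ y ^ 2) (Pt t n) :=
    Integrable.of_bound (hψc.pow 2).aestronglyMeasurable (B ^ 2) (Eventually.of_forall fun y => by
      rw [Real.norm_eq_abs, abs_pow]
      exact pow_le_pow_left₀ (abs_nonneg _) (hB y) 2)
  have e : ∫ y, (ψ y - ψ n) ^ 2 ∂(Pt t n) =
      (∫ y, ψ y ^ 2 ∂(Pt t n)) - 2 * ψ n * (∫ y, ψ y ∂(Pt t n)) + ψ n ^ 2 := by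
    have : ∀ y, (ψ y - ψ n) ^ 2 = ψ y ^ 2 - 2 * ψ n * ψ y + ψ n ^ 2 := fun y => by ring
    have i3 : Integrable (fun y => 2 * ψ n * ψ y) (Pt t n) := i1.const_mul _
    have i4 : Integrable (fun y => ψ y ^ 2 - 2 * ψ n * ψ y) (Pt t n) := i2.sub i3
    simp only [this]
    rw [integral_add i4 (integrable_const _), integral_sub i2 i3, integral_const_mul]
    simp
  have h0 : 0 ≤ (∫ y, (ψ y - ψ n) ^ 2 ∂(Pt t n)) / (t : ℝ) :=
    div_nonneg (integral_nonneg fun y => sq_nonneg _) t.2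
  rw [e] at h0
  refine h0.trans_eq ?_
  rw [semigroupQuotient, semigroupQuotient]
  ring

theorem carreDuChamp_nonneg {Ω : Type*} {mΩ : MeasurableSpace Ω} {P : Measure Ω}
    {ℱ : Filtration ℝ mΩ} {m : ℝ → Ω → E} (hm : IsDrivingProcess P ℱ E m Pt DM)
    (hΨ : IsGoodTestFunction Pt DM Ψ) (hΨ2 : IsGoodTestFunction Pt DM fun u n => Ψ u n ^ 2)
    (u : L2H1 d μ) (n : E) : 0 ≤ carreDuChamp a Pt ε Ψ u n := by
  obtain ⟨ψ, hψ, he⟩ := hΨ.mem_domain u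
  obtain ⟨ψ₂, hψ₂, he₂⟩ := hΨ2.mem_domain u
  have h1 := hm.generator_wellDefined ψ hψ
  have h2 := hm.generator_wellDefined ψ₂ hψ₂
  rw [he] at h1
  rw [he₂] at h2
  have := hm.semigroup_markov
  rw [carreDuChamp_eq hΨ hΨ2]
  exact mul_nonneg (by positivity) (markovGenerator_sq_nonneg (he ▸ ψ.continuous) (B := ‖ψ‖)
    (fun n => he ▸ ψ.norm_coe_le_norm n) h1 h2 n)

end Generator

end KineticDiffusion
-- Continuity of paths, and transfer to the given solution.
namespace KineticDiffusion

/-- For `y` in `c` close to `x t`, the Lipschitz bound replaces `x s` and `x t` by `y`, and the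
slice at `y` is continuous. With `c` countable, almost sure statements hold for all slices at once.
-/
theorem continuous_of_dense_slices {T H : Type*} [TopologicalSpace T] [NormedAddCommGroup H]
    {F : H → T → ℝ} {x : T → H} (hx : Continuous x) {c : Set H} (hc : range x ⊆ closure c)
    (hF : ∀ y ∈ c, Continuous (F y))
    (hL : ∀ R, ∃ B, 0 ≤ B ∧ ∀ u w s, ‖u‖ ≤ R → ‖w‖ ≤ R → |F w s - F u s| ≤ B * ‖w - u‖) :
    Continuous fun s => F (x s) s := by
  refine continuous_iff_continuousAt.2 fun t => Metric.continuousAt_iff'.2 fun δ hδ => ?_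
  obtain ⟨B, hB0, hB⟩ := hL (‖x t‖ + 1)
  -- The three errors are at most `2Br ≤ δ/2`, less than `δ/4`, and at most `Br ≤ δ/4`; `r ≤ 1`
  -- keeps the points in the ball of radius `‖x t‖ + 1`.
  set r := min 1 (δ / (4 * (B + 1))) with hr
  have hr0 : 0 < r := lt_min one_pos (by positivity)
  have hBr : B * r ≤ δ / 4 := by
    have h1 : r ≤ δ / (4 * (B + 1)) := min_le_right _ _
    have h2 : (B + 1) * (δ / (4 * (B + 1))) = δ / 4 := by
      field_simp
    nlinarith
  obtain ⟨y, hy, hyt⟩ := Metric.mem_closure_iff.1 (hc ⟨t, rfl⟩) r hr0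
  rw [dist_eq_norm] at hyt
  have hyR : ‖y‖ ≤ ‖x t‖ + 1 := by
    have h1 : ‖y‖ ≤ ‖x t‖ + ‖x t - y‖ := by
      simpa using norm_sub_le (x t) (x t - y)
    have h2 : r ≤ 1 := min_le_left _ _
    linarith
  have h1 : ∀ᶠ s in 𝓝 t, ‖x s - x t‖ < r := by
    simpa only [dist_eq_norm] using Metric.continuousAt_iff'.1 hx.continuousAt r hr0
  have h2 : ∀ᶠ s in 𝓝 t, |F y s - F y t| < δ / 4 :=
    Metric.continuousAt_iff'.1 (hF y hy).continuousAt (δ / 4) (by positivity)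
  filter_upwards [h1, h2] with s hs1 hs2
  have hxs : ‖x s‖ ≤ ‖x t‖ + 1 := by
    have h1 : ‖x s‖ ≤ ‖x t‖ + ‖x s - x t‖ := by
      simpa using norm_add_le (x t) (x s - x t)
    have h2 : r ≤ 1 := min_le_left _ _
    linarith
  have hsy : ‖x s - y‖ ≤ 2 * r := by
    have : ‖x s - y‖ ≤ ‖x s - x t‖ + ‖x t - y‖ := norm_sub_le_norm_sub_add_norm_sub _ _ _
    linarith
  have e1 := (hB y (x s) s hyR hxs).trans (mul_le_mul_of_nonneg_left hsy hB0)
  have e2 := (hB y (x t) t hyR (le_add_of_nonneg_right zero_le_one)).trans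
    (mul_le_mul_of_nonneg_left hyt.le hB0)
  rw [Real.dist_eq, abs_lt]
  rw [abs_le] at e1 e2
  rw [abs_lt] at hs2
  constructor <;> linarith [e1.1, e1.2, e2.1, e2.2, hs2.1, hs2.2]

section SolutionProcess

variable {V : Type*} [MeasurableSpace V] {d : ℕ} {μ : Measure V} [IsProbabilityMeasure μ]
  {a : Lp (EuclideanSpace ℝ (Fin d)) ⊤ μ} {ε : ℝ}
  {Ω : Type*} {mΩ : MeasurableSpace Ω} {P : Measure Ω}
  {ℱ : Filtration ℝ mΩ} {E : Set (W1inf d)} {m : ℝ → Ω → E} {Pt : ℝ≥0 → Kernel E E}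
  {DM : Set (E →ᵇ ℝ)} {Ψ F : L2H1 d μ → E → ℝ} {u₀ : L2H1 d μ}

/-- An observable of the solution of the kinetic equation and of the noise. -/
def alongH (a : Lp (EuclideanSpace ℝ (Fin d)) ⊤ μ) (m : ℝ → Ω → E) (ε : ℝ) (u₀ : L2H1 d μ)
    (F : L2H1 d μ → E → ℝ) (t : ℝ) (ω : Ω) : ℝ :=
  F (solH a ε (noiseW m ε) u₀ t ω) (noise m ε t ω)

/-- `Ψ(u, m^ε)` is a continuous martingale plus a time integral, after a change of time. The
exceptional null set depends on `u`. -/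
theorem ae_continuous_slice (hm : IsDrivingProcess P ℱ E m Pt DM)
    (hΨ : IsGoodTestFunction Pt DM Ψ) (ε : ℝ) (u : L2H1 d μ) :
    ∀ᵐ ω ∂P, Continuous fun t : ℝ≥0 => Ψ u (noise m ε t ω) := by
  obtain ⟨ψ, hψ, he⟩ := hΨ.mem_domain u
  obtain ⟨B, -, hB⟩ := hΨ.exists_bound hm.bounded ‖u‖
  filter_upwards [(hm.generator_martingale ψ hψ).continuous_paths] with ω hω
  have hc : Continuous (markovGenerator Pt (Ψ u)) :=
    continuous_uncurry_comp (fun u n => markovGenerator Pt (Ψ u) n) hΨ.continuous_generator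
      continuous_const continuous_id
  have hmω : Measurable fun s => m s ω := hm.measurable.comp measurable_prodMk_right
  have hi : ∀ r t, IntervalIntegrable (fun s => markovGenerator Pt ψ (m s ω)) volume r t := by
    intro r t
    rw [he]
    exact (intervalIntegrable_const (c := B)).mono_fun' (hc.measurable.comp hmω).aestronglyMeasurable
      (Eventually.of_forall fun s => (hB u (m s ω) le_rfl).2.2)
  have h1 := hω.add ((intervalIntegral.continuous_primitive hi 0).comp NNReal.continuous_coe)
  have h2 : Continuous fun t : ℝ≥0 => ψ (m t ω) := by
    refine h1.congr fun t => ?_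
    simp
  have h3 : Continuous fun t : ℝ≥0 => (⟨(t : ℝ) / ε ^ 2, by positivity⟩ : ℝ≥0) :=
    (NNReal.continuous_coe.div_const _).subtype_mk _
  have h4 := h2.comp h3
  rw [he] at h4
  exact h4

/-- The solution takes its values in the closure of one countable set, so countably many of the null
sets of `ae_continuous_slice` suffice. -/
theorem ae_continuous_alongH (hm : IsDrivingProcess P ℱ E m Pt DM)
    (hΨ : IsGoodTestFunction Pt DM Ψ) :
    ∀ᵐ ω ∂P, Continuous fun t : ℝ≥0 => alongH a m ε u₀ Ψ t ω := by
  obtain ⟨K, hK0, hK, -⟩ := exists_norm_drift_le hm.bounded m ε μ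
  have hM := measurable_noiseW hm ε
  obtain ⟨c, hc, hcr⟩ :=
    (stronglyMeasurable_solH (u₀ := u₀) (a := a) hM hK0 hK).isSeparable_range
  have h := (ae_ball_iff hc).2 fun u (_ : u ∈ c) => ae_continuous_slice hm hΨ ε u
  filter_upwards [h] with ω hω
  refine continuous_of_dense_slices (F := fun u (t : ℝ≥0) => Ψ u (noise m ε t ω))
    (x := fun t : ℝ≥0 => solH a ε (noiseW m ε) u₀ t ω)
    ((continuous_solH hM hK0 hK ω).comp NNReal.continuous_coe) (c := c) ?_ hω fun R => ?_
  · rintro _ ⟨t, rfl⟩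
    exact hcr ⟨((t : ℝ), ω), rfl⟩
  · obtain ⟨B, hB0, hB⟩ := hΨ.exists_bound hm.bounded R
    exact ⟨B, hB0, fun u w s hu hw => hΨ.abs_sub_le hB hu hw _⟩

theorem ae_eq_toL2_solH (hm : IsDrivingProcess P ℱ E m Pt DM) {f : ℝ → Ω → L2xv d μ}
    (hf : IsSolution P a m ε (toL2 u₀) f) :
    ∀ᵐ ω ∂P, ∀ t : ℝ, 0 ≤ t → f t ω = toL2 (solH a ε (noiseW m ε) u₀ t ω) := by
  obtain ⟨K, hK0, hK, hKL⟩ := exists_norm_drift_le hm.bounded m ε μ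
  filter_upwards [hf] with ω hω t ht
  exact eq_toL2_solH (measurable_noiseW hm ε) hK0 hK hKL ω hω.1 hω.2 ht

theorem ae_along_eq (hm : IsDrivingProcess P ℱ E m Pt DM) {f : ℝ → Ω → L2xv d μ}
    (hf : IsSolution P a m ε (toL2 u₀) f) : ∀ᵐ ω ∂P, ∀ (F : L2H1 d μ → E → ℝ) (t : ℝ), 0 ≤ t →
      along m ε f F t ω = alongH a m ε u₀ F t ω := by
  filter_upwards [ae_eq_toL2_solH hm hf] with ω hω F t ht
  exact along_eq F (hω t ht)

theorem ae_integral_along_eq (hm : IsDrivingProcess P ℱ E m Pt DM) {f : ℝ → Ω → L2xv d μ}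
    (hf : IsSolution P a m ε (toL2 u₀) f) : ∀ᵐ ω ∂P, ∀ (F : L2H1 d μ → E → ℝ) (t : ℝ≥0),
      ∫ s in (0 : ℝ)..t, along m ε f F s ω = timeIntegral (alongH a m ε u₀ F) t ω := by
  filter_upwards [ae_along_eq hm hf] with ω hω F t
  rw [timeIntegral_eq _ t.coe_nonneg]
  refine intervalIntegral.integral_congr fun s hs => hω F s ?_
  rw [uIcc_of_le t.coe_nonneg] at hs
  exact hs.1

theorem monotone_scaled (ℱ : Filtration ℝ mΩ) (ε : ℝ) : Monotone fun t : ℝ => ℱ (t / ε ^ 2) :=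
  fun _ _ hst => ℱ.mono (div_le_div_of_nonneg_right hst (sq_nonneg ε))

variable [IsProbabilityMeasure P]

theorem IsObservable.isTame (hF : IsObservable F) (hm : IsDrivingProcess P ℱ E m Pt DM) :
    IsTame P (fun t => ℱ (t / ε ^ 2)) (alongH a m ε u₀ F) := by
  obtain ⟨K, hK0, hK, -⟩ := exists_norm_drift_le hm.bounded m ε μ
  have hM := measurable_noiseW hm ε
  refine ⟨stronglyMeasurable_comp₂ (F := F) hF.1 (stronglyMeasurable_solH hM hK0 hK)
      (measurable_noise hm ε),
    fun t => aestronglyMeasurable_comp₂ (F := F) hF.1 (aestronglyMeasurable_solH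
      (𝒢 := fun t => ℱ (t / ε ^ 2)) (fun t => ℱ.le _) (monotone_scaled ℱ ε) hM
      (fun t => measurable_subtype_coe.comp (hm.adapted _)) hK0 hK t) (hm.adapted _), fun T => ?_⟩
  obtain ⟨B, hB0, hB⟩ := hF.2 (‖u₀‖ * Real.exp (K * max T 0))
  refine ⟨B, hB0, fun t ω ht => hB _ _ ((norm_solH_le hK0 hK t ω).trans ?_)⟩
  gcongr
  exact (le_abs_self t).trans ht

theorem hasCentredIncrements_generator (hm : IsDrivingProcess P ℱ E m Pt DM) (hε : 0 < ε)
    (hΨ : IsGoodTestFunction Pt DM Ψ) : HasCentredIncrements P (fun t => ℱ (t / ε ^ 2))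
      fun t ω => alongH a m ε u₀ Ψ t ω - timeIntegral (alongH a m ε u₀ (generator a Pt ε Ψ)) t ω := by
  intro s t hs hst A hA
  have hj := (hΨ.isObservable_generator hm.bounded a ε).isTame (a := a) (ε := ε) (u₀ := u₀) hm
  rw [← setIntegral_generator (a := a) (u₀ := u₀) hm hε hΨ hs hst hA]
  refine congrArg _ ?_
  funext ω
  have h := hj.timeIntegral_sub hs hst ω
  simp only [alongH] at h ⊢
  linarith

theorem HasCentredIncrements.isContMartingale {N : ℝ → Ω → ℝ} {X : ℝ≥0 → Ω → ℝ}
    (hN : HasCentredIncrements P (fun t => ℱ (t / ε ^ 2)) N)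
    (hNt : IsTame P (fun t => ℱ (t / ε ^ 2)) N)
    (hc : ∀ᵐ ω ∂P, Continuous fun t : ℝ≥0 => N t ω) (he : ∀ᵐ ω ∂P, ∀ t : ℝ≥0, X t ω = N t ω) :
    IsContMartingale X (scaledFiltration ℱ ε) P := by
  have he' : ∀ t : ℝ≥0, N t =ᵐ[P] X t := fun t => he.mono fun ω h => (h t).symm
  have hs : ∀ (t : ℝ≥0) (A : Set Ω), ∫ ω in A, X t ω ∂P = ∫ ω in A, N t ω ∂P := fun t A =>
    integral_congr_ae (ae_restrict_of_ae (he' t).symm)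
  refine isContMartingale_of_setIntegral (fun t => (hNt.adapted t).congr (he' t))
    (fun t => (hNt.integrable t).congr (he' t)) (fun s t hst A hA => ?_) ?_
  · rw [hs, hs, ← sub_eq_zero, ← integral_sub (hNt.integrable t).integrableOn
      (hNt.integrable s).integrableOn]
    exact hN s t s.2 hst A hA
  · filter_upwards [hc, he] with ω h1 h2
    exact h1.congr fun t => (h2 t).symm

theorem IsObservable.ae_intervalIntegrable_along (hF : IsObservable F)
    (hm : IsDrivingProcess P ℱ E m Pt DM) {f : ℝ → Ω → L2xv d μ}
    (hf : IsSolution P a m ε (toL2 u₀) f) :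
    ∀ᵐ ω ∂P, ∀ t : ℝ≥0, IntervalIntegrable (fun s => along m ε f F s ω) volume 0 t := by
  filter_upwards [ae_along_eq hm hf] with ω hω t
  refine ((hF.isTame (a := a) (ε := ε) (u₀ := u₀) hm).intervalIntegrable 0 t ω).congr
    fun s hs => (hω F s ?_).symm
  rw [uIoc_of_le t.coe_nonneg] at hs
  exact hs.1.le

end SolutionProcess

end KineticDiffusion

end

/-! ### The martingale and its quadratic variation. -/

theorem propositiont5 {V : Type*} [MeasurableSpace V] (μ : MeasureTheory.Measure V)
    [MeasureTheory.IsProbabilityMeasure μ] {d : ℕ}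
    (a : MeasureTheory.Lp (EuclideanSpace ℝ (Fin d)) ⊤ μ)
    {Ω : Type*} {mΩ : MeasurableSpace Ω} (P : MeasureTheory.Measure Ω)
    [MeasureTheory.IsProbabilityMeasure P]
    (ℱ : MeasureTheory.Filtration ℝ mΩ) (E : Set (KineticDiffusion.W1inf d))
    (m : ℝ → Ω → E) (Pt : ℝ≥0 → ProbabilityTheory.Kernel E E) (DM : Set (E →ᵇ ℝ))
    (hm : KineticDiffusion.IsDrivingProcess P ℱ E m Pt DM)
    (ε : ℝ) (hε : 0 < ε)
    (f₀ : KineticDiffusion.L2H1 d μ) (f : ℝ → Ω → KineticDiffusion.L2xv d μ)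
    (hf : KineticDiffusion.IsSolution P a m ε (KineticDiffusion.toL2 f₀) f)
    (Ψ : KineticDiffusion.L2H1 d μ → E → ℝ)
    (hΨ : KineticDiffusion.IsGoodTestFunction Pt DM Ψ) :
    -- almost surely, `f(t)` lies in `L²(V; H¹)` for all `t ≥ 0`, and `𝓛^εΨ` can be integrated
    (∀ᵐ ω ∂P, ∀ t : ℝ≥0, (∃ u, KineticDiffusion.toL2 u = f t ω) ∧
      IntervalIntegrable
        (fun s => KineticDiffusion.along m ε f (KineticDiffusion.generator a Pt ε Ψ) s ω)
        MeasureTheory.volume 0 t) ∧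
    KineticDiffusion.IsContMartingale (KineticDiffusion.testProcess a Pt m ε f Ψ)
      (KineticDiffusion.scaledFiltration ℱ ε) P ∧
    -- the quadratic variation, as soon as `𝓛^ε|Ψ|²` is defined
    (KineticDiffusion.IsGoodTestFunction Pt DM (fun u n => Ψ u n ^ 2) →
      (∀ᵐ ω ∂P, ∀ t : ℝ≥0, IntervalIntegrable
        (fun s => KineticDiffusion.along m ε f (KineticDiffusion.carreDuChamp a Pt ε Ψ) s ω)
        MeasureTheory.volume 0 t) ∧
      KineticDiffusion.IsQuadraticVariation (KineticDiffusion.testProcess a Pt m ε f Ψ)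
        (fun t ω => ∫ s in (0 : ℝ)..t,
          KineticDiffusion.along m ε f (KineticDiffusion.carreDuChamp a Pt ε Ψ) s ω)
        (KineticDiffusion.scaledFiltration ℱ ε) P) := by
  have hE := hm.bounded
  have hX := (hΨ.isObservable hE).isTame (a := a) (ε := ε) (u₀ := f₀) hm
  have hg := hΨ.isObservable_generator hE a ε
  have hj := hg.isTame (a := a) (ε := ε) (u₀ := f₀) hm
  have hle : ∀ t : ℝ, ℱ (t / ε ^ 2) ≤ mΩ := fun t => ℱ.le _
  have hmono := KineticDiffusion.monotone_scaled ℱ ε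
  have hN := hX.sub (hj.timeIntegral hle hmono)
  have hNc := KineticDiffusion.hasCentredIncrements_generator (a := a) (u₀ := f₀) hm hε hΨ
  have hNp : ∀ᵐ ω ∂P, Continuous fun t : ℝ≥0 =>
      KineticDiffusion.alongH a m ε f₀ Ψ t ω -
        KineticDiffusion.timeIntegral
          (KineticDiffusion.alongH a m ε f₀ (KineticDiffusion.generator a Pt ε Ψ)) t ω := by
    filter_upwards [KineticDiffusion.ae_continuous_alongH (a := a) (ε := ε) (u₀ := f₀) hm hΨ]
      with ω hω
    exact hω.sub (hj.continuous_timeIntegral ω)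
  have hNe : ∀ᵐ ω ∂P, ∀ t : ℝ≥0, KineticDiffusion.testProcess a Pt m ε f Ψ t ω =
      KineticDiffusion.alongH a m ε f₀ Ψ t ω -
        KineticDiffusion.timeIntegral
          (KineticDiffusion.alongH a m ε f₀ (KineticDiffusion.generator a Pt ε Ψ)) t ω := by
    filter_upwards [KineticDiffusion.ae_along_eq hm hf, KineticDiffusion.ae_integral_along_eq hm hf]
      with ω h1 h2 t
    rw [KineticDiffusion.testProcess, h1 Ψ t t.coe_nonneg, h2]
  refine ⟨?_, hNc.isContMartingale hN hNp hNe, fun hΨ2 => ?_⟩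
  · filter_upwards [KineticDiffusion.ae_eq_toL2_solH hm hf,
      hg.ae_intervalIntegrable_along hm hf] with ω h1 h2 t
    exact ⟨⟨_, (h1 t t.coe_nonneg).symm⟩, h2 t⟩
  · have hq := KineticDiffusion.isObservable_carreDuChamp hΨ hΨ2 hE a ε
    have hQ := hq.isTame (a := a) (ε := ε) (u₀ := f₀) hm
    have hk := (hΨ2.isObservable_generator hE a ε).isTame (a := a) (ε := ε) (u₀ := f₀) hm
    have hQt := hQ.timeIntegral hle hmono
    have hi := hq.ae_intervalIntegrable_along hm hf
    have hQe := KineticDiffusion.ae_integral_along_eq hm hf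
    have hpos := fun t ω => KineticDiffusion.carreDuChamp_nonneg (a := a) (ε := ε) hm hΨ hΨ2
      (KineticDiffusion.solH a ε (KineticDiffusion.noiseW m ε) f₀ t ω)
      (KineticDiffusion.noise m ε t ω)
    -- Here `X = Ψ`, `j = 𝓛^εΨ` and `k = 𝓛^ε|Ψ|²` along the solution, so `k - 2Xj` is by definition
    -- the carré du champ.
    have hbr := KineticDiffusion.HasCentredIncrements.sq_sub hle hmono hX hj hk hNc
      (KineticDiffusion.hasCentredIncrements_generator (a := a) (u₀ := f₀) hm hε hΨ2)
    refine ⟨hi, fun t => ?_, ?_, ?_, ?_, ?_⟩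
    · exact (hQt.adapted t).congr (hQe.mono fun ω h => (h _ t).symm)
    · exact Filter.Eventually.of_forall fun ω => by simp
    · filter_upwards [hQe] with ω h s t hst
      simp only [h]
      exact KineticDiffusion.timeIntegral_mono hQ hpos hst ω
    · filter_upwards [hQe] with ω h
      simp only [h]
      exact hQ.continuous_timeIntegral ω
    · refine hbr.isContMartingale ((hN.mul hN).sub hQt |>.congr fun t ω => ?_) ?_ ?_
      · rw [pow_two]; rfl
      · filter_upwards [hNp] with ω h
        exact (h.pow 2).sub (hQ.continuous_timeIntegral ω)
      · filter_upwards [hNe, hQe] with ω h1 h2 t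
        rw [h1, h2]
        rfl
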